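/- **Setting.** Let $\Omega\subset\mathbb R^d$ be compact, $Y$ a real Hilbert space, $\mathcal M=\mathcal C(\Omega)^*$ the space of Radon measures on $\Omega$ with its dual norm, $\alpha>0$, $\kappa:\Omega\to Y$ Hölder continuous, $Ku=\int_\Omega\kappa\,du$, and $F:Y\to[0,\infty)$ strictly convex and continuously differentiable with $L_{\nabla F}$-Lipschitz gradient. Put $J(u)=F(Ku)+\alpha\|u\|_{\mathcal M}$, $r_J(u)=J(u)-\min_{\mathcal M}J$, $p_u(x)=-(\kappa(x),\nabla F(Ku))_Y$, $\varphi(u,v)=\langle p_u,v-u\rangle+\alpha\|u\|_{\mathcal M}-\alpha\|v\|_{\mathcal M}$. Assume moreover that $\kappa\in\mathcal C^{2,1}(\Omega;Y)$ and that $F$ is twice continuously Fréchet differentiable with locally Lipschitz second derivative. Let $\bar u$ be a minimizer of $J$ and $\bar p=p_{\bar u}$. Assume that for some $\gamma,\theta,R',\sigma'>0$ with $\sigma'<\alpha$: (B1) $(\nabla F(y_1)-\nabla F(y_2),y_1-y_2)_Y\ge\gamma\|y_1-y_2\|_Y^2$ for $y_1,y_2$ in a neighbourhood of $K\bar u$;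 (B2) $\{x\in\Omega:|\bar p(x)|=\alpha=\|\bar p\|_{\mathcal C}\}=\{\bar x^1,\dots,\bar x^{\bar N}\}\subset\operatorname{int}\Omega$ with distinct $\bar x^j$ and $\kappa(\bar x^1),\dots,\kappa(\bar x^{\bar N})$ linearly independent; (B3) $\Omega_{R'}=\bigcup_jB_{R'}(\bar x^j)\subset\operatorname{int}\Omega$, $|\bar p|\le\alpha-\sigma'$ on $\Omega\setminus\overline{\Omega_{R'}}$, and the balls $B_{2R'}(\bar x^j)$ are pairwise disjoint; (B4) $-\operatorname{sign}(\bar p(\bar x^j))\nabla^2\bar p(\bar x^j)\ge\theta\,\mathrm{Id}$ for all $j$; (B5) $\operatorname{supp}\bar u=\{\bar x^1,\dots,\bar x^{\bar N}\}$. For $z=(\mathbf x,\lambda)\in\mathcal Z^N=\Omega^N\times\mathbb R^N$ (Euclidean norm) let $\mathcal U(z)=\sum_j\lambda_j\delta_{x^j}$ and $\mathcal J_N(z)=F(K\mathcal U(z))+\alpha|\lambda|_{\ell_1}$; gradient and Hessian of $\mathcal J_N$ are taken on $\mathring{\mathcal Z}^N=\operatorname{int}(\Omega)^N\times(\mathbb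 R\setminus\{0\})^N$ and extended continuously. Let $\mathrm{Newton}(z)=z-\nabla^2\mathcal J_N(z)^{-1}\nabla\mathcal J_N(z)$ if the Hessian is invertible and $\mathrm{Newton}(z)=z$ otherwise. For a sparse (finitely supported) measure $u$ write $\mathcal A_u=\operatorname{supp}u$; a minimal representer of $u$ is a $z\in\mathcal Z^N$, $N=\#\mathcal A_u$, with $\mathcal U(z)=u$. Let $\bar{\mathcal Z}=\operatorname{argmin}_{\mathcal Z^{\bar N}}\mathcal J_{\bar N}$. **Parameters.** $M>0$, $0<R\le R'$, $\sigma>0$, $L\ge L_{\nabla F}$, $C_K\ge\sup_\Omega\|\kappa\|_Y$ with $C_K>0$, $C=4LM^2C_K^2$, and $m,\bar m>0$ such that all eigenvalues of $\nabla^2\mathcal J_{\bar N}(\bar z)^{-1}$, $\bar z\in\bar{\mathcal Z}$, lie in $[m,\bar m]$. **Algorithm (NLGCG).** Subroutines, for sparse $u$: *LGCGStep$(u,\varepsilon)$*: put $v_u(x)=M\operatorname{sign}(p_u(x))\delta_x$. If there is $v\in\{0\}\cup\{v_u(x):x\in\Omega\}$ with $\varphi(u,v)\ge M\varepsilon$,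 choose one and set $\eta=\min\{1,M\varepsilon/C\}$, $\varepsilon_+=\varepsilon$. Otherwise let $v=0$ if $\|p_u\|_{\mathcal C}<\alpha$ and $v=v_u(\hat x)$ with some $\hat x\in\operatorname{argmax}|p_u|$ else, $\Phi=\varphi(u,v)$, $\eta=\min\{1,\Phi/C\}$, $\varepsilon_+=\Phi/(2M)$. Return $((1-\eta)u+\eta v,\varepsilon_+)$. *DropStep$(u)$*: delete from $u$ all atoms $x$ with $\operatorname{sign}p_u(x)\ne\operatorname{sign}u(\{x\})$ or $|p_u(x)|\le\alpha-\sigma/2$; return the result if this does not increase $J$, else return $u$. *CoefficientStep$(u,\Psi)$*: for $w\ge0$ supported in $\mathcal A_u$ let $v_w=\sum_{x\in\mathcal A_u}\operatorname{sign}(u(\{x\}))w(\{x\})\delta_x$; return some $v_w$ with $J(v_w)\le J(u)$ whose dual gap is at most $\Psi$, i.e. $\sum_{x\in\mathcal A_u}\operatorname{sign}(u(\{x\}))p_{v_w}(x)(v(\{x\})-w(\{x\}))+\alpha\|w\|_{\mathcal M}-\alpha\|v\|_{\mathcal M}\le\Psi$ for all $v\ge0$ supported in $\mathcal A_u$ with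 $\|v\|_{\mathcal M}\le M$. *LM$(u)$*: start with $\mathcal A=\mathcal A_u$ and the measure $0$; while $\mathcal A\neq\emptyset$ choose $x\in\operatorname{argmax}_{\mathcal A}|p_u|$, add $u(B_{2R}(x))\delta_x$, and replace $\mathcal A$ by $\mathcal A\setminus B_{2R}(x)$. Acceptance conditions, with $z_+=(\mathbf x_+,\lambda_+)=\mathrm{Newton}(z)$: (A1) $z_+\in\mathcal Z^N$, $|\lambda_+|_{\ell_1}\le M$, $\mathcal J_N(z_+)-\mathcal J_N(z)\le-\frac m8\|\nabla\mathcal J_N(z)\|^2$; (A2) for $\varepsilon$: $\|\nabla\mathcal J_N(z)\|^2\ge\frac{M^2\varepsilon^2}{2C\bar m}$ if $M\varepsilon\le C$, and $\|\nabla\mathcal J_N(z)\|^2\ge\frac{2M\varepsilon-C}{2\bar m}$ otherwise. Inputs: a sparse $u_1$ such that $J(v)\le J(u_1)$ implies $\|v\|_{\mathcal M}\le M$; $\varepsilon_1$ with $r_J(u_1)\le2M\varepsilon_1$; $\Psi_1>0$; $S\in\mathbb N$, $S\geq 1$. For $k=1,2,\dots$: let $(u_k^{GCG},\varepsilon_{k+1})=$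 LGCGStep$(u_k,\varepsilon_k)$ and terminate with $u_k$ if $\varepsilon_{k+1}=0$; let $u_k^{coef}=$ CoefficientStep$($DropStep$(u_k^{GCG}),\Psi_k)$, $u_{k,1}=$ LM$(u_k^{coef})$, $\varepsilon_{k,1}=\varepsilon_{k+1}+\frac{J(u_{k,1})-J(u_k^{coef})}{2M}$. Inner loop, for $s=1,2,\dots$: choose a minimal representer $z_{k,s}$ of $u_{k,s}$ and set $z_{k,s}^{New}=\mathrm{Newton}(z_{k,s})$, $u_{k,s}^{New}=\mathcal U(z_{k,s}^{New})$, $u_{k,s}^{GCG}=u_{k,s}$. If (A2) holds for $\varepsilon_{k,s}$, put $\varepsilon_{k,s+1}=\varepsilon_{k,s}$. Otherwise let $(u_{k,s}^{GCG},\varepsilon_{k,s+1})=$ LGCGStep$(u_{k,s},\varepsilon_{k,s})$, terminate with $u_{k,s}$ if $\varepsilon_{k,s+1}=0$, and leave the inner loop if (A2) fails for $\varepsilon_{k,s+1}$. Leave the inner loop if (A1) fails. If $S\mid s$, let $u_{k,s}^{drop}=$ DropStep$(u_{k,s}^{New})$, $u_{k,s+1}=$ LM$(u_{k,s}^{drop})$,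 and add $\frac{J(u_{k,s+1})-J(u_{k,s}^{drop})}{2M}$ to $\varepsilon_{k,s+1}$; else $u_{k,s+1}=u_{k,s}^{New}$. When the inner loop is left, $u_{k+1}$ is a minimizer of $J$ among $u_k^{coef},u_{k,1},u_{k,s}^{GCG}$ and, if $z_{k,s}^{New}\in\mathcal Z^N$, $u_{k,s}^{New}$; and $\Psi_{k+1}=\Psi_k/2$. **Statement.** There are $\nu_0\in(0,R)$ and $c_{New}>0$, independent of the inputs $u_1,\varepsilon_1,\Psi_1,S$ and of all choices made by the algorithm, such that for every $\bar z\in\bar{\mathcal Z}$ and every $z\in B_{\nu_0}(\bar z)$ $$z\in\mathring{\mathcal Z}^{\bar N},\qquad \mathrm{Newton}(z)\in B_{\nu_0}(\bar z),\qquad\|\mathrm{Newton}(z)-\bar z\|\le c_{New}\|z-\bar z\|^2,$$ and such that, with $C_{New}=8c_{New}^2\bar m^2/m$, the following holds. Let $u_{k,s}$ with a minimal representer $z_{k,s}$ be generated by the algorithm and suppose $\#\mathcal A_{u_{k,s}}=\bar N$ and $\operatorname{dist}(z_{k,s},\bar{\mathcal Z})<\nu_0$. (i) The Newton step from $z_{k,s}$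 is accepted: (A1) holds, (A2) holds for the threshold returned by any LGCGStep$(u_{k,s},\varepsilon_{k,s})$, and the inner loop is not left in iteration $s$. The measure $u^{New}_{k,s}$ is unchanged by drop and merge: DropStep$(u^{New}_{k,s})=u^{New}_{k,s}$, and $u^{New}_{k,s}$ is the only possible output of LM$(u^{New}_{k,s})$. (ii) Either $u_{k,s+1}$ is well defined, or $u_{k,s}=\bar u$ and the algorithm terminates with this solution; termination in iteration $s$ occurs only if $u_{k,s}=\bar u$. If the algorithm goes on, then $u_{k,s+1}=u^{New}_{k,s}$. (iii) $\#\mathcal A_{u^{New}_{k,s}}=\bar N$, every minimal representer of $u^{New}_{k,s}$ has distance less than $\nu_0$ from $\bar{\mathcal Z}$, and $r_J(u^{New}_{k,s})\le C_{New}\,r_J(u_{k,s})^2$. (iv) From then on the algorithm never leaves the inner loop of iteration $k$, unless it terminates with the solution $\bar u$: every later state is either a state of this inner loop whose iterate again satisfies the two hypotheses and from which the algorithm can go on, or termination with $\bar u$. If the algorithm does not terminate, it yields an infinite sequence $(u_{k,s+n})_{n\ge0}$ in this inner loop with $\#\mathcal A_{u_{k,s+n}}=\bar N$ and $r_J(u_{k,s+n+1})\le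 C_{New}\,r_J(u_{k,s+n})^2$ for all $n\ge0$. -/

import Mathlib

open Set Topology
open scoped NNReal Gradient

noncomputable section

namespace NLGCG

/-- Euclidean space `ℝ^d`. -/
abbrev Eucl (d : ℕ) := EuclideanSpace ℝ (Fin d)

/-- The data `(Ω, κ, F, α)` of the problem `min_{u ∈ M(Ω)} F(Ku) + α ‖u‖`, `Ku = ∫ κ du`, with its
standing assumptions: `Ω` compact, `κ` Hölder continuous on `Ω` (the values of `κ` outside `Ω` are
irrelevant), `F ≥ 0` strictly convex and continuously differentiable with Lipschitz gradient. -/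
structure SparseProblem (d : ℕ) (Y : Type*) [NormedAddCommGroup Y] [InnerProductSpace ℝ Y]
    [CompleteSpace Y] where
  Ω : Set (Eucl d)
  isCompact : IsCompact Ω
  κ : Eucl d → Y
  κ_holder : ∃ ν : ℝ≥0, 0 < ν ∧ ∃ C : ℝ≥0, HolderOnWith C ν κ Ω
  F : Y → ℝ
  F_nonneg : ∀ y, 0 ≤ F y
  F_strictConvex : StrictConvexOn ℝ univ F
  F_contDiff : ContDiff ℝ 1 F
  LF : ℝ
  LF_pos : 0 < LF
  F_lipschitz : ∀ y₁ y₂, ‖∇ F y₁ - ∇ F y₂‖ ≤ LF * ‖y₁ - y₂‖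
  α : ℝ
  α_pos : 0 < α

namespace SparseProblem

variable {d : ℕ} {Y : Type*} [NormedAddCommGroup Y] [InnerProductSpace ℝ Y] [CompleteSpace Y]
variable (P : SparseProblem d Y)

instance : CompactSpace P.Ω := isCompact_iff_compactSpace.mp P.isCompact

/-! ### Measures, the forward operator, the objective, the dual variable -/

/-- The space of Radon measures on `Ω`: the topological dual of `C(Ω)`, with the dual norm. The
duality pairing `⟨φ, u⟩` is the value `u φ`. -/
abbrev Meas := StrongDual ℝ C(P.Ω, ℝ)

/-- The kernel as a continuous function on `Ω`. -/
def kernel : C(P.Ω, Y) where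
  toFun x := P.κ x
  continuous_toFun := by
    obtain ⟨ν, hν, C, h⟩ := P.κ_holder
    exact continuousOn_iff_continuous_domRestrict.mp (h.continuousOn hν)

/-- `K_* : Y → C(Ω)`, `(K_* y)(x) = (κ(x), y)`. -/
def Kstar : Y →L[ℝ] C(P.Ω, ℝ) :=
  LinearMap.mkContinuous
    { toFun := fun y =>
        { toFun := fun x => inner ℝ (P.kernel x) y
          continuous_toFun := P.kernel.continuous.inner continuous_const }
      map_add' := fun y z => by ext x; simp [inner_add_right]
      map_smul' := fun c y => by ext x; simp [inner_smul_right] }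
    ‖P.kernel‖
    (fun y => (ContinuousMap.norm_le _ (by positivity)).2 fun x =>
      (abs_real_inner_le_norm _ _).trans
        (mul_le_mul_of_nonneg_right (P.kernel.norm_coe_le_norm x) (norm_nonneg y)))

/-- `Ku = ∫ κ du`, as the weak (Pettis) integral: the element of `Y` with
`(Ku, y) = ⟨K_* y, u⟩` for all `y`. -/
def K (u : P.Meas) : Y := (InnerProductSpace.toDual ℝ Y).symm (u.comp P.Kstar)

theorem inner_K (u : P.Meas) (y : Y) : inner ℝ (P.K u) y = u (P.Kstar y) := by
  simp [K]

/-- `J(u) = F(Ku) + α ‖u‖`. -/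
def J (u : P.Meas) : ℝ := P.F (P.K u) + P.α * ‖u‖

/-- The residual `r_J(u) = J(u) - min J`. -/
def residual (u : P.Meas) : ℝ := P.J u - ⨅ v : P.Meas, P.J v

/-- The dual variable `p_u = -K_* ∇F(Ku)`. -/
def p (u : P.Meas) : C(P.Ω, ℝ) := -P.Kstar (∇ P.F (P.K u))

/-- `φ(u,v) = ⟨p_u, v - u⟩ + α‖u‖ - α‖v‖`. -/
def gap (u v : P.Meas) : ℝ := (v - u) (P.p u) + P.α * ‖u‖ - P.α * ‖v‖

/-- The Dirac measure at `x`. -/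
def dirac (x : P.Ω) : P.Meas := ContinuousMap.evalCLM ℝ x

/-- The support of a measure. -/
def supp (u : P.Meas) : Set P.Ω :=
  {x | ∀ U ∈ 𝓝 x, ∃ φ : C(P.Ω, ℝ), Function.support φ ⊆ U ∧ u φ ≠ 0}

/-- Sparse measures `u = ∑ λ_j δ_{x_j}`: `u x` is the mass `u({x})`, and `u.support` is the finite
support `A_u`. -/
abbrev Sparse := P.Ω →₀ ℝ

/-- The measure given by a sparse measure. -/
def toMeas : P.Sparse →ₗ[ℝ] P.Meas := Finsupp.linearCombination ℝ P.dirac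

/-! ### Second order assumptions -/

/-- `κ ∈ C^{2,1}(Ω; Y)`: twice continuously differentiable in the interior, with derivatives that
extend continuously to `Ω`, the second one being Lipschitz continuous. -/
structure KernelC21 : Prop where
  contDiffOn : ContDiffOn ℝ 2 P.κ (interior P.Ω)
  fderiv_extends : ∃ g, ContinuousOn g P.Ω ∧ EqOn g (fderiv ℝ P.κ) (interior P.Ω)
  fderiv2_extends :
    ∃ g, ContinuousOn g P.Ω ∧ EqOn g (fderiv ℝ (fderiv ℝ P.κ)) (interior P.Ω)
  fderiv2_lipschitz :
    ∃ C : ℝ≥0, LipschitzOnWith C (fderiv ℝ (fderiv ℝ P.κ)) (interior P.Ω)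

/-- The formula `x ↦ -(κ(x), ∇F(Ku))` for `p_u`, as a function on `ℝ^d`, so that it can be
differentiated at interior points of `Ω`. -/
def pFun (u : P.Meas) (x : Eucl d) : ℝ := -inner ℝ (P.κ x) (∇ P.F (P.K u))

/-- The non-degeneracy assumptions at the solution `ubar`, with points `xbar j`, `j < Nbar`,
strong convexity constant `γ`, curvature constant `θ`, radius `R'` and margin `σ'`. (The required
`C²`-regularity of `κ` on the closure of `⋃ B_{R'}(xbar j)` is part of `KernelC21`.) -/
structure NonDegenerate (ubar : P.Meas) {Nbar : ℕ} (xbar : Fin Nbar → Eucl d)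
    (γ θ R' σ' : ℝ) : Prop where
  minimizer : ∀ v, P.J ubar ≤ P.J v
  γ_pos : 0 < γ
  strong_convexity : ∃ V ∈ 𝓝 (P.K ubar), ∀ y₁ ∈ V, ∀ y₂ ∈ V,
    γ * ‖y₁ - y₂‖ ^ 2 ≤ inner ℝ (∇ P.F y₁ - ∇ P.F y₂) (y₁ - y₂)
  injective : Function.Injective xbar
  mem_interior : ∀ j, xbar j ∈ interior P.Ω
  range_eq : range xbar =
    Subtype.val '' {x : P.Ω | |P.p ubar x| = P.α ∧ P.α = ‖P.p ubar‖}
  linearIndependent : LinearIndependent ℝ fun j => P.κ (xbar j)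
  R'_pos : 0 < R'
  σ'_pos : 0 < σ'
  σ'_lt : σ' < P.α
  ball_subset : (⋃ j, Metric.ball (xbar j) R') ⊆ interior P.Ω
  away : ∀ x : P.Ω, (x : Eucl d) ∉ closure (⋃ j, Metric.ball (xbar j) R') →
    |P.p ubar x| ≤ P.α - σ'
  disjoint : ∀ i j, i ≠ j →
    Disjoint (Metric.ball (xbar i) (2 * R')) (Metric.ball (xbar j) (2 * R'))
  θ_pos : 0 < θ
  curvature : ∀ j, ∀ h : Eucl d, θ * ‖h‖ ^ 2 ≤
    -Real.sign (P.pFun ubar (xbar j)) * fderiv ℝ (fderiv ℝ (P.pFun ubar)) (xbar j) h h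
  supp_eq : Subtype.val '' P.supp ubar = range xbar

/-! ### The finite-dimensional problem in positions and coefficients -/

end SparseProblem

/-- Pairs `z = (x, λ) ∈ (ℝ^d)^N × ℝ^N` with the Euclidean norm; `z.fst j = x^j`,
`z.snd j = λ^j`. -/
abbrev ZSpace (d N : ℕ) := WithLp 2 (PiLp 2 (fun _ : Fin N => Eucl d) × EuclideanSpace ℝ (Fin N))

namespace SparseProblem

variable {d : ℕ} {Y : Type*} [NormedAddCommGroup Y] [InnerProductSpace ℝ Y] [CompleteSpace Y]
variable (P : SparseProblem d Y)

/-- `Z^N = Ω^N × ℝ^N`. -/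
def Z (N : ℕ) : Set (ZSpace d N) := {z | ∀ j, z.fst j ∈ P.Ω}

/-- `int(Ω)^N × (ℝ \ {0})^N`. -/
def Zint (N : ℕ) : Set (ZSpace d N) := {z | ∀ j, z.fst j ∈ interior P.Ω ∧ z.snd j ≠ 0}

open Classical in
/-- `U(z) = ∑ λ_j δ_{x_j}`, meant for `z ∈ Z^N` (atoms outside `Ω` are ignored). -/
def U {N : ℕ} (z : ZSpace d N) : P.Sparse :=
  ∑ j, if h : z.fst j ∈ P.Ω then Finsupp.single ⟨z.fst j, h⟩ (z.snd j) else 0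

/-- `J_N(z) = F(∑ λ_j κ(x_j)) + α |λ|_1`. -/
def JN {N : ℕ} (z : ZSpace d N) : ℝ :=
  P.F (∑ j, z.snd j • P.κ (z.fst j)) + P.α * ∑ j, |z.snd j|

/-- The gradient of `J_N`, extended continuously from `int(Ω)^N × (ℝ \ {0})^N`. -/
def gradJN {N : ℕ} : ZSpace d N → ZSpace d N :=
  extendFrom (P.Zint N) (∇ (P.JN (N := N)))

/-- The Hessian of `J_N`, extended continuously from `int(Ω)^N × (ℝ \ {0})^N`. -/
def hessJN {N : ℕ} : ZSpace d N → (ZSpace d N →L[ℝ] ZSpace d N) :=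
  extendFrom (P.Zint N) (fderiv ℝ (∇ (P.JN (N := N))))

open Classical in
/-- The Newton update. -/
def newton {N : ℕ} (z : ZSpace d N) : ZSpace d N :=
  if (P.hessJN z).det ≠ 0 then z - (P.hessJN z).inverse (P.gradJN z) else z

/-- The set of global minimizers of `J_N` over `Z^N`. -/
def argminJN (N : ℕ) : Set (ZSpace d N) := {z ∈ P.Z N | ∀ z' ∈ P.Z N, P.JN z ≤ P.JN z'}

/-- `z` is a minimal representer of `u`: `z ∈ Z^N` with `N = #A_u` and `U(z) = u`. -/
def IsMinRep (u : P.Sparse) {N : ℕ} (z : ZSpace d N) : Prop :=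
  u.support.card = N ∧ z ∈ P.Z N ∧ P.U z = u

end SparseProblem

/-! ### The algorithm -/

/-- The parameters of the algorithm: the norm bound `M`, the radius `R`, the margin `σ`, the
Lipschitz bound `L` for `∇F`, the bound `CK` for `κ`, and the estimates `m`, `mbar` for the
eigenvalues of the inverse Hessian. -/
structure Params where
  M : ℝ
  R : ℝ
  σ : ℝ
  L : ℝ
  CK : ℝ
  m : ℝ
  mbar : ℝ

/-- `C = 4 L M² C_K²`. -/
def Params.C (A : Params) : ℝ := 4 * A.L * A.M ^ 2 * A.CK ^ 2

namespace SparseProblem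

variable {d : ℕ} {Y : Type*} [NormedAddCommGroup Y] [InnerProductSpace ℝ Y] [CompleteSpace Y]
variable (P : SparseProblem d Y) (A : Params)

/-- What is required of the parameters, where `R'` is the radius of the non-degeneracy
assumptions: `L` and `CK` bound the Lipschitz constant of `∇F` and the norm of `κ`, and `m`, `mbar`
bound the eigenvalues of the inverse Hessian of `J_Nbar` at its minimizers. -/
structure Admissible (Nbar : ℕ) (R' : ℝ) : Prop where
  M_pos : 0 < A.M
  R_pos : 0 < A.R
  R_le : A.R ≤ R'
  σ_pos : 0 < A.σ
  L_ge : P.LF ≤ A.L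
  CK_pos : 0 < A.CK
  CK_ge : ∀ x ∈ P.Ω, ‖P.κ x‖ ≤ A.CK
  m_pos : 0 < A.m
  mbar_pos : 0 < A.mbar
  eigenvalues : ∀ zbar ∈ P.argminJN Nbar, ∀ μ : ℝ,
    Module.End.HasEigenvalue ((P.hessJN zbar).inverse : ZSpace d Nbar →ₗ[ℝ] ZSpace d Nbar) μ →
      A.m ≤ μ ∧ μ ≤ A.mbar

/-- `v_u(x) = M sign(p_u(x)) δ_x`. -/
def vdir (u : P.Sparse) (x : P.Ω) : P.Sparse :=
  Finsupp.single x (A.M * Real.sign (P.p (P.toMeas u) x))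

/-- `v` is a lazy solution for `u` at tolerance `ε`. -/
def IsLazy (u : P.Sparse) (ε : ℝ) (v : P.Sparse) : Prop :=
  (v = 0 ∨ ∃ x, v = P.vdir A u x) ∧ A.M * ε ≤ P.gap (P.toMeas u) (P.toMeas v)

/-- `v` is an exact conditional gradient direction for `u`. -/
def IsExactDir (u v : P.Sparse) : Prop :=
  (‖P.p (P.toMeas u)‖ < P.α ∧ v = 0) ∨
  (P.α ≤ ‖P.p (P.toMeas u)‖ ∧
    ∃ x, (∀ y, |P.p (P.toMeas u) y| ≤ |P.p (P.toMeas u) x|) ∧ v = P.vdir A u x)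

/-- `LGCGStep`: `(u', ε')` is a possible output (updated measure and threshold) for input `u`, `ε`.
The first constructor is the lazy call, the second the exact call. -/
inductive LGCGStep (u : P.Sparse) (ε : ℝ) : P.Sparse → ℝ → Prop
  | lazy (v : P.Sparse) (η : ℝ) (hv : P.IsLazy A u ε v) (hη : η = min 1 (A.M * ε / A.C)) :
      LGCGStep u ε ((1 - η) • u + η • v) ε
  | exact (v : P.Sparse) (η Φ : ℝ) (hnone : ∀ v', ¬ P.IsLazy A u ε v')
      (hv : P.IsExactDir A u v) (hΦ : Φ = P.gap (P.toMeas u) (P.toMeas v))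
      (hη : η = min 1 (Φ / A.C)) :
      LGCGStep u ε ((1 - η) • u + η • v) (Φ / (2 * A.M))

open Classical in
/-- The measure `u` restricted to the complement of
`D_u = {x ∈ A_u | sign p_u(x) ≠ sign u({x}) or |p_u(x)| ≤ α - σ/2}`. -/
def dropMeas (u : P.Sparse) : P.Sparse :=
  u.filter fun x => ¬ (Real.sign (P.p (P.toMeas u) x) ≠ Real.sign (u x) ∨
    |P.p (P.toMeas u) x| ≤ P.α - A.σ / 2)

open Classical in
/-- `DropStep`. -/
def dropStep (u : P.Sparse) : P.Sparse :=
  if P.J (P.toMeas (P.dropMeas A u)) ≤ P.J (P.toMeas u) then P.dropMeas A u else u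

/-- The cone `M₊(A_u)` of positive measures supported in `A_u`. -/
def posCone (u : P.Sparse) : Set P.Sparse := {w | w.support ⊆ u.support ∧ ∀ x, 0 ≤ w x}

/-- `v^u_w = ∑ sign(u({x})) w({x}) δ_x`. -/
def signed (u w : P.Sparse) : P.Sparse :=
  Finsupp.zipWith (fun a b => Real.sign a * b) (by simp) u w

/-- `K^u w = ∑ κ(x) sign(u({x})) w({x})`. -/
def Ksigned (u w : P.Sparse) : Y := ∑ x ∈ u.support, (Real.sign (u x) * w x) • P.κ x

/-- `J^u(w) = F(K^u w) + α ‖w‖`. -/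
def Jsigned (u w : P.Sparse) : ℝ := P.F (P.Ksigned u w) + P.α * ‖P.toMeas w‖

/-- `p^u_w = -K^u_* ∇F(K^u w)`, a function on `A_u`. -/
def psigned (u w : P.Sparse) (x : P.Ω) : ℝ :=
  -(Real.sign (u x) * inner ℝ (P.κ x) (∇ P.F (P.Ksigned u w)))

/-- `φ^u(w,v) = ⟨p^u_w, v - w⟩ + α‖w‖ - α‖v‖`. -/
def gapSigned (u w v : P.Sparse) : ℝ :=
  ∑ x ∈ u.support, P.psigned u w x * (v x - w x) + P.α * ‖P.toMeas w‖ - P.α * ‖P.toMeas v‖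

/-- `Φ^u(w)`, the maximum of `φ^u(w, ·)` over `v ∈ M₊(A_u)` with `‖v‖ ≤ M`. -/
def dualGapSigned (u w : P.Sparse) : ℝ :=
  sSup (P.gapSigned u w '' {v | v ∈ P.posCone u ∧ ‖P.toMeas v‖ ≤ A.M})

/-- `CoefficientStep`: `u'` is a possible output (updated measure) for input `u` and accuracy
`Ψ`. -/
def CoefficientStep (u : P.Sparse) (Ψ : ℝ) (u' : P.Sparse) : Prop :=
  ∃ w ∈ P.posCone u, P.Jsigned u w ≤ P.Jsigned u (u.mapRange (fun a => |a|) abs_zero) ∧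
    P.dualGapSigned A u w ≤ Ψ ∧ u' = P.signed u w

open Classical in
/-- `u(B_r(x))`. -/
def massBall (u : P.Sparse) (x : P.Ω) (r : ℝ) : ℝ :=
  ∑ y ∈ u.support with y ∈ Metric.ball x r, u y

open Classical in
/-- The while loop of the local merging procedure: with active set `S` and current measure `l`,
the loop can end with the measure `l'`. -/
inductive MergeLoop (u : P.Sparse) : Finset P.Ω → P.Sparse → P.Sparse → Prop
  | finish (l : P.Sparse) : MergeLoop u ∅ l l
  | pick (S : Finset P.Ω) (l l' : P.Sparse) (x : P.Ω) (hx : x ∈ S)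
      (hmax : ∀ y ∈ S, |P.p (P.toMeas u) y| ≤ |P.p (P.toMeas u) x|)
      (h : MergeLoop u {y ∈ S | y ∉ Metric.ball x (2 * A.R)}
        (l + Finsupp.single x (P.massBall u x (2 * A.R))) l') :
      MergeLoop u S l l'

/-- Local merging: `u'` is a possible output for input `u`. -/
def LocalMerge (u u' : P.Sparse) : Prop := P.MergeLoop A u u.support 0 u'

/-- First acceptance condition for the Newton step from `z`. -/
def Accept₁ {N : ℕ} (z : ZSpace d N) : Prop :=
  P.newton z ∈ P.Z N ∧ ∑ j, |(P.newton z).snd j| ≤ A.M ∧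
    P.JN (P.newton z) - P.JN z ≤ -(A.m / 8) * ‖P.gradJN z‖ ^ 2

/-- Second acceptance condition for the Newton step from `z`, with threshold `ε`. -/
def Accept₂ {N : ℕ} (z : ZSpace d N) (ε : ℝ) : Prop :=
  (if A.M * ε ≤ A.C then A.M ^ 2 * ε ^ 2 / (2 * A.C * A.mbar)
    else (2 * A.M * ε - A.C) / (2 * A.mbar)) ≤ ‖P.gradJN z‖ ^ 2

/-- The part of the body of the inner loop that checks the second acceptance condition is passed,
with current conditional gradient iterate `uG` and threshold `ε'`. -/
def PassesGap (u : P.Sparse) (ε : ℝ) {N : ℕ} (z : ZSpace d N) (uG : P.Sparse) (ε' : ℝ) : Prop :=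
  (P.Accept₂ A z ε ∧ uG = u ∧ ε' = ε) ∨
  (¬ P.Accept₂ A z ε ∧ P.LGCGStep A u ε uG ε' ∧ ε' ≠ 0 ∧ P.Accept₂ A z ε')

/-- The possible outcomes of one pass through the body of the inner loop: the algorithm
terminates; the inner loop is left, with conditional gradient iterate `uG`; or the inner loop goes
on with the next iterate `u'` and threshold `ε'`. -/
inductive Outcome
  | terminate
  | leave (uG : P.Sparse)
  | next (u' : P.Sparse) (ε' : ℝ)

/-- One pass through the body of the inner loop in iteration `s`, from `u = u_{k,s}`,
`ε = ε_{k,s}` and the minimal representer `z = z_{k,s}`, with merging frequency `S`. -/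
inductive InnerBody (S s : ℕ) (u : P.Sparse) (ε : ℝ) {N : ℕ} (z : ZSpace d N) : P.Outcome → Prop
  | terminate (uG : P.Sparse) (h : ¬ P.Accept₂ A z ε) (hstep : P.LGCGStep A u ε uG 0) :
      InnerBody S s u ε z Outcome.terminate
  | leave₂ (uG : P.Sparse) (ε' : ℝ) (h : ¬ P.Accept₂ A z ε) (hstep : P.LGCGStep A u ε uG ε')
      (hε' : ε' ≠ 0) (h' : ¬ P.Accept₂ A z ε') :
      InnerBody S s u ε z (Outcome.leave uG)
  | leave₁ (uG : P.Sparse) (ε' : ℝ) (h : P.PassesGap A u ε z uG ε') (h₁ : ¬ P.Accept₁ A z) :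
      InnerBody S s u ε z (Outcome.leave uG)
  | merge (uG : P.Sparse) (ε' : ℝ) (u' : P.Sparse) (h : P.PassesGap A u ε z uG ε')
      (h₁ : P.Accept₁ A z) (hs : s % S = 0)
      (hm : P.LocalMerge A (P.dropStep A (P.U (P.newton z))) u') :
      InnerBody S s u ε z (Outcome.next u' (ε' +
        (P.J (P.toMeas u') - P.J (P.toMeas (P.dropStep A (P.U (P.newton z))))) / (2 * A.M)))
  | plain (uG : P.Sparse) (ε' : ℝ) (h : P.PassesGap A u ε z uG ε') (h₁ : P.Accept₁ A z)
      (hs : s % S ≠ 0) :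
      InnerBody S s u ε z (Outcome.next (P.U (P.newton z)) ε')

/-- The configurations of the algorithm: the start of outer iteration `k` with `u_k`, `ε_k`,
`Ψ_k`; the start of inner iteration `s` of outer iteration `k`, with the data `u_k^coef`,
`u_{k,1}`, `ε_{k+1}`, `Ψ_k` of the outer iteration and `u_{k,s}`, `ε_{k,s}`; and termination with
the measure `u`. -/
inductive Config
  | outer (k : ℕ) (u : P.Sparse) (ε Ψ : ℝ)
  | inner (k : ℕ) (ucoef u₁ : P.Sparse) (εout Ψ : ℝ) (s : ℕ) (u : P.Sparse) (ε : ℝ)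
  | done (u : P.Sparse)

/-- The measures among which the next outer iterate is chosen: `u_k^coef`, `u_{k,1}`,
`u_{k,s}^GCG`, and `u_{k,s}^New` (the latter only if the Newton update lies in `Z^N`, as it is not a
measure on `Ω` otherwise). -/
def candidates (ucoef u₁ uG : P.Sparse) {N : ℕ} (z : ZSpace d N) : Set P.Sparse :=
  {ucoef, u₁, uG} ∪ {w | P.newton z ∈ P.Z N ∧ w = P.U (P.newton z)}

/-- The algorithm with merging frequency `S`, as a (nondeterministic) transition relation between
configurations. -/
inductive Step (S : ℕ) : P.Config → P.Config → Prop
  | outer_terminate (k : ℕ) (u : P.Sparse) (ε Ψ : ℝ) (uG : P.Sparse)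
      (hstep : P.LGCGStep A u ε uG 0) :
      Step S (Config.outer k u ε Ψ) (Config.done u)
  | outer_enter (k : ℕ) (u : P.Sparse) (ε Ψ : ℝ) (uG : P.Sparse) (εout : ℝ) (ucoef u₁ : P.Sparse)
      (hstep : P.LGCGStep A u ε uG εout) (hε : εout ≠ 0)
      (hcoef : P.CoefficientStep A (P.dropStep A uG) Ψ ucoef) (hm : P.LocalMerge A ucoef u₁) :
      Step S (Config.outer k u ε Ψ)
        (Config.inner k ucoef u₁ εout Ψ 1 u₁
          (εout + (P.J (P.toMeas u₁) - P.J (P.toMeas ucoef)) / (2 * A.M)))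
  | inner_terminate (k : ℕ) (ucoef u₁ : P.Sparse) (εout Ψ : ℝ) (s : ℕ) (u : P.Sparse) (ε : ℝ)
      (N : ℕ) (z : ZSpace d N) (hz : P.IsMinRep u z)
      (h : P.InnerBody A S s u ε z Outcome.terminate) :
      Step S (Config.inner k ucoef u₁ εout Ψ s u ε) (Config.done u)
  | inner_next (k : ℕ) (ucoef u₁ : P.Sparse) (εout Ψ : ℝ) (s : ℕ) (u : P.Sparse) (ε : ℝ)
      (N : ℕ) (z : ZSpace d N) (hz : P.IsMinRep u z) (u' : P.Sparse) (ε' : ℝ)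
      (h : P.InnerBody A S s u ε z (Outcome.next u' ε')) :
      Step S (Config.inner k ucoef u₁ εout Ψ s u ε) (Config.inner k ucoef u₁ εout Ψ (s + 1) u' ε')
  | inner_leave (k : ℕ) (ucoef u₁ : P.Sparse) (εout Ψ : ℝ) (s : ℕ) (u : P.Sparse) (ε : ℝ)
      (N : ℕ) (z : ZSpace d N) (hz : P.IsMinRep u z) (uG : P.Sparse)
      (h : P.InnerBody A S s u ε z (Outcome.leave uG)) (unext : P.Sparse)
      (hmem : unext ∈ P.candidates ucoef u₁ uG z)
      (hmin : ∀ w ∈ P.candidates ucoef u₁ uG z, P.J (P.toMeas unext) ≤ P.J (P.toMeas w)) :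
      Step S (Config.inner k ucoef u₁ εout Ψ s u ε) (Config.outer (k + 1) unext εout (Ψ / 2))

/-- The configuration `c` is generated by the algorithm from the inputs `u₁`, `ε₁`, `Ψ₁`, `S`,
which are subject to: `M` bounds the norm on the sublevel set of `u₁`, `r_J(u₁) ≤ 2 M ε₁`, `Ψ₁ > 0`
and `S ≥ 1`. -/
def Generated (S : ℕ) (u₁ : P.Sparse) (ε₁ Ψ₁ : ℝ) (c : P.Config) : Prop :=
  (∀ v, P.J v ≤ P.J (P.toMeas u₁) → ‖v‖ ≤ A.M) ∧ P.residual (P.toMeas u₁) ≤ 2 * A.M * ε₁ ∧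
    0 < Ψ₁ ∧ 0 < S ∧ Relation.ReflTransGen (P.Step A S) (Config.outer 1 u₁ ε₁ Ψ₁) c

/-- `u` has exactly `Nbar` support points and every minimal representer of `u` has distance less
than `ν₀` from the set of minimizers of `J_Nbar`. -/
def Near (Nbar : ℕ) (ν₀ : ℝ) (u : P.Sparse) : Prop :=
  u.support.card = Nbar ∧
    ∀ z : ZSpace d Nbar, P.IsMinRep u z → Metric.infDist z (P.argminJN Nbar) < ν₀

/-- `B_ν₀(zbar) ⊆ int(Ω)^N × (ℝ \ {0})^N` for all minimizers `zbar` of `J_Nbar`, and the Newton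
update maps each of these balls to itself and converges quadratically there, with constant
`cNew`. -/
def NewtonContracts (Nbar : ℕ) (ν₀ cNew : ℝ) : Prop :=
  ∀ zbar ∈ P.argminJN Nbar, ∀ z ∈ Metric.ball zbar ν₀,
    z ∈ P.Zint Nbar ∧ P.newton z ∈ Metric.ball zbar ν₀ ∧
      ‖P.newton z - zbar‖ ≤ cNew * ‖z - zbar‖ ^ 2

end SparseProblem

end NLGCG

end

open NLGCG NLGCG.SparseProblem

/-!
Near the solution the algorithm is Newton's method for `J_Nbar`, and everything else in the loop
is inactive.

*The solution.* First-order optimality gives `|p_ubar| ≤ α` and `⟨p_ubar, ubar⟩ = α ‖ubar‖`. A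
measure with these two properties annihilates all functions that vanish where `|p_ubar| = α`
(`annihilates_of_pairing_eq`), so a minimizer is a combination of Dirac measures at the points
`xbar j`. By strict convexity of `F` and linear independence of the `κ (xbar j)` it is unique, and
the minimizers of `J_Nbar` are its minimal representers (`NonDegenerate.argminJN_eq`), which
differ only by the order of the atoms.

*The Hessian.* At a representer `z` of the solution, `J_N(w) - J_N(z)` is the remainder of the
linearization of `F` plus the defects `α |λ_j| - λ_j p_ubar(x_j)` of the atoms of `w`, all of them
nonnegative (`NonDegenerate.JN_sub_eq`). The curvature condition makes a defect grow quadratically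
when an atom moves, and the strong convexity of `F` does the same for the remainder when only the
coefficients change. Hence the Hessian is positive definite (`NonDegenerate.hessian_pos`), and the
eigenvalue bounds on its inverse turn into bounds `1 / mbar` and `1 / m` on its quadratic form. As
the second derivative of `J_N` is locally Lipschitz, `newton_local` gives the quadratic
contraction of the Newton error, and the comparison of `J_N - min J_N` with the squared distance
and the squared norm of the gradient.

*Acceptance.* The sufficient decrease is a consequence of these comparisons. The norm bound on the
coefficients needs `‖ubar‖ < M` strictly; equality would force the initial measure to be optimal,
and then the inner loop is never entered (`NonDegenerate.norm_lt_of_generated_inner`). All states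
satisfy `r_J(u) ≤ 2 M ε` (`NonDegenerate.invariant_of_generated`), so a threshold returned by a
conditional gradient step is nonnegative, and zero only at the solution. It is also at most the
dual gap along some direction, whence a conditional gradient step would decrease the objective by
the amount compared with the gradient in the second acceptance condition; the objective cannot
fall below its minimum, and the residual is at most `mbar ‖∇J_N‖²`
(`NonDegenerate.accept₂_of_gap`).

*Drop and merge.* Near the solution the dual variable at the atoms is close to `±α` with the right
signs, and the atoms are at distance at least `2R` from each other. So both steps return the
Newton iterate unchanged, which is again near the solution, and the statements about the whole run
follow by induction along the transition relation (`NonDegenerate.step_of_near`).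
-/

namespace NLGCG

open Filter

/-! ### Local regularity with a Lipschitz top derivative -/

section LipNear

/-- `f` is Lipschitz continuous on a neighbourhood of `x`. -/
def LipNear {E F : Type*} [PseudoMetricSpace E] [PseudoMetricSpace F] (f : E → F) (x : E) : Prop :=
  ∃ K : ℝ≥0, ∃ t ∈ 𝓝 x, LipschitzOnWith K f t

section Metric

variable {E F G : Type*} [PseudoMetricSpace E] [PseudoMetricSpace F] [PseudoMetricSpace G]

theorem LipNear.congr {f g : E → F} {x : E} (hf : LipNear f x) (h : f =ᶠ[𝓝 x] g) :
    LipNear g x := by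
  obtain ⟨K, t, ht, hK⟩ := hf
  refine ⟨K, t ∩ {y | f y = g y}, inter_mem ht h, fun y hy z hz => ?_⟩
  rw [← hy.2, ← hz.2]
  exact hK hy.1 hz.1

theorem LipNear.continuousAt {f : E → F} {x : E} (hf : LipNear f x) : ContinuousAt f x := by
  obtain ⟨K, t, ht, hK⟩ := hf
  exact hK.continuousOn.continuousAt ht

theorem LipNear.comp {g : F → G} {f : E → F} {x : E} (hg : LipNear g (f x)) (hf : LipNear f x) :
    LipNear (fun y => g (f y)) x := by
  have hc := hf.continuousAt
  obtain ⟨K, t, ht, hK⟩ := hf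
  obtain ⟨K', t', ht', hK'⟩ := hg
  exact ⟨K' * K, t ∩ f ⁻¹' t', inter_mem ht (hc ht'),
    hK'.comp (hK.mono inter_subset_left) fun y hy => hy.2⟩

theorem LipNear.prodMk {f : E → F} {g : E → G} {x : E} (hf : LipNear f x) (hg : LipNear g x) :
    LipNear (fun y => (f y, g y)) x := by
  obtain ⟨K, t, ht, hK⟩ := hf
  obtain ⟨K', t', ht', hK'⟩ := hg
  exact ⟨max K K', t ∩ t', inter_mem ht ht',
    (hK.mono inter_subset_left).prodMk (hK'.mono inter_subset_right)⟩

end Metric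

variable {E F G H : Type*} [NormedAddCommGroup E] [NormedSpace ℝ E] [NormedAddCommGroup F]
  [NormedSpace ℝ F] [NormedAddCommGroup G] [NormedSpace ℝ G] [NormedAddCommGroup H]
  [NormedSpace ℝ H]

theorem LipNear.of_contDiffAt {f : E → F} {x : E} (hf : ContDiffAt ℝ 1 f x) : LipNear f x :=
  hf.exists_lipschitzOnWith

section

variable {X : Type*} [PseudoMetricSpace X]

theorem LipNear.clm (L : F →L[ℝ] G) {f : X → F} {x : X} (hf : LipNear f x) :
    LipNear (fun y => L (f y)) x :=
  LipNear.comp (g := L) (LipNear.of_contDiffAt L.contDiff.contDiffAt) hf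

theorem LipNear.bilin (B : F →L[ℝ] G →L[ℝ] H) {f : X → F} {g : X → G} {x : X}
    (hf : LipNear f x) (hg : LipNear g x) : LipNear (fun y => B (f y) (g y)) x :=
  LipNear.comp (g := fun p : F × G => B p.1 p.2)
    (LipNear.of_contDiffAt B.isBoundedBilinearMap.contDiff.contDiffAt) (hf.prodMk hg)

theorem LipNear.add {f g : X → F} {x : X} (hf : LipNear f x) (hg : LipNear g x) :
    LipNear (fun y => f y + g y) x :=
  LipNear.comp (g := fun p : F × F => p.1 + p.2)
    (LipNear.of_contDiffAt contDiff_add.contDiffAt) (hf.prodMk hg)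

end

/-- `f` is differentiable near `x`, with a derivative that is Lipschitz near `x`. -/
def C1Lip (f : E → F) (x : E) : Prop :=
  (∀ᶠ y in 𝓝 x, DifferentiableAt ℝ f y) ∧ LipNear (fderiv ℝ f) x

/-- `f` is twice differentiable near `x`, with a second derivative that is Lipschitz near `x`. -/
def C2Lip (f : E → F) (x : E) : Prop :=
  (∀ᶠ y in 𝓝 x, DifferentiableAt ℝ f y) ∧ C1Lip (fderiv ℝ f) x

theorem C1Lip.of_hasFDerivAt {f : E → F} {f' : E → E →L[ℝ] F} {x : E}
    (h : ∀ᶠ y in 𝓝 x, HasFDerivAt f (f' y) y) (h' : LipNear f' x) : C1Lip f x :=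
  ⟨h.mono fun _ hy => hy.differentiableAt, h'.congr (h.mono fun _ hy => hy.fderiv.symm)⟩

theorem C1Lip.hasFDerivAt {f : E → F} {x : E} (hf : C1Lip f x) :
    ∀ᶠ y in 𝓝 x, HasFDerivAt f (fderiv ℝ f y) y := hf.1.mono fun _ hy => hy.hasFDerivAt

theorem C1Lip.congr {f g : E → F} {x : E} (hf : C1Lip f x) (h : f =ᶠ[𝓝 x] g) :
    C1Lip g x :=
  ⟨(hf.1.and h.eventuallyEq_nhds).mono fun _ hy => hy.1.congr_of_eventuallyEq hy.2.symm,
    hf.2.congr h.fderiv⟩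

theorem C1Lip.contDiffAt {f : E → F} {x : E} (hf : C1Lip f x) : ContDiffAt ℝ 1 f x := by
  obtain ⟨K, t, ht, hK⟩ := hf.2
  exact contDiffAt_one_iff.2 ⟨fderiv ℝ f, t ∩ {y | DifferentiableAt ℝ f y}, inter_mem ht hf.1,
    hK.continuousOn.mono inter_subset_left, fun y hy => hy.2.hasFDerivAt⟩

theorem C1Lip.lipNear {f : E → F} {x : E} (hf : C1Lip f x) : LipNear f x :=
  LipNear.of_contDiffAt hf.contDiffAt

theorem C1Lip.comp {g : F → G} {f : E → F} {x : E} (hg : C1Lip g (f x)) (hf : C1Lip f x) :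
    C1Lip (fun y => g (f y)) x := by
  refine C1Lip.of_hasFDerivAt (f' := fun y => (fderiv ℝ g (f y)).comp (fderiv ℝ f y)) ?_ ?_
  · filter_upwards [hf.hasFDerivAt, hf.lipNear.continuousAt.eventually hg.hasFDerivAt]
      with y hy hy'
    exact hy'.comp y hy
  · exact LipNear.bilin (ContinuousLinearMap.compL ℝ E F G) (hg.2.comp hf.lipNear) hf.2

theorem C1Lip.clm (L : F →L[ℝ] G) {f : E → F} {x : E} (hf : C1Lip f x) :
    C1Lip (fun y => L (f y)) x :=
  C1Lip.of_hasFDerivAt (hf.hasFDerivAt.mono fun _ hy => L.hasFDerivAt.comp _ hy)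
    (hf.2.clm (ContinuousLinearMap.compL ℝ E F G L))

theorem C1Lip.bilin (B : F →L[ℝ] G →L[ℝ] H) {f : E → F} {g : E → G} {x : E}
    (hf : C1Lip f x) (hg : C1Lip g x) : C1Lip (fun y => B (f y) (g y)) x := by
  refine C1Lip.of_hasFDerivAt (f' := fun y =>
    B.precompR E (f y) (fderiv ℝ g y) + B.precompL E (fderiv ℝ f y) (g y)) ?_ ?_
  · filter_upwards [hf.hasFDerivAt, hg.hasFDerivAt] with y hy hy'
    exact B.hasFDerivAt_of_bilinear hy hy'
  · exact (LipNear.bilin _ hf.lipNear hg.2).add (LipNear.bilin _ hf.2 hg.lipNear)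

theorem C1Lip.add {f g : E → F} {x : E} (hf : C1Lip f x) (hg : C1Lip g x) :
    C1Lip (fun y => f y + g y) x := by
  refine C1Lip.of_hasFDerivAt (f' := fun y => fderiv ℝ f y + fderiv ℝ g y) ?_ (hf.2.add hg.2)
  filter_upwards [hf.hasFDerivAt, hg.hasFDerivAt] with y hy hy' using hy.add hy'

theorem C2Lip.c1Lip {f : E → F} {x : E} (hf : C2Lip f x) : C1Lip f x := ⟨hf.1, hf.2.lipNear⟩

theorem C2Lip.of_hasFDerivAt {f : E → F} {f' : E → E →L[ℝ] F} {x : E}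
    (h : ∀ᶠ y in 𝓝 x, HasFDerivAt f (f' y) y) (h' : C1Lip f' x) : C2Lip f x :=
  ⟨h.mono fun _ hy => hy.differentiableAt, h'.congr (h.mono fun _ hy => hy.fderiv.symm)⟩

theorem C2Lip.congr {f g : E → F} {x : E} (hf : C2Lip f x) (h : f =ᶠ[𝓝 x] g) :
    C2Lip g x :=
  ⟨(hf.1.and h.eventuallyEq_nhds).mono fun _ hy => hy.1.congr_of_eventuallyEq hy.2.symm,
    hf.2.congr h.fderiv⟩

theorem C2Lip.comp {g : F → G} {f : E → F} {x : E} (hg : C2Lip g (f x)) (hf : C2Lip f x) :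
    C2Lip (fun y => g (f y)) x := by
  refine C2Lip.of_hasFDerivAt (f' := fun y => (fderiv ℝ g (f y)).comp (fderiv ℝ f y)) ?_ ?_
  · filter_upwards [hf.c1Lip.hasFDerivAt,
      hf.c1Lip.lipNear.continuousAt.eventually hg.c1Lip.hasFDerivAt] with y hy hy'
    exact hy'.comp y hy
  · exact C1Lip.bilin (ContinuousLinearMap.compL ℝ E F G) (hg.2.comp hf.c1Lip) hf.2

theorem C2Lip.bilin (B : F →L[ℝ] G →L[ℝ] H) {f : E → F} {g : E → G} {x : E}
    (hf : C2Lip f x) (hg : C2Lip g x) : C2Lip (fun y => B (f y) (g y)) x := by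
  refine C2Lip.of_hasFDerivAt (f' := fun y =>
    B.precompR E (f y) (fderiv ℝ g y) + B.precompL E (fderiv ℝ f y) (g y)) ?_ ?_
  · filter_upwards [hf.c1Lip.hasFDerivAt, hg.c1Lip.hasFDerivAt] with y hy hy'
    exact B.hasFDerivAt_of_bilinear hy hy'
  · exact (C1Lip.bilin _ hf.c1Lip hg.2).add (C1Lip.bilin _ hf.2 hg.c1Lip)

theorem C2Lip.add {f g : E → F} {x : E} (hf : C2Lip f x) (hg : C2Lip g x) :
    C2Lip (fun y => f y + g y) x := by
  refine C2Lip.of_hasFDerivAt (f' := fun y => fderiv ℝ f y + fderiv ℝ g y) ?_ (hf.2.add hg.2)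
  filter_upwards [hf.c1Lip.hasFDerivAt, hg.c1Lip.hasFDerivAt] with y hy hy' using hy.add hy'

theorem C2Lip.const (c : F) (x : E) : C2Lip (fun _ : E => c) x :=
  C2Lip.of_hasFDerivAt (f' := fun _ => 0) (.of_forall fun y => hasFDerivAt_const c y)
    (C1Lip.of_hasFDerivAt (f' := fun _ => 0) (.of_forall fun y => hasFDerivAt_const _ y)
      (.of_contDiffAt contDiffAt_const))

theorem C2Lip.of_clm (L : E →L[ℝ] F) (x : E) : C2Lip (fun y => L y) x :=
  C2Lip.of_hasFDerivAt (f' := fun _ => L) (.of_forall fun _ => L.hasFDerivAt)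
    (C2Lip.const L x).c1Lip

theorem C2Lip.sum {ι : Type*} (s : Finset ι) {f : ι → E → F} {x : E}
    (h : ∀ i ∈ s, C2Lip (f i) x) : C2Lip (fun y => ∑ i ∈ s, f i y) x := by
  classical
  induction s using Finset.induction_on with
  | empty => simpa using C2Lip.const 0 x
  | insert a s ha ih =>
    simp only [Finset.sum_insert ha]
    exact (h a (by simp)).add (ih fun i hi => h i (by simp [hi]))

end LipNear

/-! ### Second-order estimates for smooth functions -/

section SecondOrder

variable {E : Type*} [NormedAddCommGroup E] [InnerProductSpace ℝ E]

theorem hasDerivAt_comp_line {F : Type*} [NormedAddCommGroup F] [NormedSpace ℝ F] {f : E → F}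
    {f' : E →L[ℝ] F} {x d : E} {t : ℝ} (hf : HasFDerivAt f f' (x + t • d)) :
    HasDerivAt (fun s : ℝ => f (x + s • d)) (f' d) t := by
  have h : HasDerivAt (fun s : ℝ => x + s • d) d t := by
    simpa using ((hasDerivAt_id t).smul_const d).const_add x
  exact hf.comp_hasDerivAt t h

theorem le_of_hasDerivAt_nonneg {ψ ψ' : ℝ → ℝ} (h : ∀ t ∈ Icc (0 : ℝ) 1, HasDerivAt ψ (ψ' t) t)
    (h' : ∀ t ∈ Ioo (0 : ℝ) 1, 0 ≤ ψ' t) : ψ 0 ≤ ψ 1 := by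
  refine monotoneOn_of_deriv_nonneg (convex_Icc 0 1)
    (fun t ht => (h t ht).continuousAt.continuousWithinAt) (fun t ht => ?_) (fun t ht => ?_)
    (left_mem_Icc.2 zero_le_one) (right_mem_Icc.2 zero_le_one) zero_le_one
  · exact (h t (interior_subset ht)).differentiableAt.differentiableWithinAt
  · rw [(h t (interior_subset ht)).deriv]
    exact h' t (by simpa using ht)

theorem add_smul_sub_mem_segment {x y : E} {t : ℝ} (ht : t ∈ Icc (0 : ℝ) 1) :
    x + t • (y - x) ∈ segment ℝ x y := by
  rw [segment_eq_image']
  exact ⟨t, ht, rfl⟩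

theorem quadratic_lower_bound [CompleteSpace E] {f : E → ℝ} {g : E → E} {x y : E} {l : ℝ}
    (hf : ∀ w ∈ segment ℝ x y, HasGradientAt f (g w) w)
    (hg : ∀ w ∈ segment ℝ x y, l * ‖w - x‖ ^ 2 ≤ inner ℝ (g w - g x) (w - x)) :
    f x + inner ℝ (g x) (y - x) + l / 2 * ‖y - x‖ ^ 2 ≤ f y := by
  have := le_of_hasDerivAt_nonneg
    (ψ := fun t => f (x + t • (y - x)) - t * inner ℝ (g x) (y - x) - l / 2 * ‖y - x‖ ^ 2 * t ^ 2)
    (ψ' := fun t => inner ℝ (g (x + t • (y - x))) (y - x) - 1 * inner ℝ (g x) (y - x)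
      - l / 2 * ‖y - x‖ ^ 2 * (2 * t ^ 1 * 1)) (fun t ht => ?_) (fun t ht => ?_)
  · simp at this
    linarith
  · have h1 := hasDerivAt_comp_line (hf _ (add_smul_sub_mem_segment ht)).hasFDerivAt
    rw [InnerProductSpace.toDual_apply_apply] at h1
    exact (h1.sub ((hasDerivAt_id t).mul_const _)).sub (((hasDerivAt_id t).pow 2).const_mul _)
  · have h1 := hg _ (add_smul_sub_mem_segment (Ioo_subset_Icc_self ht))
    rw [add_sub_cancel_left, norm_smul, inner_smul_right, inner_sub_left, Real.norm_eq_abs,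
      mul_pow, sq_abs] at h1
    have h2 : t * (l * t * ‖y - x‖ ^ 2) ≤
      t * (inner ℝ (g (x + t • (y - x))) (y - x) - inner ℝ (g x) (y - x)) := by linarith
    have := le_of_mul_le_mul_left h2 ht.1
    linarith

theorem quadratic_upper_bound [CompleteSpace E] {f : E → ℝ} {g : E → E} {x y : E} {l : ℝ}
    (hf : ∀ w ∈ segment ℝ x y, HasGradientAt f (g w) w)
    (hg : ∀ w ∈ segment ℝ x y, inner ℝ (g w - g x) (w - x) ≤ l * ‖w - x‖ ^ 2) :
    f y ≤ f x + inner ℝ (g x) (y - x) + l / 2 * ‖y - x‖ ^ 2 := by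
  have := quadratic_lower_bound (f := fun w => -f w) (g := fun w => -g w) (l := -l) (x := x)
    (y := y) (fun w hw => ?_) (fun w hw => ?_)
  · simp at this
    linarith
  · have := (hf w hw).hasFDerivAt.neg
    rw [← map_neg] at this
    exact hasGradientAt_iff_hasFDerivAt.2 this
  · have := hg w hw
    rw [neg_sub_neg, ← neg_sub (g w), inner_neg_left]
    linarith

theorem inner_sub_lower_bound {g : E → E} {H : E → E →L[ℝ] E} {x y : E} {l : ℝ}
    (hg : ∀ w ∈ segment ℝ x y, HasFDerivAt g (H w) w)
    (hH : ∀ w ∈ segment ℝ x y, l * ‖y - x‖ ^ 2 ≤ inner ℝ (H w (y - x)) (y - x)) :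
    l * ‖y - x‖ ^ 2 ≤ inner ℝ (g y - g x) (y - x) := by
  have := le_of_hasDerivAt_nonneg
    (ψ := fun t => inner ℝ (g (x + t • (y - x))) (y - x) - t * (l * ‖y - x‖ ^ 2))
    (ψ' := fun t => inner ℝ (H (x + t • (y - x)) (y - x)) (y - x) - 1 * (l * ‖y - x‖ ^ 2))
    (fun t ht => ?_) (fun t ht => ?_)
  · simp only [zero_smul, add_zero, zero_mul, sub_zero, one_smul, add_sub_cancel, one_mul] at this
    rw [inner_sub_left]
    linarith
  · have h1 := hasDerivAt_comp_line (hg _ (add_smul_sub_mem_segment ht))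
    have h2 := h1.inner ℝ (hasDerivAt_const t (y - x))
    simp only [inner_zero_right, zero_add] at h2
    exact h2.sub ((hasDerivAt_id t).mul_const _)
  · have := hH _ (add_smul_sub_mem_segment (Ioo_subset_Icc_self ht))
    linarith

theorem inner_sub_upper_bound {g : E → E} {H : E → E →L[ℝ] E} {x y : E} {l : ℝ}
    (hg : ∀ w ∈ segment ℝ x y, HasFDerivAt g (H w) w)
    (hH : ∀ w ∈ segment ℝ x y, inner ℝ (H w (y - x)) (y - x) ≤ l * ‖y - x‖ ^ 2) :
    inner ℝ (g y - g x) (y - x) ≤ l * ‖y - x‖ ^ 2 := by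
  have := inner_sub_lower_bound (g := fun w => -g w) (H := fun w => -H w) (l := -l)
    (fun w hw => (hg w hw).neg) (fun w hw => ?_)
  · rw [neg_sub_neg, ← neg_sub (g y), inner_neg_left] at this
    linarith
  · have := hH w hw
    rw [_root_.neg_apply, inner_neg_left]
    linarith

theorem convex_gradient_le [CompleteSpace E] {F : E → ℝ} (hF : ConvexOn ℝ univ F) {x : E}
    (hd : DifferentiableAt ℝ F x) (y : E) : F x + inner ℝ (∇ F x) (y - x) ≤ F y := by
  have h1 : HasDerivAt (fun s : ℝ => F (x + s • (y - x))) (inner ℝ (∇ F x) (y - x)) 0 := by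
    have := hd.hasGradientAt.hasFDerivAt
    rw [← add_zero x, ← zero_smul ℝ (y - x)] at this
    simpa using hasDerivAt_comp_line (d := y - x) this
  have h2 : ConvexOn ℝ univ (fun s : ℝ => F (x + s • (y - x))) := by
    have := hF.comp_affineMap (AffineMap.lineMap x y)
    simpa [Function.comp_def, AffineMap.lineMap_apply, add_comm] using this
  have := h2.le_slope_of_hasDerivAt (mem_univ 0) (mem_univ 1) zero_lt_one h1
  simp only [slope_def_field, zero_smul, add_zero, one_smul, add_sub_cancel, sub_zero,
    div_one] at this
  linarith

/-- The second-order expansion at a critical point, from the right, by L'Hôpital's rule. -/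
theorem tendsto_second_order {φ φ' : ℝ → ℝ} {q : ℝ} (h : ∀ᶠ t in 𝓝 0, HasDerivAt φ (φ' t) t)
    (h0 : φ' 0 = 0) (h2 : HasDerivAt φ' q 0) :
    Tendsto (fun t => (φ t - φ 0) / t ^ 2) (𝓝[>] 0) (𝓝 (q / 2)) := by
  refine HasDerivAt.lhopital_zero_nhdsGT (f' := φ') (g' := fun t => 2 * t)
    (nhdsWithin_le_nhds (h.mono fun t ht => ht.sub_const _)) (.of_forall fun t => ?_)
    (eventually_mem_nhdsWithin.mono fun t ht => ?_) ?_ ?_ ?_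
  · simpa using hasDerivAt_pow 2 t
  · have : (0 : ℝ) < t := ht
    positivity
  · have : Tendsto (fun t => φ t - φ 0) (𝓝 0) (𝓝 (φ 0 - φ 0)) :=
      h.self_of_nhds.continuousAt.tendsto.sub_const (φ 0)
    rw [sub_self] at this
    exact this.mono_left nhdsWithin_le_nhds
  · have : Tendsto (fun t : ℝ => t ^ 2) (𝓝 0) (𝓝 (0 ^ 2)) := (continuous_pow 2).tendsto 0
    rw [zero_pow two_ne_zero] at this
    exact this.mono_left nhdsWithin_le_nhds
  · have := (hasDerivAt_iff_tendsto_slope.1 h2).mono_left (nhdsGT_le_nhdsNE 0)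
    refine (this.div_const 2).congr fun t => ?_
    rw [slope_def_field, h0, sub_zero, sub_zero, div_div, mul_comm]

theorem tendsto_second_order_line {f : E → ℝ} {x h : E} (hf : ∀ᶠ y in 𝓝 x, DifferentiableAt ℝ f y)
    (hf' : DifferentiableAt ℝ (fderiv ℝ f) x) (h0 : fderiv ℝ f x h = 0) :
    Tendsto (fun t : ℝ => (f (x + t • h) - f x) / t ^ 2) (𝓝[>] 0)
      (𝓝 (fderiv ℝ (fderiv ℝ f) x h h / 2)) := by
  have hc : Tendsto (fun t : ℝ => x + t • h) (𝓝 0) (𝓝 x) := by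
    have : Continuous fun t : ℝ => x + t • h := by fun_prop
    simpa using this.tendsto 0
  have := tendsto_second_order (φ := fun t : ℝ => f (x + t • h))
    (φ' := fun t => fderiv ℝ f (x + t • h) h) (q := fderiv ℝ (fderiv ℝ f) x h h)
    ((hc.eventually hf).mono fun t ht => hasDerivAt_comp_line ht.hasFDerivAt) (by simpa using h0) ?_
  · simpa using this
  · have h1 : HasFDerivAt (fderiv ℝ f) (fderiv ℝ (fderiv ℝ f) x) (x + (0 : ℝ) • h) := by
      simpa using hf'.hasFDerivAt
    exact (hasDerivAt_comp_line h1).clm_apply (hasDerivAt_const 0 h) |>.congr_deriv (by simp)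

end SecondOrder

/-! ### Spectral bounds -/

section Spectral

variable {E : Type*} [NormedAddCommGroup E] [InnerProductSpace ℝ E] [FiniteDimensional ℝ E]

theorem isInvertible_of_ker_eq_bot {T : E →L[ℝ] E} (h : ∀ x, T x = 0 → x = 0) :
    T.IsInvertible := by
  have hi : Function.Injective (T : E →ₗ[ℝ] E) := (injective_iff_map_eq_zero _).2 h
  exact ⟨(LinearEquiv.ofInjectiveEndo (T : E →ₗ[ℝ] E) hi).toContinuousLinearEquiv, by ext; rfl⟩

/-- Eigenvalue bounds for the inverse of a positive definite operator bound its quadratic form. -/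
theorem quadratic_form_bounds_of_inverse_eigenvalues {T : E →L[ℝ] E}
    (hsym : ∀ x y, inner ℝ (T x) y = inner ℝ x (T y)) (hpos : ∀ x, x ≠ 0 → 0 < inner ℝ (T x) x)
    {m mbar : ℝ} (hm : 0 < m)
    (he : ∀ μ : ℝ, Module.End.HasEigenvalue (T.inverse : E →ₗ[ℝ] E) μ → m ≤ μ ∧ μ ≤ mbar) (x : E) :
    1 / mbar * ‖x‖ ^ 2 ≤ inner ℝ (T x) x ∧ inner ℝ (T x) x ≤ 1 / m * ‖x‖ ^ 2 := by
  have hT : (T : E →ₗ[ℝ] E).IsSymmetric := hsym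
  have hinv : T.IsInvertible := isInvertible_of_ker_eq_bot fun y hy => by
    by_contra hne
    have := hpos y hne
    simp [hy] at this
  set b := hT.eigenvectorBasis rfl
  set μ := hT.eigenvalues rfl
  have hb : ∀ i, T (b i) = μ i • b i := fun i => hT.apply_eigenvectorBasis rfl i
  have hμ : ∀ i, 0 < μ i := fun i => by
    have := hpos (b i) (b.orthonormal.ne_zero i)
    rw [hb, real_inner_smul_left, real_inner_self_eq_norm_sq, b.orthonormal.1 i] at this
    simpa using this
  have hbd : ∀ i, 1 / mbar ≤ μ i ∧ μ i ≤ 1 / m := fun i => by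
    have hev : Module.End.HasEigenvalue (T.inverse : E →ₗ[ℝ] E) (μ i)⁻¹ := by
      refine Module.End.hasEigenvalue_of_hasEigenvector (x := b i)
        ⟨Module.End.mem_eigenspace_iff.2 ?_, b.orthonormal.ne_zero i⟩
      have h1 : T.inverse (T (b i)) = b i := hinv.inverse_apply_self _
      rw [hb, map_smul] at h1
      change T.inverse (b i) = _
      rw [← h1, smul_smul, inv_mul_cancel₀ (hμ i).ne', one_smul, h1]
    obtain ⟨h1, h2⟩ := he _ hev
    have h3 : 0 < (μ i)⁻¹ := inv_pos.2 (hμ i)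
    constructor
    · rw [one_div]; exact inv_le_of_inv_le₀ (hμ i) h2
    · rw [one_div]; exact (le_inv_comm₀ hm (hμ i)).1 h1
  have hq : inner ℝ (T x) x = ∑ i, μ i * (inner ℝ x (b i)) ^ 2 := by
    rw [← b.sum_inner_mul_inner]
    refine Finset.sum_congr rfl fun i _ => ?_
    rw [hsym, hb, real_inner_smul_right, real_inner_comm x]
    ring
  have hn : ‖x‖ ^ 2 = ∑ i, (inner ℝ x (b i)) ^ 2 := by
    rw [← real_inner_self_eq_norm_sq, ← b.sum_inner_mul_inner]
    refine Finset.sum_congr rfl fun i _ => ?_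
    rw [real_inner_comm x]
    ring
  rw [hq, hn, Finset.mul_sum, Finset.mul_sum]
  exact ⟨Finset.sum_le_sum fun i _ => mul_le_mul_of_nonneg_right (hbd i).1 (sq_nonneg _),
    Finset.sum_le_sum fun i _ => mul_le_mul_of_nonneg_right (hbd i).2 (sq_nonneg _)⟩

end Spectral

/-! ### Newton's method near a non-degenerate critical point -/

section Newton

variable {E : Type*} [NormedAddCommGroup E] [InnerProductSpace ℝ E]

/-- The inverse of the Riesz isomorphism `InnerProductSpace.toDual`, as a real linear map. -/
noncomputable def rieszSymm (E : Type*) [NormedAddCommGroup E] [InnerProductSpace ℝ E]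
    [CompleteSpace E] : StrongDual ℝ E →L[ℝ] E where
  toFun := (InnerProductSpace.toDual ℝ E).symm
  map_add' := map_add _
  map_smul' c x := by simp
  cont := (InnerProductSpace.toDual ℝ E).symm.continuous

theorem C2Lip.gradient [CompleteSpace E] {f : E → ℝ} {x : E} (hf : C2Lip f x) : C1Lip (∇ f) x :=
  hf.2.clm (rieszSymm E)

theorem inner_fderiv_gradient [CompleteSpace E] {f : E → ℝ} {x : E} (hf : C2Lip f x) (h k : E) :
    inner ℝ (fderiv ℝ (∇ f) x h) k = fderiv ℝ (fderiv ℝ f) x h k := by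
  have h1 : HasFDerivAt (∇ f) _ x :=
    (rieszSymm E).hasFDerivAt.comp x hf.2.hasFDerivAt.self_of_nhds
  rw [h1.fderiv]
  simp [rieszSymm]

theorem inner_fderiv_gradient_symm [CompleteSpace E] {f : E → ℝ} {x : E} (hf : C2Lip f x)
    (h k : E) : inner ℝ (fderiv ℝ (∇ f) x h) k = inner ℝ h (fderiv ℝ (∇ f) x k) := by
  rw [real_inner_comm _ h, inner_fderiv_gradient hf, inner_fderiv_gradient hf]
  exact second_derivative_symmetric_of_eventually hf.c1Lip.hasFDerivAt
    hf.2.hasFDerivAt.self_of_nhds h k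

/-- Local analysis of Newton's method for `f` at a critical point `zbar` where the Hessian lies
between `1 / mbar` and `1 / m`: on a small ball the Hessian is injective, a Newton step `s`
contracts the error quadratically, and `f - f zbar` is comparable to the squared distance and to the
squared norm of the gradient. -/
theorem newton_local [FiniteDimensional ℝ E] {f : E → ℝ} {zbar : E} (hf : C2Lip f zbar)
    (h0 : ∇ f zbar = 0) {m mbar : ℝ} (hm : 0 < m) (hmbar : 0 < mbar)
    (hb : ∀ h, 1 / mbar * ‖h‖ ^ 2 ≤ inner ℝ (fderiv ℝ (∇ f) zbar h) h ∧
      inner ℝ (fderiv ℝ (∇ f) zbar h) h ≤ 1 / m * ‖h‖ ^ 2) :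
    ∃ ρ > 0, ∃ c > 0, ∀ z ∈ Metric.ball zbar ρ,
      (∀ h, fderiv ℝ (∇ f) z h = 0 → h = 0) ∧
      (∀ s, fderiv ℝ (∇ f) z s = ∇ f z → ‖z - s - zbar‖ ≤ c * ‖z - zbar‖ ^ 2) ∧
      3 / (8 * mbar) * ‖z - zbar‖ ^ 2 ≤ f z - f zbar ∧
      f z - f zbar ≤ 1 / m * ‖z - zbar‖ ^ 2 ∧
      f z - f zbar ≤ mbar * ‖∇ f z‖ ^ 2 ∧
      m / 4 * ‖∇ f z‖ ^ 2 ≤ f z - f zbar := by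
  set g := ∇ f with hg
  set H := fderiv ℝ g with hH
  have hgC : C1Lip g zbar := hf.gradient
  obtain ⟨K, t, ht, hK⟩ := hgC.2
  obtain ⟨r, hr, hball⟩ := Metric.mem_nhds_iff.1 (inter_mem ht (inter_mem hgC.1 hf.1))
  have hK1 : (0 : ℝ) < K + 1 := by positivity
  -- On the ball of radius `r'` the Hessian varies by at most `min (1 / (4 mbar)) (1 / m)`.
  obtain ⟨r', hr', hr'r, hr'1, hr'2⟩ : ∃ r' > 0, r' ≤ r ∧ K * r' ≤ 1 / (4 * mbar) ∧
      K * r' ≤ 1 / m := by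
    refine ⟨min r (min (1 / (4 * mbar) / (K + 1)) (1 / m / (K + 1))), by positivity,
      min_le_left _ _, ?_, ?_⟩
    · calc K * _ ≤ (K + 1) * (1 / (4 * mbar) / (K + 1)) :=
            mul_le_mul (by linarith) ((min_le_right _ _).trans (min_le_left _ _)) (by positivity)
              hK1.le
        _ = _ := by field_simp
    · calc K * _ ≤ (K + 1) * (1 / m / (K + 1)) :=
            mul_le_mul (by linarith) ((min_le_right _ _).trans (min_le_right _ _)) (by positivity)
              hK1.le
        _ = _ := by field_simp
  have hsub : Metric.ball zbar r' ⊆ Metric.ball zbar r := Metric.ball_subset_ball hr'r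
  have hmem : zbar ∈ Metric.ball zbar r' := Metric.mem_ball_self hr'
  have hLip : ∀ w ∈ Metric.ball zbar r', ∀ w' ∈ Metric.ball zbar r',
      ‖H w - H w'‖ ≤ K * ‖w - w'‖ := fun w hw w' hw' => by
    simpa [dist_eq_norm] using hK.dist_le_mul w (hball (hsub hw)).1 w' (hball (hsub hw')).1
  have hgrad : ∀ w ∈ Metric.ball zbar r', HasGradientAt f (g w) w := fun w hw =>
    (hball (hsub hw)).2.2.hasGradientAt
  have hder : ∀ w ∈ Metric.ball zbar r', HasFDerivAt g (H w) w := fun w hw =>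
    (hball (hsub hw)).2.1.hasFDerivAt
  have hHb : ∀ w ∈ Metric.ball zbar r', ∀ h, 3 / (4 * mbar) * ‖h‖ ^ 2 ≤ inner ℝ (H w h) h ∧
      inner ℝ (H w h) h ≤ 2 / m * ‖h‖ ^ 2 := fun w hw h => by
    have h1 : |inner ℝ ((H w - H zbar) h) h| ≤ K * r' * ‖h‖ ^ 2 := by
      calc _ ≤ ‖(H w - H zbar) h‖ * ‖h‖ := abs_real_inner_le_norm _ _
        _ ≤ (K * r' * ‖h‖) * ‖h‖ := by
            gcongr
            refine ContinuousLinearMap.le_of_opNorm_le _ ((hLip w hw zbar hmem).trans ?_) h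
            gcongr
            exact (mem_ball_iff_norm.1 hw).le
        _ = _ := by ring
    have h2 : K * r' * ‖h‖ ^ 2 ≤ 1 / (4 * mbar) * ‖h‖ ^ 2 := by gcongr
    have h3 : K * r' * ‖h‖ ^ 2 ≤ 1 / m * ‖h‖ ^ 2 := by gcongr
    have h4 : inner ℝ (H w h) h = inner ℝ (H zbar h) h + inner ℝ ((H w - H zbar) h) h := by
      rw [_root_.sub_apply, inner_sub_left]; ring
    obtain ⟨h5, h6⟩ := abs_le.1 h1
    obtain ⟨h7, h8⟩ := hb h
    constructor
    · have : 3 / (4 * mbar) * ‖h‖ ^ 2 = 1 / mbar * ‖h‖ ^ 2 - 1 / (4 * mbar) * ‖h‖ ^ 2 := by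
        field_simp; ring
      linarith
    · have : 2 / m * ‖h‖ ^ 2 = 1 / m * ‖h‖ ^ 2 + 1 / m * ‖h‖ ^ 2 := by ring
      linarith
  have hseg : ∀ {x y}, x ∈ Metric.ball zbar r' → y ∈ Metric.ball zbar r' →
      segment ℝ x y ⊆ Metric.ball zbar r' := fun hx hy =>
    (convex_ball zbar r').segment_subset hx hy
  have hlow : ∀ x ∈ Metric.ball zbar r', ∀ y ∈ Metric.ball zbar r',
      f x + inner ℝ (g x) (y - x) + 3 / (8 * mbar) * ‖y - x‖ ^ 2 ≤ f y := fun x hx y hy => by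
    have := quadratic_lower_bound (l := 3 / (4 * mbar)) (fun w hw => hgrad w (hseg hx hy hw))
      (fun w hw => inner_sub_lower_bound
        (fun v hv => hder v (hseg hx (hseg hx hy hw) hv))
        (fun v hv => (hHb v (hseg hx (hseg hx hy hw) hv) _).1))
    convert this using 3
    field_simp; norm_num
  have hup : ∀ x ∈ Metric.ball zbar r', ∀ y ∈ Metric.ball zbar r',
      f y ≤ f x + inner ℝ (g x) (y - x) + 1 / m * ‖y - x‖ ^ 2 := fun x hx y hy => by
    have := quadratic_upper_bound (l := 2 / m) (fun w hw => hgrad w (hseg hx hy hw))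
      (fun w hw => inner_sub_upper_bound
        (fun v hv => hder v (hseg hx (hseg hx hy hw) hv))
        (fun v hv => (hHb v (hseg hx (hseg hx hy hw) hv) _).2))
    convert this using 3
    ring
  -- The gradient step `z - (m / 2) ∇f(z)` stays in the ball of radius `r'` for `z` close to `zbar`.
  have hstep : ∀ᶠ z in 𝓝 zbar, z - (m / 2) • g z ∈ Metric.ball zbar r' := by
    have hc : ContinuousAt (fun z => z - (m / 2) • g z) zbar :=
      continuousAt_id.sub (hgC.lipNear.continuousAt.const_smul _)
    refine hc (Metric.isOpen_ball.mem_nhds ?_)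
    simpa [h0] using hmem
  obtain ⟨ρ, hρ, hρball⟩ := Metric.mem_nhds_iff.1
    (inter_mem hstep (Metric.ball_mem_nhds zbar hr'))
  refine ⟨ρ, hρ, 4 * mbar / 3 * K + 1, by positivity, fun z hz => ?_⟩
  have hz' := (hρball hz).2
  have hstep' := (hρball hz).1
  have hlz := hlow zbar hmem z hz'
  have huz := hup zbar hmem z hz'
  rw [h0, inner_zero_left] at hlz huz
  refine ⟨fun h hh => ?_, fun s hs => ?_, by linarith, by linarith, ?_, ?_⟩
  · have := (hHb z hz' h).1
    rw [hh, inner_zero_left] at this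
    have h1 : 0 < 3 / (4 * mbar) := by positivity
    have h2 : ‖h‖ ^ 2 ≤ 0 := by
      by_contra hne
      have := mul_pos h1 (not_le.1 hne)
      linarith
    simpa using h2
  · set e := z - s - zbar with he
    have h1 : ‖g zbar - g z - H z (zbar - z)‖ ≤ K * ‖z - zbar‖ * ‖zbar - z‖ := by
      refine Convex.norm_image_sub_le_of_norm_hasFDerivWithin_le' (s := segment ℝ z zbar)
        (fun w hw => (hder w (hseg hz' hmem hw)).hasFDerivWithinAt) (fun w hw => ?_)
        (convex_segment _ _) (left_mem_segment _ _ _) (right_mem_segment _ _ _)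
      refine (hLip w (hseg hz' hmem hw) z hz').trans ?_
      gcongr
      rw [segment_eq_image'] at hw
      obtain ⟨θ, hθ, rfl⟩ := hw
      simp only [add_sub_cancel_left, norm_smul, Real.norm_eq_abs, abs_of_nonneg hθ.1]
      rw [norm_sub_rev]
      exact mul_le_of_le_one_left (norm_nonneg _) hθ.2
    -- The Taylor remainder at the critical point is the image of the new error under the Hessian.
    have h2 : g zbar - g z - H z (zbar - z) = H z e := by
      have : e = -(zbar - z) - s := by rw [he]; abel
      rw [this, map_sub (H z) (-_), map_neg, hs, h0]
      abel
    rw [h2, norm_sub_rev zbar] at h1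
    have h3 := (hHb z hz' e).1
    have h4 : inner ℝ (H z e) e ≤ K * ‖z - zbar‖ * ‖z - zbar‖ * ‖e‖ :=
      (real_inner_le_norm _ _).trans (mul_le_mul_of_nonneg_right h1 (norm_nonneg _))
    have h5 : ‖e‖ ≤ 4 * mbar / 3 * K * ‖z - zbar‖ ^ 2 := by
      rcases (norm_nonneg e).eq_or_lt with h6 | h6
      · rw [← h6]; positivity
      · have h7 : 3 / (4 * mbar) * ‖e‖ * ‖e‖ ≤ K * ‖z - zbar‖ * ‖z - zbar‖ * ‖e‖ := by
          linarith
        have h8 := le_of_mul_le_mul_right h7 h6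
        calc ‖e‖ = 4 * mbar / 3 * (3 / (4 * mbar) * ‖e‖) := by field_simp
          _ ≤ 4 * mbar / 3 * (K * ‖z - zbar‖ * ‖z - zbar‖) := by gcongr
          _ = _ := by ring
    refine h5.trans ?_
    gcongr
    linarith
  · have h1 := hlow z hz' zbar hmem
    have h2 : -(‖g z‖ * ‖zbar - z‖) ≤ inner ℝ (g z) (zbar - z) :=
      (abs_le.1 (abs_real_inner_le_norm _ _)).1
    have h3 : ‖g z‖ * ‖zbar - z‖ ≤ mbar * ‖g z‖ ^ 2 + 3 / (8 * mbar) * ‖zbar - z‖ ^ 2 := by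
      have h4 : 0 ≤ mbar * (‖g z‖ - 1 / (2 * mbar) * ‖zbar - z‖) ^ 2 := by positivity
      have h5 : mbar * (‖g z‖ - 1 / (2 * mbar) * ‖zbar - z‖) ^ 2 = mbar * ‖g z‖ ^ 2 -
          ‖g z‖ * ‖zbar - z‖ + 1 / (4 * mbar) * ‖zbar - z‖ ^ 2 := by
        field_simp; ring
      have h6 : 1 / (4 * mbar) ≤ 3 / (8 * mbar) := by
        rw [div_le_div_iff₀ (by positivity) (by positivity)]
        linarith
      have := mul_le_mul_of_nonneg_right h6 (sq_nonneg ‖zbar - z‖)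
      linarith
    linarith
  · have h1 := hup z hz' _ hstep'
    have h2 := hlow zbar hmem _ hstep'
    rw [h0, inner_zero_left] at h2
    rw [sub_sub_cancel_left, inner_neg_right, real_inner_smul_right, real_inner_self_eq_norm_sq,
      norm_neg, norm_smul, Real.norm_of_nonneg (by positivity), mul_pow] at h1
    have h3 : 0 ≤ 3 / (8 * mbar) * ‖z - (m / 2) • g z - zbar‖ ^ 2 := by positivity
    have h4 : 1 / m * ((m / 2) ^ 2 * ‖g z‖ ^ 2) = m / 4 * ‖g z‖ ^ 2 := by field_simp; ring
    rw [h4] at h1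
    linarith

end Newton

end NLGCG

namespace NLGCG

namespace SparseProblem

open Filter

variable {d : ℕ} {Y : Type*} [NormedAddCommGroup Y] [InnerProductSpace ℝ Y] [CompleteSpace Y]
variable (P : SparseProblem d Y)

/-! ### The forward operator and sparse measures -/

theorem norm_meas_zero : ‖(0 : P.Meas)‖ = 0 := ContinuousLinearMap.opNorm_zero

theorem norm_meas_nonneg (u : P.Meas) : 0 ≤ ‖u‖ := u.opNorm_nonneg

theorem norm_meas_neg (u : P.Meas) : ‖-u‖ = ‖u‖ := u.opNorm_neg

theorem norm_meas_add_le (u v : P.Meas) : ‖u + v‖ ≤ ‖u‖ + ‖v‖ := u.opNorm_add_le v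

theorem norm_meas_smul_le (c : ℝ) (u : P.Meas) : ‖c • u‖ ≤ |c| * ‖u‖ :=
  ContinuousLinearMap.opNorm_smul_le c u

theorem K_add (u v : P.Meas) : P.K (u + v) = P.K u + P.K v := by
  simp [K, ContinuousLinearMap.add_comp]

theorem K_sub (u v : P.Meas) : P.K (u - v) = P.K u - P.K v := by
  simp [K, ContinuousLinearMap.sub_comp]

theorem K_smul (c : ℝ) (u : P.Meas) : P.K (c • u) = c • P.K u := by
  simp [K, ContinuousLinearMap.smul_comp]

theorem K_sum {ι : Type*} (s : Finset ι) (u : ι → P.Meas) :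
    P.K (∑ i ∈ s, u i) = ∑ i ∈ s, P.K (u i) :=
  map_sum (AddMonoidHom.mk' P.K P.K_add) u s

theorem K_dirac (x : P.Ω) : P.K (P.dirac x) = P.κ x :=
  ext_inner_right ℝ fun y => by rw [P.inner_K]; rfl

theorem p_apply (u : P.Meas) (x : P.Ω) :
    P.p u x = -inner ℝ (P.κ x) (∇ P.F (P.K u)) := rfl

theorem pairing_p (u v : P.Meas) : v (P.p u) = -inner ℝ (P.K v) (∇ P.F (P.K u)) := by
  rw [p, map_neg, P.inner_K]

theorem gap_eq (u v : P.Meas) :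
    P.gap u v = v (P.p u) - u (P.p u) + P.α * ‖u‖ - P.α * ‖v‖ := rfl

theorem gap_eq_inner (u v : P.Meas) :
    P.gap u v = -inner ℝ (∇ P.F (P.K u)) (P.K v - P.K u) + P.α * ‖u‖ - P.α * ‖v‖ := by
  rw [gap, P.pairing_p, K_sub, real_inner_comm]

theorem norm_K_le {CK : ℝ} (h0 : 0 ≤ CK) (h : ∀ x ∈ P.Ω, ‖P.κ x‖ ≤ CK) (u : P.Meas) :
    ‖P.K u‖ ≤ CK * ‖u‖ := by
  have h1 : ‖P.Kstar (P.K u)‖ ≤ CK * ‖P.K u‖ :=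
    (ContinuousMap.norm_le _ (by positivity)).2 fun x =>
      (abs_real_inner_le_norm _ _).trans (mul_le_mul_of_nonneg_right (h x x.2) (norm_nonneg _))
  have h2 : ‖P.K u‖ * ‖P.K u‖ ≤ CK * ‖u‖ * ‖P.K u‖ := by
    rw [← real_inner_self_eq_norm_mul_norm, P.inner_K]
    calc _ ≤ ‖u‖ * ‖P.Kstar (P.K u)‖ := (Real.le_norm_self _).trans (u.le_opNorm _)
      _ ≤ ‖u‖ * (CK * ‖P.K u‖) := by gcongr
      _ = _ := by ring
  rcases (norm_nonneg (P.K u)).eq_or_lt with h3 | h3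
  · rw [← h3]; positivity
  · exact le_of_mul_le_mul_right h2 h3

theorem F_differentiable : Differentiable ℝ P.F := P.F_contDiff.differentiable one_ne_zero

theorem continuous_gradient_F : Continuous (∇ P.F) :=
  LipschitzWith.continuous (K := P.LF.toNNReal) (.of_dist_le_mul fun x y => by
    rw [dist_eq_norm, dist_eq_norm, Real.coe_toNNReal _ P.LF_pos.le]
    exact P.F_lipschitz x y)

/-- `J` lies above its linearization: `J(u) - J(v) ≤ φ(u, v)`. -/
theorem J_sub_le_gap (u v : P.Meas) : P.J u - P.J v ≤ P.gap u v := by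
  have := convex_gradient_le P.F_strictConvex.convexOn (P.F_differentiable (P.K u)) (P.K v)
  rw [gap_eq_inner, J, J]
  linarith

theorem F_le_quadratic (x y : Y) :
    P.F y ≤ P.F x + inner ℝ (∇ P.F x) (y - x) + P.LF / 2 * ‖y - x‖ ^ 2 :=
  quadratic_upper_bound (fun w _ => (P.F_differentiable w).hasGradientAt) fun w _ =>
    (real_inner_le_norm _ _).trans <| by
      rw [pow_two, ← mul_assoc]
      exact mul_le_mul_of_nonneg_right (P.F_lipschitz w x) (norm_nonneg _)

theorem norm_dirac_le (x : P.Ω) : ‖P.dirac x‖ ≤ 1 :=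
  ContinuousLinearMap.opNorm_le_bound _ zero_le_one fun φ => by
    simpa [dirac] using φ.norm_coe_le_norm x

theorem toMeas_single (x : P.Ω) (a : ℝ) : P.toMeas (Finsupp.single x a) = a • P.dirac x := by
  simp [toMeas]

theorem toMeas_apply (u : P.Sparse) (φ : C(P.Ω, ℝ)) :
    P.toMeas u φ = ∑ x ∈ u.support, u x * φ x := by
  simp [toMeas, Finsupp.linearCombination_apply, Finsupp.sum, dirac]

/-- A function with prescribed values on a finite set, without increasing the norm. -/
theorem exists_interpolation (S : Finset P.Ω) (c : P.Ω → ℝ) (hc : ∀ x, |c x| ≤ 1) :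
    ∃ φ : C(P.Ω, ℝ), ‖φ‖ ≤ 1 ∧ ∀ x ∈ S, φ x = c x := by
  let f : C((S : Set P.Ω), ℝ) := ⟨fun x => c x, continuous_of_discreteTopology⟩
  obtain ⟨g, hg, hgf⟩ := f.exists_restrict_eq_forall_mem_of_closed (t := Icc (-1) 1)
    (fun x => abs_le.1 (hc x)) ⟨0, by simp⟩ S.finite_toSet.isClosed
  refine ⟨g, (ContinuousMap.norm_le _ zero_le_one).2 fun x => abs_le.2 (hg x), fun x hx => ?_⟩
  exact DFunLike.congr_fun hgf ⟨x, hx⟩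

theorem norm_toMeas (u : P.Sparse) : ‖P.toMeas u‖ = ∑ x ∈ u.support, |u x| := by
  refine le_antisymm (ContinuousLinearMap.opNorm_le_bound _ (by positivity) fun φ => ?_) ?_
  · rw [toMeas_apply, Finset.sum_mul]
    refine (norm_sum_le _ _).trans (Finset.sum_le_sum fun x _ => ?_)
    rw [norm_mul, Real.norm_eq_abs]
    exact mul_le_mul_of_nonneg_left (φ.norm_coe_le_norm x) (abs_nonneg _)
  · obtain ⟨φ, hφ, hφu⟩ := P.exists_interpolation u.support (fun x => Real.sign (u x)) fun x => by
      rcases Real.sign_apply_eq (u x) with h | h | h <;> simp [h]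
    calc ∑ x ∈ u.support, |u x| = P.toMeas u φ := by
          rw [toMeas_apply]
          refine Finset.sum_congr rfl fun x hx => ?_
          rw [hφu x hx]
          rcases lt_trichotomy (u x) 0 with h | h | h
          · rw [Real.sign_of_neg h, abs_of_neg h]; ring
          · simp [h]
          · rw [Real.sign_of_pos h, abs_of_pos h]; ring
      _ ≤ ‖P.toMeas u‖ * ‖φ‖ := (Real.le_norm_self _).trans ((P.toMeas u).le_opNorm φ)
      _ ≤ _ := mul_le_of_le_one_right (P.norm_meas_nonneg _) hφ

theorem toMeas_injective : Function.Injective P.toMeas := by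
  refine (injective_iff_map_eq_zero _).2 fun u hu => ?_
  have h := P.norm_toMeas u
  rw [hu, norm_meas_zero, eq_comm, Finset.sum_eq_zero_iff_of_nonneg fun _ _ => abs_nonneg _] at h
  ext x
  by_contra hx
  exact hx (abs_eq_zero.1 (h x (Finsupp.mem_support_iff.2 hx)))

theorem K_toMeas (u : P.Sparse) : P.K (P.toMeas u) = ∑ x ∈ u.support, u x • P.κ x := by
  simp only [toMeas, Finsupp.linearCombination_apply, Finsupp.sum, K_sum, K_smul, K_dirac]

/-! ### Optimality conditions -/

section Minimizer

variable {P} {ubar : P.Meas}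

/-- First-order optimality: the dual gap of a minimizer vanishes. The derivative of the smooth
part in the direction `v - ubar` is compared with the increase of the norm, which is convex. -/
theorem gap_nonpos_of_minimizer (h : ∀ v, P.J ubar ≤ P.J v) (v : P.Meas) : P.gap ubar v ≤ 0 := by
  have hd : HasDerivAt (fun s : ℝ => P.F (P.K ubar + s • (P.K v - P.K ubar)))
      (inner ℝ (∇ P.F (P.K ubar)) (P.K v - P.K ubar)) 0 := by
    have := (P.F_differentiable (P.K ubar)).hasGradientAt.hasFDerivAt
    rw [← add_zero (P.K ubar), ← zero_smul ℝ (P.K v - P.K ubar)] at this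
    simpa using hasDerivAt_comp_line (d := P.K v - P.K ubar) this
  have ht := (hasDerivAt_iff_tendsto_slope.1 hd).mono_left (nhdsGT_le_nhdsNE 0)
  have hge : P.α * ‖ubar‖ - P.α * ‖v‖ ≤ inner ℝ (∇ P.F (P.K ubar)) (P.K v - P.K ubar) := by
    refine ge_of_tendsto ht ?_
    filter_upwards [Ioo_mem_nhdsGT (zero_lt_one (α := ℝ))] with t ht
    have h1 := h (ubar + t • (v - ubar))
    have h2 : ‖ubar + t • (v - ubar)‖ ≤ (1 - t) * ‖ubar‖ + t * ‖v‖ := by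
      have : ubar + t • (v - ubar) = (1 - t) • ubar + t • v := by
        module
      rw [this]
      refine (P.norm_meas_add_le _ _).trans (add_le_add ?_ ?_)
      · simpa only [abs_of_nonneg (sub_nonneg.2 ht.2.le)] using P.norm_meas_smul_le (1 - t) ubar
      · simpa only [abs_of_nonneg ht.1.le] using P.norm_meas_smul_le t v
    rw [J, J, K_add, K_smul, K_sub] at h1
    have h3 := mul_le_mul_of_nonneg_left h2 P.α_pos.le
    rw [slope_def_field, zero_smul, add_zero, sub_zero, le_div_iff₀ ht.1]
    nlinarith
  rw [gap_eq_inner]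
  linarith

theorem pairing_p_of_minimizer (h : ∀ v, P.J ubar ≤ P.J v) : ubar (P.p ubar) = P.α * ‖ubar‖ := by
  have h1 := gap_nonpos_of_minimizer h 0
  have h2 := gap_nonpos_of_minimizer h ((2 : ℝ) • ubar)
  have h3 := mul_le_mul_of_nonneg_left (P.norm_meas_smul_le 2 ubar) P.α_pos.le
  rw [gap_eq] at h1 h2
  rw [_root_.smul_apply, smul_eq_mul] at h2
  rw [norm_meas_zero, _root_.zero_apply] at h1
  rw [abs_two] at h3
  linarith

theorem abs_p_le_of_minimizer (h : ∀ v, P.J ubar ≤ P.J v) (x : P.Ω) : |P.p ubar x| ≤ P.α := by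
  have key : ∀ v : P.Meas, v (P.p ubar) ≤ P.α * ‖v‖ := fun v => by
    have h1 := gap_nonpos_of_minimizer h (ubar + v)
    rw [gap_eq, _root_.add_apply] at h1
    have h2 := mul_le_mul_of_nonneg_left (P.norm_meas_add_le ubar v) P.α_pos.le
    linarith
  have h3 : P.α * ‖P.dirac x‖ ≤ P.α := mul_le_of_le_one_right P.α_pos.le (P.norm_dirac_le x)
  have h1 : P.p ubar x ≤ P.α := (key (P.dirac x)).trans h3
  have h2 : -P.p ubar x ≤ P.α := by
    have := key (-P.dirac x)
    rw [norm_meas_neg] at this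
    exact this.trans h3
  exact abs_le.2 ⟨by linarith, h1⟩

/-- A measure `u` with `⟨p, u⟩ = α ‖u‖`, where `|p| ≤ α`, annihilates every function that vanishes
where `|p| = α`: truncating the function near zero, it can be added to and subtracted from `p` with
a small factor without violating `|p| ≤ α`. -/
theorem annihilates_of_pairing_eq {α : ℝ} (hα : 0 ≤ α) {p φ : C(P.Ω, ℝ)} {u : P.Meas}
    (hp : ∀ x, |p x| ≤ α)
    (hu : u p = α * ‖u‖) (hφ : ∀ x, |p x| = α → φ x = 0) : u φ = 0 := by
  have key : ∀ ε > 0, |u φ| ≤ ‖u‖ * ε := fun ε hε => by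
    -- Up to the truncation `ψ`, which is at most `ε`, the function vanishes near `|p| = α`.
    let ψ : C(P.Ω, ℝ) := ⟨fun x => max (-ε) (min (φ x) ε), by fun_prop⟩
    have hψ : ∀ x, ψ x = max (-ε) (min (φ x) ε) := fun _ => rfl
    have hψε : ‖ψ‖ ≤ ε := (ContinuousMap.norm_le _ hε.le).2 fun x => by
      rw [hψ, Real.norm_eq_abs, abs_le]
      exact ⟨le_max_left _ _, max_le (by linarith) (min_le_right _ _)⟩
    have hzero : ∀ x, |φ x| < ε → (φ - ψ) x = 0 := fun x hx => by
      obtain ⟨h1, h2⟩ := abs_lt.1 hx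
      rw [ContinuousMap.sub_apply, hψ, min_eq_left h2.le, max_eq_right h1.le, sub_self]
    have hcomp : IsCompact {x : P.Ω | ε ≤ |φ x|} :=
      (isClosed_le continuous_const (by fun_prop)).isCompact
    obtain ⟨δ, hδ, hδp⟩ : ∃ δ > 0, ∀ x, ε ≤ |φ x| → |p x| ≤ α - δ := by
      rcases {x : P.Ω | ε ≤ |φ x|}.eq_empty_or_nonempty with he | hne
      · exact ⟨1, one_pos, fun x hx => absurd hx (eq_empty_iff_forall_notMem.1 he x)⟩
      · obtain ⟨x₀, hx₀, hmax⟩ := hcomp.exists_isMaxOn hne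
          (f := fun x => |p x|) (by fun_prop)
        refine ⟨α - |p x₀|, sub_pos.2 (lt_of_le_of_ne (hp x₀) fun h => ?_), fun x hx => ?_⟩
        · have : ε ≤ |φ x₀| := hx₀
          rw [hφ x₀ h, abs_zero] at this
          linarith
        · have : |p x| ≤ |p x₀| := hmax hx
          linarith
    have hsmall : ∀ s : ℝ, |s| ≤ δ / (‖φ - ψ‖ + 1) → s * u (φ - ψ) ≤ 0 := fun s hs => by
      have h1 : ‖p + s • (φ - ψ)‖ ≤ α := by
        refine (ContinuousMap.norm_le _ hα).2 fun x => ?_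
        by_cases hx : |φ x| < ε
        · rw [ContinuousMap.add_apply, ContinuousMap.smul_apply, hzero x hx, smul_zero, add_zero]
          exact hp x
        · have h2 := hδp x (not_lt.1 hx)
          have h3 : |s| * |(φ - ψ) x| ≤ δ := by
            calc _ ≤ δ / (‖φ - ψ‖ + 1) * (‖φ - ψ‖ + 1) := by
                  gcongr
                  exact ((φ - ψ).norm_coe_le_norm x).trans (by linarith)
              _ = δ := by field_simp
          calc |p x + s * (φ - ψ) x| ≤ |p x| + |s * (φ - ψ) x| := abs_add_le _ _
            _ ≤ α := by rw [abs_mul]; linarith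
      have h2 : u (p + s • (φ - ψ)) ≤ ‖u‖ * α :=
        (Real.le_norm_self _).trans (u.le_opNorm_of_le h1)
      rw [map_add, map_smul, hu, smul_eq_mul] at h2
      linarith
    have ht : 0 < δ / (‖φ - ψ‖ + 1) := by positivity
    have h1 := hsmall _ (abs_of_pos ht).le
    have h2 := hsmall (-(δ / (‖φ - ψ‖ + 1))) (by rw [abs_neg, abs_of_pos ht])
    have h3 : u (φ - ψ) = 0 := by
      rw [neg_mul] at h2
      exact (mul_eq_zero.1 (le_antisymm h1 (by linarith))).resolve_left ht.ne'
    rw [map_sub, sub_eq_zero] at h3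
    rw [h3]
    exact u.le_opNorm_of_le hψε
  by_contra hne
  have h1 : 0 < |u φ| := abs_pos.2 hne
  have h2 := key (|u φ| / (2 * (‖u‖ + 1))) (by positivity)
  have h3 : ‖u‖ * (|u φ| / (2 * (‖u‖ + 1))) ≤ |u φ| / 2 := by
    rw [mul_div_assoc', div_le_div_iff₀ (by positivity) (by positivity)]
    nlinarith [P.norm_meas_nonneg u]
  linarith

end Minimizer

end SparseProblem

end NLGCG

namespace NLGCG

namespace SparseProblem

open Filter

variable {d : ℕ} {Y : Type*} [NormedAddCommGroup Y] [InnerProductSpace ℝ Y] [CompleteSpace Y]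
variable {P : SparseProblem d Y}

/-! ### Representers of sparse measures -/

section Representers

variable {N : ℕ}

/-- The `j`-th atom of `z ∈ Z^N`, as a point of `Ω`. -/
def atom {z : ZSpace d N} (hz : z ∈ P.Z N) (j : Fin N) : P.Ω := ⟨z.fst j, hz j⟩

theorem atom_injective {z : ZSpace d N} (hz : z ∈ P.Z N) :
    Function.Injective (atom hz) ↔ Function.Injective fun j => z.fst j :=
  ⟨fun h _ _ hij => h (Subtype.ext hij), fun h _ _ hij => h (congrArg Subtype.val hij)⟩

theorem U_eq {z : ZSpace d N} (hz : z ∈ P.Z N) :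
    P.U z = ∑ j, Finsupp.single (atom hz j) (z.snd j) :=
  Finset.sum_congr rfl fun j _ => dif_pos (hz j)

theorem toMeas_U {z : ZSpace d N} (hz : z ∈ P.Z N) :
    P.toMeas (P.U z) = ∑ j, z.snd j • P.dirac (atom hz j) := by
  simp_rw [U_eq hz, map_sum, toMeas_single]

theorem K_U {z : ZSpace d N} (hz : z ∈ P.Z N) :
    P.K (P.toMeas (P.U z)) = ∑ j, z.snd j • P.κ (z.fst j) := by
  simp_rw [toMeas_U hz, K_sum, K_smul, K_dirac]
  rfl

/-- Only an inequality: atoms of `z` that coincide may cancel. -/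
theorem norm_U_le {z : ZSpace d N} (hz : z ∈ P.Z N) :
    ‖P.toMeas (P.U z)‖ ≤ ∑ j, |z.snd j| := by
  refine ContinuousLinearMap.opNorm_le_bound _ (by positivity) fun φ => ?_
  rw [toMeas_U hz, _root_.sum_apply, Finset.sum_mul]
  refine (norm_sum_le _ _).trans (Finset.sum_le_sum fun j _ => ?_)
  rw [_root_.smul_apply, norm_smul]
  exact mul_le_mul_of_nonneg_left (φ.norm_coe_le_norm _) (abs_nonneg _)

theorem J_U_le {z : ZSpace d N} (hz : z ∈ P.Z N) : P.J (P.toMeas (P.U z)) ≤ P.JN z := by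
  rw [J, JN, K_U hz]
  gcongr
  · exact P.α_pos.le
  · exact norm_U_le hz

theorem U_apply {z : ZSpace d N} (hz : z ∈ P.Z N) (hi : Function.Injective fun j => z.fst j)
    (j : Fin N) : P.U z (atom hz j) = z.snd j := by
  classical
  rw [U_eq hz, Finsupp.finsetSum_apply, Finset.sum_eq_single j]
  · simp
  · intro i _ hij
    rw [Finsupp.single_eq_of_ne]
    exact fun h => hij ((atom_injective hz).2 hi h.symm)
  · simp

theorem support_U_subset [DecidableEq P.Ω] {z : ZSpace d N} (hz : z ∈ P.Z N) :
    (P.U z).support ⊆ Finset.univ.image (atom hz) := by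
  rw [U_eq hz]
  refine Finsupp.support_finsetSum.trans (Finset.biUnion_subset.2 fun j _ => ?_)
  refine Finsupp.support_single_subset.trans ?_
  simp

theorem support_U [DecidableEq P.Ω] {z : ZSpace d N} (hz : z ∈ P.Z N)
    (hi : Function.Injective fun j => z.fst j) (h0 : ∀ j, z.snd j ≠ 0) :
    (P.U z).support = Finset.univ.image (atom hz) := by
  refine (support_U_subset hz).antisymm fun x hx => ?_
  obtain ⟨j, -, rfl⟩ := Finset.mem_image.1 hx
  rw [Finsupp.mem_support_iff, U_apply hz hi]
  exact h0 j

/-- As the number of atoms equals the number of support points, no atoms of a minimal representer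
coincide and no coefficient vanishes. -/
theorem isMinRep_iff {u : P.Sparse} {z : ZSpace d N} :
    P.IsMinRep u z ↔
      z ∈ P.Z N ∧ (Function.Injective fun j => z.fst j) ∧ (∀ j, z.snd j ≠ 0) ∧ P.U z = u := by
  classical
  constructor
  · rintro ⟨hc, hz, rfl⟩
    have h1 : (Finset.univ.image (atom hz)).card ≤ N :=
      Finset.card_image_le.trans_eq (by simp)
    have h2 : (P.U z).support = Finset.univ.image (atom hz) :=
      Finset.eq_of_subset_of_card_le (support_U_subset hz) (h1.trans_eq hc.symm)
    have hi : Function.Injective fun j => z.fst j := by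
      rw [← atom_injective hz, ← Set.injOn_univ, ← Finset.coe_univ, ← Finset.card_image_iff,
        ← h2, hc, Finset.card_univ, Fintype.card_fin]
    refine ⟨hz, hi, fun j => ?_, rfl⟩
    rw [← U_apply hz hi, ← Finsupp.mem_support_iff, h2]
    simp
  · rintro ⟨hz, hi, h0, rfl⟩
    refine ⟨?_, hz, rfl⟩
    rw [support_U hz hi h0, Finset.card_image_of_injective _ ((atom_injective hz).2 hi),
      Finset.card_univ, Fintype.card_fin]

theorem norm_eq_of_isMinRep {u : P.Sparse} {z : ZSpace d N} (h : P.IsMinRep u z) :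
    ‖P.toMeas u‖ = ∑ j, |z.snd j| := by
  classical
  obtain ⟨hz, hi, h0, rfl⟩ := isMinRep_iff.1 h
  rw [norm_toMeas, support_U hz hi h0, Finset.sum_image ((atom_injective hz).2 hi).injOn]
  exact Finset.sum_congr rfl fun j _ => by rw [U_apply hz hi]

theorem JN_eq_of_isMinRep {u : P.Sparse} {z : ZSpace d N} (h : P.IsMinRep u z) :
    P.JN z = P.J (P.toMeas u) := by
  rw [J, norm_eq_of_isMinRep h]
  obtain ⟨hz, -, -, rfl⟩ := isMinRep_iff.1 h
  rw [K_U hz, JN]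

theorem exists_isMinRep {u : P.Sparse} (h : u.support.card = N) :
    ∃ z : ZSpace d N, P.IsMinRep u z := by
  classical
  obtain ⟨e⟩ : Nonempty (Fin N ≃ u.support) := ⟨(Finset.equivFinOfCardEq h).symm⟩
  let z : ZSpace d N := WithLp.toLp 2
    (WithLp.toLp 2 fun j => ((e j : P.Ω) : Eucl d), WithLp.toLp 2 fun j => u (e j))
  have hz : z ∈ P.Z N := fun j => (e j : P.Ω).2
  refine ⟨z, h, hz, ?_⟩
  rw [U_eq hz]
  calc ∑ j, Finsupp.single (atom hz j) (z.snd j)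
      = ∑ j, Finsupp.single (e j : P.Ω) (u (e j)) := rfl
    _ = ∑ x : u.support, Finsupp.single (x : P.Ω) (u x) :=
        e.sum_comp fun x : u.support => Finsupp.single (x : P.Ω) (u x)
    _ = u := by
        rw [Finset.sum_coe_sort u.support fun x => Finsupp.single x (u x)]
        exact u.sum_single

/-- The action of permutations of the atoms. -/
def permZ (π : Equiv.Perm (Fin N)) (z : ZSpace d N) : ZSpace d N :=
  WithLp.toLp 2 (WithLp.toLp 2 fun j => z.fst (π j), WithLp.toLp 2 fun j => z.snd (π j))

theorem dist_permZ (π : Equiv.Perm (Fin N)) (z z' : ZSpace d N) :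
    dist (permZ π z) (permZ π z') = dist z z' := by
  rw [WithLp.prod_dist_eq_of_L2, WithLp.prod_dist_eq_of_L2, PiLp.dist_eq_of_L2,
    PiLp.dist_eq_of_L2 z.fst, EuclideanSpace.dist_eq, EuclideanSpace.dist_eq z.snd]
  congr 3
  · congr 1
    exact Equiv.sum_comp π fun j => dist (z.fst j) (z'.fst j) ^ 2
  · congr 1
    exact Equiv.sum_comp π fun j => dist (z.snd j) (z'.snd j) ^ 2

theorem isMinRep_permZ {u : P.Sparse} {z : ZSpace d N} (h : P.IsMinRep u z)
    (π : Equiv.Perm (Fin N)) : P.IsMinRep u (permZ π z) := by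
  obtain ⟨hc, hz, rfl⟩ := h
  have hz' : permZ π z ∈ P.Z N := fun j => hz (π j)
  refine ⟨hc, hz', ?_⟩
  rw [U_eq hz', U_eq hz]
  exact Equiv.sum_comp π fun j => Finsupp.single (atom hz j) (z.snd j)

/-- Minimal representers are unique up to the order of the atoms. -/
theorem exists_perm_of_isMinRep {u : P.Sparse} {z z' : ZSpace d N} (h : P.IsMinRep u z)
    (h' : P.IsMinRep u z') : ∃ π : Equiv.Perm (Fin N), z' = permZ π z := by
  classical
  obtain ⟨hz, hi, h0, hu⟩ := isMinRep_iff.1 h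
  obtain ⟨hz', hi', h0', hu'⟩ := isMinRep_iff.1 h'
  have hs : ∀ j, ∃ i, atom hz i = atom hz' j := fun j => by
    have : atom hz' j ∈ (P.U z').support := by rw [support_U hz' hi' h0']; simp
    rw [hu', ← hu, support_U hz hi h0] at this
    simpa using this
  choose f hf using hs
  have hfi : Function.Injective f := fun i j hij =>
    (atom_injective hz').2 hi' (by rw [← hf, ← hf, hij])
  refine ⟨Equiv.ofBijective f (Finite.injective_iff_bijective.1 hfi), ?_⟩
  have h1 : ∀ j, z'.fst j = z.fst (f j) := fun j => congrArg Subtype.val (hf j).symm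
  have h2 : ∀ j, z'.snd j = z.snd (f j) := fun j => by
    rw [← U_apply hz hi, ← U_apply hz' hi', hu, hu', hf]
  refine WithLp.ofLp_injective 2 (Prod.ext ?_ ?_)
  · ext1 j
    exact h1 j
  · ext1 j
    exact h2 j

end Representers

/-! ### The solution -/

section Solution

/-- Strict convexity of `F` makes `Ku`, hence `p_u`, independent of the minimizer `u`. -/
theorem K_eq_of_minimizers {u v : P.Meas} (hu : ∀ w, P.J u ≤ P.J w) (hv : ∀ w, P.J v ≤ P.J w) :
    P.K u = P.K v := by
  by_contra hne
  have h1 := P.F_strictConvex.2 (mem_univ (P.K u)) (mem_univ (P.K v)) hne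
    (one_half_pos (α := ℝ)) one_half_pos (add_halves 1)
  have h2 := hu ((1 / 2 : ℝ) • u + (1 / 2 : ℝ) • v)
  have h3 := hv u
  have h4 : ‖(1 / 2 : ℝ) • u + (1 / 2 : ℝ) • v‖ ≤ 1 / 2 * ‖u‖ + 1 / 2 * ‖v‖ := by
    have := P.norm_meas_smul_le (1 / 2) u
    have h' := P.norm_meas_smul_le (1 / 2) v
    rw [abs_of_pos (by norm_num)] at this h'
    linarith [P.norm_meas_add_le ((1 / 2 : ℝ) • u) ((1 / 2 : ℝ) • v)]
  have h5 := mul_le_mul_of_nonneg_left h4 P.α_pos.le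
  rw [J, J] at h2 h3
  rw [K_add, K_smul, K_smul] at h2
  simp only [smul_eq_mul] at h1
  linarith

namespace NonDegenerate

variable {ubar : P.Meas} {Nbar : ℕ} {xbar : Fin Nbar → Eucl d} {γ θ R' σ' : ℝ}

/-- The peaks `xbar j` of `|p_ubar|`, as points of `Ω`. -/
def peak (hB : P.NonDegenerate ubar xbar γ θ R' σ') (j : Fin Nbar) : P.Ω :=
  ⟨xbar j, interior_subset (hB.mem_interior j)⟩

variable (hB : P.NonDegenerate ubar xbar γ θ R' σ')
include hB

theorem peak_injective : Function.Injective hB.peak := fun _ _ h =>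
  hB.injective (congrArg Subtype.val h)

theorem abs_p_eq_iff (x : P.Ω) : |P.p ubar x| = P.α ↔ ∃ j, hB.peak j = x := by
  have h := fun y => Set.ext_iff.1 hB.range_eq y
  constructor
  · intro hx
    have hn : P.α = ‖P.p ubar‖ := le_antisymm (hx ▸ (P.p ubar).norm_coe_le_norm x)
      ((ContinuousMap.norm_le _ P.α_pos.le).2 (abs_p_le_of_minimizer hB.minimizer))
    obtain ⟨j, hj⟩ := (h x).2 ⟨x, ⟨hx, hn⟩, rfl⟩
    exact ⟨j, Subtype.ext hj⟩
  · rintro ⟨j, rfl⟩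
    obtain ⟨x, hx, hxj⟩ := (h (xbar j)).1 ⟨j, rfl⟩
    have : hB.peak j = x := Subtype.ext hxj.symm
    rw [this]
    exact hx.1

/-- Every minimizer is a combination of the Dirac measures at the peaks. -/
theorem eq_sum_dirac {u : P.Meas} (hu : ∀ w, P.J u ≤ P.J w) :
    ∃ c : Fin Nbar → ℝ, u = ∑ j, c j • P.dirac (hB.peak j) := by
  classical
  have hp : P.p u = P.p ubar := by rw [p, p, K_eq_of_minimizers hu hB.minimizer]
  have hex : ∀ j, ∃ φ : C(P.Ω, ℝ), ∀ i, φ (hB.peak i) = if i = j then 1 else 0 := fun j => by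
    obtain ⟨φ, -, hφ⟩ := P.exists_interpolation (Finset.univ.image hB.peak)
      (fun x => if x = hB.peak j then 1 else 0) (fun x => by split_ifs <;> simp)
    refine ⟨φ, fun i => ?_⟩
    rw [hφ _ (by simp)]
    simp [hB.peak_injective.eq_iff]
  choose φ hφ using hex
  refine ⟨fun j => u (φ j), ?_⟩
  ext ψ
  have h0 : u (ψ - ∑ j, ψ (hB.peak j) • φ j) = 0 := by
    refine annihilates_of_pairing_eq P.α_pos.le (abs_p_le_of_minimizer hu)
      (pairing_p_of_minimizer hu) fun x hx => ?_
    rw [hp] at hx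
    obtain ⟨i, rfl⟩ := (hB.abs_p_eq_iff x).1 hx
    simp [hφ, ContinuousMap.sum_apply]
  rw [map_sub, map_sum, sub_eq_zero] at h0
  rw [h0, _root_.sum_apply]
  refine Finset.sum_congr rfl fun j _ => ?_
  rw [map_smul, _root_.smul_apply, smul_eq_mul, smul_eq_mul, mul_comm]
  rfl

/-- Uniqueness of the solution: two minimizers are supported on the peaks and have the same image
under `K`, so the linear independence of the `κ(xbar j)` identifies their coefficients. -/
theorem eq_of_minimizer {u : P.Meas} (hu : ∀ w, P.J u ≤ P.J w) : u = ubar := by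
  obtain ⟨c, hc⟩ := hB.eq_sum_dirac hu
  obtain ⟨c', hc'⟩ := hB.eq_sum_dirac hB.minimizer
  have h := K_eq_of_minimizers hu hB.minimizer
  rw [hc] at h
  conv at h => rhs; arg 2; rw [hc']
  simp only [K_sum, K_smul, K_dirac] at h
  have h2 : ∀ j, c j - c' j = 0 := Fintype.linearIndependent_iff.1 hB.linearIndependent
    (fun j => c j - c' j) (by
      simp only [sub_smul, Finset.sum_sub_distrib, sub_eq_zero]
      exact h)
  rw [hc]
  refine Eq.trans ?_ hc'.symm
  exact Finset.sum_congr rfl fun j _ => by rw [sub_eq_zero.1 (h2 j)]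

/-- The solution has a representer `(xbar, λ)` with non-zero coefficients. -/
theorem exists_representer : ∃ (us : P.Sparse) (z : ZSpace d Nbar), P.toMeas us = ubar ∧
    P.IsMinRep us z ∧ ∀ j, z.fst j = xbar j := by
  obtain ⟨c, hc⟩ := hB.eq_sum_dirac hB.minimizer
  let z : ZSpace d Nbar := WithLp.toLp 2 (WithLp.toLp 2 xbar, WithLp.toLp 2 c)
  have hz : z ∈ P.Z Nbar := fun j => (hB.peak j).2
  have hu : P.toMeas (P.U z) = ubar := by rw [toMeas_U hz, hc]; rfl
  refine ⟨P.U z, z, hu, isMinRep_iff.2 ⟨hz, hB.injective, fun j hj => ?_, rfl⟩, fun j => rfl⟩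
  have hmem : hB.peak j ∈ P.supp ubar := by
    have : xbar j ∈ Subtype.val '' P.supp ubar := hB.supp_eq ▸ mem_range_self j
    obtain ⟨x, hx, hxj⟩ := this
    have : hB.peak j = x := Subtype.ext hxj.symm
    rwa [this]
  have hfin : (hB.peak '' {i | i ≠ j}).Finite := Set.toFinite _
  obtain ⟨φ, hφ, hφu⟩ := hmem (hB.peak '' {i | i ≠ j})ᶜ (hfin.isClosed.isOpen_compl.mem_nhds (by
    rintro ⟨i, hi, hij⟩
    exact hi (hB.peak_injective hij)))
  apply hφu
  rw [hc, _root_.sum_apply]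
  refine Finset.sum_eq_zero fun i _ => ?_
  rw [_root_.smul_apply, smul_eq_mul]
  by_cases hij : i = j
  · have : c i = 0 := by rw [hij]; exact hj
    rw [this, zero_mul]
  · have : φ (hB.peak i) = 0 := by
      by_contra hne
      exact hφ hne ⟨i, hij, rfl⟩
    change c i * φ (hB.peak i) = 0
    rw [this, mul_zero]

/-- Equality in `⟨p, ubar⟩ ≤ α ‖ubar‖` forces equality at every atom. -/
theorem p_eq_sign_of_isMinRep {us : P.Sparse} (hus : P.toMeas us = ubar) {N : ℕ} {z : ZSpace d N}
    (hz : P.IsMinRep us z) (j : Fin N) :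
    P.p ubar (atom hz.2.1 j) = P.α * Real.sign (z.snd j) := by
  have h1 := pairing_p_of_minimizer hB.minimizer
  have hn := norm_eq_of_isMinRep hz
  rw [hus] at hn
  obtain ⟨hz', hi, h0, hu⟩ := isMinRep_iff.1 hz
  have h2 : ubar (P.p ubar) = ∑ j, z.snd j * P.p ubar (atom hz' j) := by
    have h3 : ubar = ∑ j, z.snd j • P.dirac (atom hz' j) := by rw [← hus, ← hu, toMeas_U hz']
    calc ubar (P.p ubar) = (∑ j, z.snd j • P.dirac (atom hz' j)) (P.p ubar) := by rw [← h3]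
      _ = _ := by rw [_root_.sum_apply]; rfl
  rw [h2, hn, Finset.mul_sum] at h1
  have h3 : ∀ j ∈ Finset.univ, z.snd j * P.p ubar (atom hz' j) ≤ P.α * |z.snd j| := fun j _ => by
    calc _ ≤ |z.snd j * P.p ubar (atom hz' j)| := le_abs_self _
      _ ≤ _ := by
        rw [abs_mul, mul_comm]
        exact mul_le_mul_of_nonneg_right (abs_p_le_of_minimizer hB.minimizer _) (abs_nonneg _)
  have h4 := (Finset.sum_eq_sum_iff_of_le h3).1 h1 j (Finset.mem_univ j)
  rcases lt_or_gt_of_ne (h0 j) with h | h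
  · rw [Real.sign_of_neg h]
    rw [abs_of_neg h] at h4
    exact mul_left_cancel₀ h.ne (by linarith)
  · rw [Real.sign_of_pos h]
    rw [abs_of_pos h] at h4
    exact mul_left_cancel₀ h.ne' (by linarith)

/-- The minimizers of `J_Nbar` are the minimal representers of the solution. -/
theorem argminJN_eq {us : P.Sparse} (hus : P.toMeas us = ubar) (hc : us.support.card = Nbar) :
    P.argminJN Nbar = {z | P.IsMinRep us z} := by
  ext z
  constructor
  · rintro ⟨hz, hmin⟩
    obtain ⟨z₀, hz₀⟩ := exists_isMinRep hc
    have h1 := hmin z₀ hz₀.2.1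
    rw [JN_eq_of_isMinRep hz₀, hus] at h1
    have h2 := hB.eq_of_minimizer (u := P.toMeas (P.U z)) fun w =>
      (J_U_le hz).trans (h1.trans (hB.minimizer w))
    exact ⟨hc, hz, P.toMeas_injective (h2.trans hus.symm)⟩
  · intro hz
    refine ⟨hz.2.1, fun z' hz' => ?_⟩
    rw [JN_eq_of_isMinRep hz, hus]
    exact (hB.minimizer _).trans (J_U_le hz')

theorem residual_eq (u : P.Meas) : P.residual u = P.J u - P.J ubar := by
  have : ⨅ v : P.Meas, P.J v = P.J ubar :=
    le_antisymm (ciInf_le ⟨P.J ubar, by rintro _ ⟨v, rfl⟩; exact hB.minimizer v⟩ ubar)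
      (le_ciInf hB.minimizer)
  rw [residual, this]

theorem residual_nonneg (u : P.Meas) : 0 ≤ P.residual u := by
  rw [hB.residual_eq]
  exact sub_nonneg.2 (hB.minimizer u)

theorem eq_of_residual_le_zero {u : P.Meas} (h : P.residual u ≤ 0) : u = ubar :=
  hB.eq_of_minimizer fun w => by
    rw [hB.residual_eq] at h
    exact (sub_nonpos.1 h).trans (hB.minimizer w)

end NonDegenerate

end Solution

end SparseProblem

end NLGCG

namespace NLGCG

theorem extendFrom_hessian {E : Type*} [NormedAddCommGroup E] [InnerProductSpace ℝ E]
    [CompleteSpace E] {A : Set E} {f : E → ℝ} {z : E} (hz : z ∈ A)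
    (hc : ContinuousAt (fderiv ℝ (∇ f)) z) :
    extendFrom A (fderiv ℝ (∇ f)) z = fderiv ℝ (∇ f) z :=
  extendFrom_eq (subset_closure hz) (hc.mono_left nhdsWithin_le_nhds)

/-- The junk values of `det` and `inverse` play no role for an injective operator. -/
theorem det_ne_zero_and_apply_inverse {E : Type*} [NormedAddCommGroup E] [InnerProductSpace ℝ E]
    [FiniteDimensional ℝ E] {T : E →L[ℝ] E} (h : ∀ x, T x = 0 → x = 0) :
    T.det ≠ 0 ∧ ∀ x, T (T.inverse x) = x := by
  refine ⟨?_, (isInvertible_of_ker_eq_bot h).self_apply_inverse⟩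
  have hk : LinearMap.ker (T : E →ₗ[ℝ] E) = ⊥ := LinearMap.ker_eq_bot'.2 h
  exact ((LinearMap.isUnit_iff_isUnit_det _).1
    ((LinearMap.isUnit_iff_ker_eq_bot _).2 hk)).ne_zero

namespace SparseProblem

open Filter

variable {d : ℕ} {Y : Type*} [NormedAddCommGroup Y] [InnerProductSpace ℝ Y] [CompleteSpace Y]
variable {P : SparseProblem d Y}

/-! ### Regularity of the finite-dimensional objective -/

theorem KernelC21.c2Lip (hκ : P.KernelC21) {x : Eucl d} (hx : x ∈ interior P.Ω) :
    C2Lip P.κ x := by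
  have hn : interior P.Ω ∈ 𝓝 x := isOpen_interior.mem_nhds hx
  have hc : ∀ y ∈ interior P.Ω, ContDiffAt ℝ 2 P.κ y := fun y hy =>
    hκ.contDiffOn.contDiffAt (isOpen_interior.mem_nhds hy)
  refine ⟨?_, ?_, ?_⟩
  · filter_upwards [hn] with y hy using (hc y hy).differentiableAt (by norm_num)
  · filter_upwards [hn] with y hy
    exact ((hc y hy).fderiv_right (m := 1) (by norm_num)).differentiableAt one_ne_zero
  · obtain ⟨C, hC⟩ := hκ.fderiv2_lipschitz
    exact ⟨C, _, hn, hC⟩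

theorem c2Lip_F (hF : ContDiff ℝ 2 P.F) (hF' : LocallyLipschitz (fderiv ℝ (gradient P.F))) (y : Y) :
    C2Lip P.F y := by
  have h1 : C1Lip (∇ P.F) y := by
    refine ⟨.of_forall fun z => ?_, hF' y⟩
    exact (rieszSymm Y).differentiableAt.comp z
      ((hF.fderiv_right (m := 1) (by norm_num)).differentiable one_ne_zero z)
  refine C2Lip.of_hasFDerivAt (f' := fun z => innerSL ℝ (∇ P.F z))
    (.of_forall fun z => ?_) (h1.clm (innerSL ℝ))
  exact (P.F_differentiable z).hasGradientAt.hasFDerivAt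

section Projections

variable (d) {N : ℕ}

/-- The projection of `z = (x, λ)` to `x^j`. -/
noncomputable def posL (j : Fin N) : ZSpace d N →L[ℝ] Eucl d :=
  (PiLp.proj 2 (fun _ : Fin N => Eucl d) j).comp
    (WithLp.fstL 2 ℝ (PiLp 2 fun _ : Fin N => Eucl d) (EuclideanSpace ℝ (Fin N)))

/-- The projection of `z = (x, λ)` to `λ^j`. -/
noncomputable def coefL (j : Fin N) : ZSpace d N →L[ℝ] ℝ :=
  (EuclideanSpace.proj j).comp
    (WithLp.sndL 2 ℝ (PiLp 2 fun _ : Fin N => Eucl d) (EuclideanSpace ℝ (Fin N)))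

variable {d}

theorem coefL_apply (j : Fin N) (z : ZSpace d N) : coefL d j z = z.snd j := rfl

theorem continuous_pos (j : Fin N) : Continuous fun z : ZSpace d N => z.fst j :=
  (posL d j).continuous

theorem continuous_coef (j : Fin N) : Continuous fun z : ZSpace d N => z.snd j :=
  (coefL d j).continuous

end Projections

section JN

variable {N : ℕ}

/-- `K U(z) = ∑ λ_j κ(x_j)`, as a function of `z`. -/
noncomputable def KU (P : SparseProblem d Y) (z : ZSpace d N) : Y :=
  ∑ j, z.snd j • P.κ (z.fst j)

theorem K_eq_KU {N : ℕ} {ubar : P.Meas} {us : P.Sparse} (hus : P.toMeas us = ubar)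
    {z : ZSpace d N} (hz : P.IsMinRep us z) : P.K ubar = KU P z := by
  rw [← hus, ← (isMinRep_iff.1 hz).2.2.2, K_U hz.2.1]; rfl

theorem isOpen_Zint : IsOpen (P.Zint N) := by
  simp only [Zint, Set.ofPred_forall, Set.ofPred_and]
  refine isOpen_iInter_of_finite fun j => IsOpen.inter ?_ ?_
  · exact isOpen_interior.preimage (continuous_pos j)
  · exact isOpen_ne.preimage (continuous_coef j)

theorem Zint_subset : P.Zint N ⊆ P.Z N := fun _ hz j => interior_subset (hz j).1

theorem c2Lip_KU (hκ : P.KernelC21) {z : ZSpace d N} (hz : z ∈ P.Zint N) : C2Lip (KU P) z :=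
  C2Lip.sum _ fun j _ => C2Lip.bilin (ContinuousLinearMap.lsmul ℝ ℝ)
    (C2Lip.of_clm (coefL d j) z)
    (C2Lip.comp (g := P.κ) (f := posL d j) (hκ.c2Lip (hz j).1) (C2Lip.of_clm (posL d j) z))

theorem abs_coef_eventuallyEq {z : ZSpace d N} (hz : ∀ j, z.snd j ≠ 0) (j : Fin N) :
    (fun w : ZSpace d N => |w.snd j|) =ᶠ[𝓝 z] fun w => Real.sign (z.snd j) * w.snd j := by
  have hc := (continuous_coef (d := d) j).tendsto z
  rcases lt_or_gt_of_ne (hz j) with h | h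
  · filter_upwards [hc.eventually_lt_const h] with w hw
    rw [Real.sign_of_neg h, abs_of_neg hw]; ring
  · filter_upwards [hc.eventually_const_lt h] with w hw
    rw [Real.sign_of_pos h, abs_of_pos hw]; ring

theorem c2Lip_JN (hκ : P.KernelC21) (hF : ContDiff ℝ 2 P.F)
    (hF' : LocallyLipschitz (fderiv ℝ (gradient P.F))) {z : ZSpace d N} (hz : z ∈ P.Zint N) :
    C2Lip (P.JN (N := N)) z := by
  have h1 : C2Lip (fun w : ZSpace d N => P.F (KU P w)) z :=
    C2Lip.comp (c2Lip_F hF hF' _) (c2Lip_KU hκ hz)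
  have h2 : C2Lip (fun w : ZSpace d N => P.α * ∑ j, |w.snd j|) z := by
    refine (C2Lip.of_clm (∑ j, (P.α * Real.sign (z.snd j)) • coefL d j) z).congr ?_
    filter_upwards [eventually_all.2 fun j => abs_coef_eventuallyEq (fun i => (hz i).2) j]
      with w hw
    simp only [hw, _root_.sum_apply, Finset.mul_sum]
    exact Finset.sum_congr rfl fun j _ => by rw [_root_.smul_apply, coefL_apply, smul_eq_mul]; ring
  exact h1.add h2

theorem gradJN_eq (h : ∀ z ∈ P.Zint N, C2Lip (P.JN (N := N)) z) {z : ZSpace d N}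
    (hz : z ∈ P.Zint N) : P.gradJN z = ∇ P.JN z :=
  extendFrom_eq (subset_closure hz)
    ((h z hz).gradient.lipNear.continuousAt.mono_left nhdsWithin_le_nhds)

theorem hessJN_eq (h : ∀ z ∈ P.Zint N, C2Lip (P.JN (N := N)) z) {z : ZSpace d N}
    (hz : z ∈ P.Zint N) : P.hessJN z = fderiv ℝ (∇ P.JN) z :=
  extendFrom_hessian hz (h z hz).gradient.2.continuousAt

end JN

theorem F_remainder_nonneg (x y : Y) :
    0 ≤ P.F y - P.F x - inner ℝ (∇ P.F x) (y - x) := by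
  have := convex_gradient_le P.F_strictConvex.convexOn (P.F_differentiable x) y
  linarith

/-! ### Positive definiteness of the Hessian at the solution -/

namespace NonDegenerate

variable {ubar : P.Meas} {Nbar : ℕ} {xbar : Fin Nbar → Eucl d} {γ θ R' σ' : ℝ}
variable (hB : P.NonDegenerate ubar xbar γ θ R' σ') {us : P.Sparse} (hus : P.toMeas us = ubar)
include hB

theorem R'_le_dist {i j : Fin Nbar} (hij : i ≠ j) : 4 * R' ≤ dist (xbar i) (xbar j) := by
  have h : 0 < 2 * R' := by linarith [hB.R'_pos]
  have := (disjoint_ball_ball_iff h h).1 (hB.disjoint i j hij)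
  linarith

/-- The defect of the atom `λ δ_x` in the inequality `λ p(x) ≤ α |λ|`. -/
theorem defect_nonneg {w : ZSpace d Nbar} (hw : w ∈ P.Z Nbar) (j : Fin Nbar) :
    0 ≤ P.α * |w.snd j| - w.snd j * P.pFun ubar (w.fst j) := by
  have h := abs_p_le_of_minimizer hB.minimizer (atom hw j)
  have h1 : |w.snd j * P.p ubar (atom hw j)| ≤ |w.snd j| * P.α := by
    rw [abs_mul]
    exact mul_le_mul_of_nonneg_left h (abs_nonneg _)
  have h2 := (le_abs_self _).trans h1
  change w.snd j * P.pFun ubar (w.fst j) ≤ _ at h2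
  linarith

include hus

theorem exists_perm {z : ZSpace d Nbar} (hz : P.IsMinRep us z) :
    ∃ π : Equiv.Perm (Fin Nbar), ∀ j, z.fst j = xbar (π j) := by
  obtain ⟨us', z₀, hus', hz₀, hx⟩ := hB.exists_representer
  obtain rfl : us' = us := P.toMeas_injective (hus'.trans hus.symm)
  obtain ⟨π, rfl⟩ := exists_perm_of_isMinRep hz₀ hz
  exact ⟨π, fun j => hx (π j)⟩

theorem mem_Zint {z : ZSpace d Nbar} (hz : P.IsMinRep us z) : z ∈ P.Zint Nbar := by
  obtain ⟨π, hπ⟩ := hB.exists_perm hus hz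
  exact fun j => ⟨hπ j ▸ hB.mem_interior (π j), (isMinRep_iff.1 hz).2.2.1 j⟩

/-- The increase of `J_N` is the remainder of `F` plus the defects of the atoms. -/
theorem JN_sub_eq {z : ZSpace d Nbar} (hz : P.IsMinRep us z) (w : ZSpace d Nbar) :
    P.JN w - P.JN z =
      (P.F (KU P w) - P.F (KU P z) - inner ℝ (∇ P.F (KU P z)) (KU P w - KU P z)) +
      ∑ j, (P.α * |w.snd j| - w.snd j * P.pFun ubar (w.fst j)) := by
  have hK := K_eq_KU hus hz
  have hpair : ∀ w : ZSpace d Nbar, inner ℝ (∇ P.F (KU P z)) (KU P w) =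
      -∑ j, w.snd j * P.pFun ubar (w.fst j) := fun w => by
    rw [KU.eq_def P w, inner_sum, ← Finset.sum_neg_distrib]
    refine Finset.sum_congr rfl fun j _ => ?_
    rw [real_inner_smul_right, pFun, hK, real_inner_comm]
    ring
  have h1 : ∑ j, z.snd j * P.pFun ubar (z.fst j) = P.α * ∑ j, |z.snd j| := by
    have h2 := hpair z
    have h3 := pairing_p_of_minimizer hB.minimizer
    have h4 := norm_eq_of_isMinRep hz
    rw [pairing_p, hK, real_inner_comm] at h3
    rw [hus] at h4
    rw [← h4]
    linarith
  rw [inner_sub_right, hpair, hpair, h1, Finset.sum_sub_distrib, ← Finset.mul_sum]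
  change P.F (KU P w) + _ - (P.F (KU P z) + _) = _
  ring

end NonDegenerate

theorem c2Lip_pFun (hκ : P.KernelC21) (u : P.Meas) {x : Eucl d} (hx : x ∈ interior P.Ω) :
    C2Lip (P.pFun u) x := by
  have h := C2Lip.comp (C2Lip.of_clm (-(innerSL ℝ (∇ P.F (P.K u)))) (P.κ x)) (hκ.c2Lip hx)
  refine h.congr (.of_forall fun y => ?_)
  simp [pFun]

theorem KU_add_smul {N : ℕ} {z h : ZSpace d N} (hh : ∀ j, h.fst j = 0) (t : ℝ) :
    KU P (z + t • h) = KU P z + t • ∑ j, h.snd j • P.κ (z.fst j) := by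
  rw [KU, KU, Finset.smul_sum, ← Finset.sum_add_distrib]
  refine Finset.sum_congr rfl fun j _ => ?_
  have h1 : (z + t • h).fst j = z.fst j := by
    change z.fst j + t • h.fst j = _
    rw [hh, smul_zero, add_zero]
  have h2 : (z + t • h).snd j = z.snd j + t * h.snd j := rfl
  rw [h1, h2, add_smul, mul_smul]

theorem tendsto_add_smul {E : Type*} [NormedAddCommGroup E] [NormedSpace ℝ E] (x h : E) :
    Tendsto (fun t : ℝ => x + t • h) (𝓝[>] 0) (𝓝 x) := by
  have : Continuous fun t : ℝ => x + t • h := by fun_prop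
  have := this.tendsto 0
  rw [zero_smul, add_zero] at this
  exact this.mono_left nhdsWithin_le_nhds

namespace NonDegenerate

variable {ubar : P.Meas} {Nbar : ℕ} {xbar : Fin Nbar → Eucl d} {γ θ R' σ' : ℝ}
variable (hB : P.NonDegenerate ubar xbar γ θ R' σ')
include hB

/-- Strong convexity of `F` near `K ubar`, in integrated form. -/
theorem F_quadratic_growth : ∀ᶠ y in 𝓝 (P.K ubar),
    γ / 2 * ‖y - P.K ubar‖ ^ 2 ≤
      P.F y - P.F (P.K ubar) - inner ℝ (∇ P.F (P.K ubar)) (y - P.K ubar) := by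
  obtain ⟨V, hV, hγ⟩ := hB.strong_convexity
  obtain ⟨r, hr, hball⟩ := Metric.mem_nhds_iff.1 hV
  filter_upwards [Metric.ball_mem_nhds _ hr] with y hy
  have := quadratic_lower_bound (f := P.F) (g := ∇ P.F) (l := γ) (x := P.K ubar) (y := y)
    (fun w _ => (P.F_differentiable w).hasGradientAt) fun w hw =>
      hγ w (hball ((convex_ball _ r).segment_subset (Metric.mem_ball_self hr) hy hw)) _
        (mem_of_mem_nhds hV)
  linarith

variable {us : P.Sparse} (hus : P.toMeas us = ubar)
include hus

theorem fderiv_JN_eq_zero (hc : us.support.card = Nbar) {z : ZSpace d Nbar}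
    (hz : P.IsMinRep us z) : fderiv ℝ (P.JN (N := Nbar)) z = 0 := by
  have h1 : z ∈ P.argminJN Nbar := by rw [hB.argminJN_eq hus hc]; exact hz
  refine IsLocalMin.fderiv_eq_zero ?_
  filter_upwards [isOpen_Zint.mem_nhds (hB.mem_Zint hus hz)] with w hw
  exact h1.2 w (Zint_subset hw)

/-- Moving an atom off its peak increases `J_N` quadratically, by the curvature condition. -/
theorem tendsto_defect (hκ : P.KernelC21) {z : ZSpace d Nbar} (hz : P.IsMinRep us z)
    (h : ZSpace d Nbar) (j : Fin Nbar) : ∃ q, |z.snd j| * (θ * ‖h.fst j‖ ^ 2) / 2 ≤ q ∧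
    Tendsto (fun t : ℝ => (P.α * |(z + t • h).snd j| -
      (z + t • h).snd j * P.pFun ubar ((z + t • h).fst j)) / t ^ 2) (𝓝[>] 0) (𝓝 q) := by
  obtain ⟨π, hπ⟩ := hB.exists_perm hus hz
  have hint : z.fst j ∈ interior P.Ω := (hB.mem_Zint hus hz j).1
  have h0 : z.snd j ≠ 0 := (hB.mem_Zint hus hz j).2
  have hp : P.pFun ubar (z.fst j) = P.α * Real.sign (z.snd j) :=
    hB.p_eq_sign_of_isMinRep hus hz j
  set s := Real.sign (z.snd j) with hs
  have hs2 : s * s = 1 := by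
    rcases lt_or_gt_of_ne h0 with h | h
    · rw [hs, Real.sign_of_neg h]; norm_num
    · rw [hs, Real.sign_of_pos h]; norm_num
  have habs : |z.snd j| = s * z.snd j :=
    (abs_coef_eventuallyEq (fun i => (hB.mem_Zint hus hz i).2) j).self_of_nhds
  have hps : Real.sign (P.pFun ubar (z.fst j)) = s := by
    rw [hp, hs]
    rcases lt_or_gt_of_ne h0 with h | h
    · rw [Real.sign_of_neg h, Real.sign_of_neg (by linarith [P.α_pos])]
    · rw [Real.sign_of_pos h, Real.sign_of_pos (by linarith [P.α_pos])]
  have hcurv : θ * ‖h.fst j‖ ^ 2 ≤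
      -s * fderiv ℝ (fderiv ℝ (P.pFun ubar)) (z.fst j) (h.fst j) (h.fst j) := by
    have := hB.curvature (π j) (h.fst j)
    rwa [← hπ j, hps] at this
  have hbd : ∀ᶠ x in 𝓝 (z.fst j), |P.pFun ubar x| ≤ P.α := by
    filter_upwards [isOpen_interior.mem_nhds hint] with x hx
    exact abs_p_le_of_minimizer hB.minimizer ⟨x, interior_subset hx⟩
  -- The extreme value `±α` of the dual variable is attained at the atom.
  have hcrit : fderiv ℝ (P.pFun ubar) (z.fst j) = 0 := by
    rcases lt_or_gt_of_ne h0 with h | h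
    · refine IsLocalMin.fderiv_eq_zero ?_
      filter_upwards [hbd] with x hx
      rw [hp, hs, Real.sign_of_neg h]
      linarith [(abs_le.1 hx).1]
    · refine IsLocalMax.fderiv_eq_zero ?_
      filter_upwards [hbd] with x hx
      rw [hp, hs, Real.sign_of_pos h]
      linarith [(abs_le.1 hx).2]
  have hpC := c2Lip_pFun hκ ubar hint
  have ht := tendsto_second_order_line (f := P.pFun ubar) (x := z.fst j) (h := h.fst j) hpC.1
    hpC.2.1.self_of_nhds (by rw [hcrit]; rfl)
  have hcoef : Tendsto (fun t : ℝ => (z + t • h).snd j) (𝓝[>] 0) (𝓝 (z.snd j)) :=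
    ((continuous_coef (d := d) j).tendsto z).comp (tendsto_add_smul z h)
  refine ⟨_, ?_, (hcoef.neg.mul ht).congr' ?_⟩
  · rw [habs]
    have h3 : 0 ≤ s * z.snd j := habs ▸ abs_nonneg _
    have h4 := mul_le_mul_of_nonneg_left hcurv h3
    have h5 : s * z.snd j * (-s * fderiv ℝ (fderiv ℝ (P.pFun ubar)) (z.fst j) (h.fst j) (h.fst j))
        = -(s * s) *
          (z.snd j * fderiv ℝ (fderiv ℝ (P.pFun ubar)) (z.fst j) (h.fst j) (h.fst j)) := by
      ring
    rw [h5, hs2] at h4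
    linarith
  · filter_upwards [(tendsto_add_smul z h).eventually
      (abs_coef_eventuallyEq (fun i => (hB.mem_Zint hus hz i).2) j)] with t ht
    rw [ht, hp]
    have h3 : (z + t • h).fst j = z.fst j + t • h.fst j := rfl
    rw [h3]
    ring

/-- The Hessian of `J_N` at a representer of the solution is positive definite. A direction that
moves some atom is detected by the defect of that atom; a direction that changes only the
coefficients changes `KU` to first order, as the `κ(xbar j)` are linearly independent, and is
detected by the strong convexity of `F`. -/
theorem hessian_pos (hκ : P.KernelC21) (hc : us.support.card = Nbar) {z : ZSpace d Nbar}
    (hz : P.IsMinRep us z) (hC : C2Lip (P.JN (N := Nbar)) z) {h : ZSpace d Nbar} (hh : h ≠ 0) :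
    0 < inner ℝ (fderiv ℝ (∇ P.JN) z h) h := by
  rw [inner_fderiv_gradient hC]
  have ht := tendsto_second_order_line (h := h) hC.1 hC.2.1.self_of_nhds
    (by rw [hB.fderiv_JN_eq_zero hus hc hz]; rfl)
  have hZ : ∀ᶠ t : ℝ in 𝓝[>] 0, z + t • h ∈ P.Z Nbar :=
    ((tendsto_add_smul z h).eventually
      (isOpen_Zint.mem_nhds (hB.mem_Zint hus hz))).mono fun _ => (Zint_subset ·)
  suffices hq : ∃ q > 0, q ≤ fderiv ℝ (fderiv ℝ P.JN) z h h / 2 by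
    obtain ⟨q, hq, hle⟩ := hq
    linarith
  by_cases hx : ∃ j, h.fst j ≠ 0
  · obtain ⟨j, hj⟩ := hx
    obtain ⟨q, hq, htq⟩ := hB.tendsto_defect hus hκ hz h j
    refine ⟨|z.snd j| * (θ * ‖h.fst j‖ ^ 2) / 2, ?_, hq.trans (le_of_tendsto_of_tendsto htq ht ?_)⟩
    · have h1 := norm_pos_iff.2 hj
      have h2 := abs_pos.2 (hB.mem_Zint hus hz j).2
      have h3 := hB.θ_pos
      positivity
    · filter_upwards [hZ] with t ht
      refine div_le_div_of_nonneg_right ?_ (sq_nonneg t)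
      rw [hB.JN_sub_eq hus hz]
      have h1 := F_remainder_nonneg (P := P) (KU P z) (KU P (z + t • h))
      have h2 := Finset.single_le_sum (fun i _ => hB.defect_nonneg ht i) (Finset.mem_univ j)
      linarith
  · push Not at hx
    set w := ∑ j, h.snd j • P.κ (z.fst j) with hw
    have hw0 : w ≠ 0 := fun h0 => hh <| by
      obtain ⟨π, hπ⟩ := hB.exists_perm hus hz
      have hli : LinearIndependent ℝ fun j => P.κ (z.fst j) := by
        simp only [hπ]
        exact hB.linearIndependent.comp π π.injective
      have hμ := Fintype.linearIndependent_iff.1 hli (fun j => h.snd j) h0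
      refine WithLp.ofLp_injective 2 (Prod.ext ?_ ?_)
      · ext1 j
        exact hx j
      · ext1 j
        exact hμ j
    refine ⟨γ / 2 * ‖w‖ ^ 2, ?_, ge_of_tendsto ht ?_⟩
    · have h1 := norm_pos_iff.2 hw0
      have h3 := hB.γ_pos
      positivity
    · filter_upwards [hZ, self_mem_nhdsWithin, (tendsto_add_smul (P.K ubar) w).eventually
        hB.F_quadratic_growth] with t htZ ht hg
      have ht : (0 : ℝ) < t := ht
      rw [le_div_iff₀ (by positivity), hB.JN_sub_eq hus hz, KU_add_smul hx, ← hw]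
      rw [K_eq_KU hus hz, add_sub_cancel_left, norm_smul, Real.norm_of_nonneg ht.le,
        mul_pow] at hg
      rw [add_sub_cancel_left]
      have h2 : 0 ≤ ∑ j, (P.α * |(z + t • h).snd j| -
          (z + t • h).snd j * P.pFun ubar ((z + t • h).fst j)) :=
        Finset.sum_nonneg fun i _ => hB.defect_nonneg htZ i
      linarith

end NonDegenerate

/-- The Newton update and the objective near a minimizer `zbar` of `J_Nbar`. -/
structure NewtonRegion (P : SparseProblem d Y) (A : Params) {N : ℕ} (zbar : ZSpace d N) (c : ℝ)
    (z : ZSpace d N) : Prop where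
  mem_Zint : z ∈ P.Zint N
  newton_error : ‖P.newton z - zbar‖ ≤ c * ‖z - zbar‖ ^ 2
  growth : 3 / (8 * A.mbar) * ‖z - zbar‖ ^ 2 ≤ P.JN z - P.JN zbar
  upper : P.JN z - P.JN zbar ≤ 1 / A.m * ‖z - zbar‖ ^ 2
  le_grad : P.JN z - P.JN zbar ≤ A.mbar * ‖P.gradJN z‖ ^ 2
  grad_le : A.m / 4 * ‖P.gradJN z‖ ^ 2 ≤ P.JN z - P.JN zbar

/-- The local analysis of Newton's method for `J_Nbar`. The eigenvalue bounds on the inverse Hessian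
provide the constants, and positive definiteness excludes that the inverse is a junk value. -/
theorem NonDegenerate.exists_newtonRegion {ubar : P.Meas} {Nbar : ℕ} {xbar : Fin Nbar → Eucl d}
    {γ θ R' σ' : ℝ} (hB : P.NonDegenerate ubar xbar γ θ R' σ') {us : P.Sparse}
    (hus : P.toMeas us = ubar) (hc : us.support.card = Nbar) (hκ : P.KernelC21)
    (hF : ContDiff ℝ 2 P.F) (hF' : LocallyLipschitz (fderiv ℝ (gradient P.F))) {A : Params}
    (hA : P.Admissible A Nbar R') {zbar : ZSpace d Nbar} (hz : P.IsMinRep us zbar) :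
    ∃ ρ > 0, ∃ c > 0, ∀ z ∈ Metric.ball zbar ρ, NewtonRegion P A zbar c z := by
  have hC : ∀ z ∈ P.Zint Nbar, C2Lip (P.JN (N := Nbar)) z := fun z hz => c2Lip_JN hκ hF hF' hz
  have hzint := hB.mem_Zint hus hz
  have hzarg : zbar ∈ P.argminJN Nbar := by rw [hB.argminJN_eq hus hc]; exact hz
  have he := hA.eigenvalues zbar hzarg
  rw [hessJN_eq hC hzint] at he
  have hb := quadratic_form_bounds_of_inverse_eigenvalues
    (inner_fderiv_gradient_symm (hC _ hzint))
    (fun h hh => hB.hessian_pos hus hκ hc hz (hC _ hzint) hh) hA.m_pos he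
  have hg0 : ∇ P.JN zbar = 0 := by
    rw [gradient, hB.fderiv_JN_eq_zero hus hc hz, map_zero]
  obtain ⟨ρ, hρ, c, hc0, H⟩ := newton_local (hC _ hzint) hg0 hA.m_pos hA.mbar_pos hb
  obtain ⟨r, hr, hball⟩ := Metric.mem_nhds_iff.1 (isOpen_Zint.mem_nhds hzint)
  refine ⟨min ρ r, lt_min hρ hr, c, hc0, fun z hzb => ?_⟩
  have hzi : z ∈ P.Zint Nbar := hball (Metric.ball_subset_ball (min_le_right _ _) hzb)
  obtain ⟨h1, h2, h3, h4, h5, h6⟩ := H z (Metric.ball_subset_ball (min_le_left _ _) hzb)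
  rw [← gradJN_eq hC hzi] at h5 h6
  refine ⟨hzi, ?_, h3, h4, h5, h6⟩
  obtain ⟨hdet, hinv⟩ := det_ne_zero_and_apply_inverse h1
  rw [← hessJN_eq hC hzi] at hdet
  rw [newton, if_pos hdet, hessJN_eq hC hzi, gradJN_eq hC hzi]
  exact h2 _ (hinv _)

variable {A : Params}

/-! ### Conditional gradient steps -/

theorem Admissible.C_pos {Nbar : ℕ} {R' : ℝ} (hA : P.Admissible A Nbar R') : 0 < A.C := by
  have h1 := hA.M_pos
  have h2 := hA.CK_pos
  have h3 : 0 < A.L := P.LF_pos.trans_le hA.L_ge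
  unfold Params.C
  positivity

/-- The descent estimate behind the step lengths; `C` bounds the curvature of `F ∘ K` between
measures of norm at most `M`. -/
theorem J_convexCombination_le {Nbar : ℕ} {R' : ℝ} (hA : P.Admissible A Nbar R') {u v : P.Meas}
    (hu : ‖u‖ ≤ A.M) (hv : ‖v‖ ≤ A.M) {η : ℝ} (h0 : 0 ≤ η) (h1 : η ≤ 1) :
    P.J ((1 - η) • u + η • v) ≤ P.J u - η * P.gap u v + η ^ 2 * (A.C / 2) := by
  have hK : P.K ((1 - η) • u + η • v) = P.K u + η • (P.K v - P.K u) := by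
    rw [K_add, K_smul, K_smul]
    module
  have hn : ‖(1 - η) • u + η • v‖ ≤ (1 - η) * ‖u‖ + η * ‖v‖ := by
    refine (P.norm_meas_add_le _ _).trans (add_le_add ?_ ?_)
    · simpa only [abs_of_nonneg (sub_nonneg.2 h1)] using P.norm_meas_smul_le (1 - η) u
    · simpa only [abs_of_nonneg h0] using P.norm_meas_smul_le η v
  have hd : ‖P.K v - P.K u‖ ≤ 2 * A.M * A.CK := by
    have h2 := P.norm_K_le hA.CK_pos.le hA.CK_ge u
    have h3 := P.norm_K_le hA.CK_pos.le hA.CK_ge v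
    have h4 := mul_le_mul_of_nonneg_left hu hA.CK_pos.le
    have h5 := mul_le_mul_of_nonneg_left hv hA.CK_pos.le
    linarith [norm_sub_le (P.K v) (P.K u)]
  have hF := P.F_le_quadratic (P.K u) (P.K u + η • (P.K v - P.K u))
  rw [add_sub_cancel_left, real_inner_smul_right, norm_smul, Real.norm_of_nonneg h0, mul_pow] at hF
  have hq : P.LF / 2 * (η ^ 2 * ‖P.K v - P.K u‖ ^ 2) ≤ η ^ 2 * (A.C / 2) := by
    calc _ ≤ A.L / 2 * (η ^ 2 * (2 * A.M * A.CK) ^ 2) := by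
          have h6 := hA.L_ge
          have h7 : 0 ≤ A.L / 2 := by linarith [P.LF_pos]
          gcongr
      _ = _ := by unfold Params.C; ring
  have hα := mul_le_mul_of_nonneg_left hn P.α_pos.le
  rw [J, J, hK, gap_eq_inner]
  linarith

theorem norm_vdir_le (hM : 0 < A.M) (u : P.Sparse) (x : P.Ω) :
    ‖P.toMeas (P.vdir A u x)‖ ≤ A.M := by
  rw [vdir, toMeas_single]
  refine (P.norm_meas_smul_le _ _).trans ?_
  have h1 : |A.M * Real.sign (P.p (P.toMeas u) x)| ≤ A.M := by
    rw [abs_mul, abs_of_pos hM]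
    refine mul_le_of_le_one_right hM.le ?_
    rcases Real.sign_apply_eq (P.p (P.toMeas u) x) with h | h | h <;> simp [h]
  exact (mul_le_of_le_one_right (abs_nonneg _) (P.norm_dirac_le x)).trans h1

theorem norm_lazy_le (hM : 0 < A.M) {u v : P.Sparse} {ε : ℝ} (h : P.IsLazy A u ε v) :
    ‖P.toMeas v‖ ≤ A.M := by
  rcases h.1 with rfl | ⟨x, rfl⟩
  · rw [map_zero, norm_meas_zero]
    exact hM.le
  · exact norm_vdir_le hM u x

theorem norm_exactDir_le (hM : 0 < A.M) {u v : P.Sparse} (h : P.IsExactDir A u v) :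
    ‖P.toMeas v‖ ≤ A.M := by
  rcases h with ⟨-, rfl⟩ | ⟨-, x, -, rfl⟩
  · rw [map_zero, norm_meas_zero]
    exact hM.le
  · exact norm_vdir_le hM u x

/-- An exact direction maximizes `φ(u, ·)` over the ball of radius `M`. -/
theorem gap_le_of_isExactDir (hM : 0 < A.M) {u v : P.Sparse} (h : P.IsExactDir A u v) {w : P.Meas}
    (hw : ‖w‖ ≤ A.M) : P.gap (P.toMeas u) w ≤ P.gap (P.toMeas u) (P.toMeas v) := by
  set p := P.p (P.toMeas u) with hp
  have hw0 := P.norm_meas_nonneg w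
  have h1 : w p ≤ ‖w‖ * ‖p‖ := (Real.le_norm_self _).trans (w.le_opNorm p)
  suffices hs : w p - P.α * ‖w‖ ≤ P.toMeas v p - P.α * ‖P.toMeas v‖ by
    rw [gap_eq, gap_eq, ← hp]
    linarith
  rcases h with ⟨hlt, rfl⟩ | ⟨hle, x, hx, rfl⟩
  · rw [map_zero, norm_meas_zero, _root_.zero_apply]
    have := mul_le_mul_of_nonneg_left hlt.le hw0
    linarith
  · have hpx : ‖p‖ ≤ |p x| := (ContinuousMap.norm_le _ (abs_nonneg _)).2 hx
    have hv : P.toMeas (P.vdir A u x) p = A.M * |p x| := by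
      rw [vdir, toMeas_single, ← hp]
      change A.M * Real.sign (p x) * p x = _
      rcases lt_trichotomy (p x) 0 with h | h | h
      · rw [Real.sign_of_neg h, abs_of_neg h]; ring
      · simp [h]
      · rw [Real.sign_of_pos h, abs_of_pos h]; ring
    rw [hv]
    have h2 := mul_le_mul_of_nonneg_left (norm_vdir_le hM u x) P.α_pos.le
    have h3 := mul_le_mul_of_nonneg_left hpx hM.le
    have h4 := mul_le_mul_of_nonneg_right hw (sub_nonneg.2 hle)
    linarith

theorem exists_isExactDir (u : P.Sparse) : ∃ v, P.IsExactDir A u v := by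
  rcases lt_or_ge ‖P.p (P.toMeas u)‖ P.α with h | h
  · exact ⟨0, Or.inl ⟨h, rfl⟩⟩
  · have hne : Nonempty P.Ω := by
      by_contra hne
      rw [not_nonempty_iff] at hne
      have h0 : ‖P.p (P.toMeas u)‖ ≤ 0 :=
        (ContinuousMap.norm_le _ le_rfl).2 fun x => hne.elim x
      linarith [P.α_pos]
    obtain ⟨x, -, hx⟩ := isCompact_univ.exists_isMaxOn (univ_nonempty (α := P.Ω))
      (f := fun x => |P.p (P.toMeas u) x|) (by fun_prop)
    exact ⟨_, Or.inr ⟨h, x, fun y => hx (mem_univ y), rfl⟩⟩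

theorem exists_LGCGStep (u : P.Sparse) (ε : ℝ) : ∃ uG ε', P.LGCGStep A u ε uG ε' := by
  by_cases h : ∃ v, P.IsLazy A u ε v
  · obtain ⟨v, hv⟩ := h
    exact ⟨_, _, .lazy v _ hv rfl⟩
  · push Not at h
    obtain ⟨v, hv⟩ := exists_isExactDir (A := A) u
    exact ⟨_, _, .exact v _ _ h hv rfl rfl⟩

namespace NonDegenerate

variable {ubar : P.Meas} {Nbar : ℕ} {xbar : Fin Nbar → Eucl d} {γ θ R' σ' : ℝ}
variable (hB : P.NonDegenerate ubar xbar γ θ R' σ') (hA : P.Admissible A Nbar R')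
include hB hA

/-- The threshold returned by a conditional gradient step still bounds the residual, and it is
bounded by the gap along an admissible direction. -/
theorem LGCGStep_threshold (hM : ‖ubar‖ ≤ A.M) {u uG : P.Sparse} {ε ε' : ℝ}
    (hr : P.residual (P.toMeas u) ≤ 2 * A.M * ε) (h : P.LGCGStep A u ε uG ε') :
    P.residual (P.toMeas u) ≤ 2 * A.M * ε' ∧
      ∃ v : P.Meas, ‖v‖ ≤ A.M ∧ A.M * ε' ≤ P.gap (P.toMeas u) v := by
  have hMp := hA.M_pos
  cases h with
  | lazy v η hv hη => exact ⟨hr, _, norm_lazy_le hMp hv, hv.2⟩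
  | exact v η Φ hnone hv hΦ hη =>
    have h1 := gap_le_of_isExactDir hMp hv hM
    have h2 := P.J_sub_le_gap (P.toMeas u) ubar
    have h3 := hB.residual_nonneg (P.toMeas u)
    rw [hB.residual_eq] at h3 ⊢
    rw [← hΦ] at h1
    have h4 : A.M * (Φ / (2 * A.M)) = Φ / 2 := by field_simp
    refine ⟨by rw [mul_assoc, h4]; linarith, _, norm_exactDir_le hMp hv, ?_⟩
    rw [h4, ← hΦ]
    linarith

theorem J_le_of_LGCGStep (hM : ‖ubar‖ ≤ A.M) {u uG : P.Sparse} {ε ε' : ℝ}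
    (hu : ‖P.toMeas u‖ ≤ A.M) (hr : P.residual (P.toMeas u) ≤ 2 * A.M * ε)
    (h : P.LGCGStep A u ε uG ε') : P.J (P.toMeas uG) ≤ P.J (P.toMeas u) := by
  have hMp := hA.M_pos
  have hC := hA.C_pos
  have h0 := hB.residual_nonneg (P.toMeas u)
  -- Both kinds of step use the step length `min 1 (a / C)` for some `a` between `0` and the gap.
  have key : ∀ (v : P.Sparse) (a η : ℝ), ‖P.toMeas v‖ ≤ A.M → 0 ≤ a →
      a ≤ P.gap (P.toMeas u) (P.toMeas v) → η = min 1 (a / A.C) →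
      P.J (P.toMeas ((1 - η) • u + η • v)) ≤ P.J (P.toMeas u) := by
    intro v a η hv ha hgap hη
    have hη0 : 0 ≤ η := hη ▸ le_min zero_le_one (by positivity)
    have hη1 : η ≤ 1 := hη ▸ min_le_left _ _
    have hηa : η * A.C ≤ a := by
      rw [← le_div_iff₀ hC, hη]
      exact min_le_right _ _
    have h1 := J_convexCombination_le hA hu hv hη0 hη1
    rw [map_add, map_smul, map_smul]
    have h2 := mul_le_mul_of_nonneg_left hgap hη0
    have h3 := mul_le_mul_of_nonneg_left hηa hη0
    have h4 := mul_nonneg hη0 ha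
    nlinarith
  cases h with
  | lazy v η hv hη =>
    exact key v _ η (norm_lazy_le hMp hv) (by linarith) hv.2 hη
  | exact v η Φ hnone hv hΦ hη =>
    have h1 := gap_le_of_isExactDir hMp hv hM
    have h2 := P.J_sub_le_gap (P.toMeas u) ubar
    rw [hB.residual_eq] at h0
    exact key v _ η (norm_exactDir_le hMp hv) (by linarith) hΦ.le hη

/-- A state whose residual is at most `mbar ‖∇J_N‖²` satisfies the second acceptance condition for
every threshold below some gap: the conditional gradient descent along the gap direction bounds the
residual from below. -/
theorem accept₂_of_gap {u : P.Sparse} (hu : ‖P.toMeas u‖ ≤ A.M) {N : ℕ} {z : ZSpace d N}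
    (hg : P.residual (P.toMeas u) ≤ A.mbar * ‖P.gradJN z‖ ^ 2) {ε : ℝ} (hε : 0 ≤ ε) {v : P.Meas}
    (hv : ‖v‖ ≤ A.M) (hgap : A.M * ε ≤ P.gap (P.toMeas u) v) : P.Accept₂ A z ε := by
  have hMp := hA.M_pos
  have hC := hA.C_pos
  have hmb := hA.mbar_pos
  have hMε : 0 ≤ A.M * ε := by positivity
  rw [hB.residual_eq] at hg
  unfold Accept₂
  split_ifs with h
  · have h1 := J_convexCombination_le hA hu hv (η := A.M * ε / A.C) (by positivity)
      ((div_le_one hC).2 h)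
    have h2 := (hB.minimizer _).trans h1
    have h3 := mul_le_mul_of_nonneg_left hgap (div_nonneg hMε hC.le)
    have h4 : A.M * ε / A.C * (A.M * ε) - (A.M * ε / A.C) ^ 2 * (A.C / 2) =
        A.M ^ 2 * ε ^ 2 / (2 * A.C) := by
      field_simp; ring
    have h5 : A.M ^ 2 * ε ^ 2 / (2 * A.C) ≤ A.mbar * ‖P.gradJN z‖ ^ 2 := by linarith
    rw [← div_div, div_le_iff₀ hmb]
    linarith
  · have h1 := J_convexCombination_le hA hu hv (η := 1) zero_le_one le_rfl
    have h2 := (hB.minimizer _).trans h1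
    rw [div_le_iff₀ (by positivity)]
    linarith

end NonDegenerate

/-! ### Coefficient and drop steps do not increase the objective -/

theorem norm_toMeas_of_subset {u : P.Sparse} {S : Finset P.Ω} (h : u.support ⊆ S) :
    ‖P.toMeas u‖ = ∑ x ∈ S, |u x| := by
  rw [norm_toMeas]
  exact Finset.sum_subset h fun x _ hx => by rw [Finsupp.notMem_support_iff.1 hx, abs_zero]

theorem K_toMeas_of_subset {u : P.Sparse} {S : Finset P.Ω} (h : u.support ⊆ S) :
    P.K (P.toMeas u) = ∑ x ∈ S, u x • P.κ x := by
  rw [K_toMeas]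
  exact Finset.sum_subset h fun x _ hx => by rw [Finsupp.notMem_support_iff.1 hx, zero_smul]

theorem J_le_of_coefficientStep {u u' : P.Sparse} {Ψ : ℝ} (h : P.CoefficientStep A u Ψ u') :
    P.J (P.toMeas u') ≤ P.J (P.toMeas u) := by
  obtain ⟨w, ⟨hws, hw0⟩, hJ, -, rfl⟩ := h
  have hs : (P.signed u w).support ⊆ u.support := fun x hx => by
    rw [Finsupp.mem_support_iff] at hx ⊢
    intro h0
    apply hx
    simp [signed, h0]
  have h1 : P.J (P.toMeas (P.signed u w)) ≤ P.Jsigned u w := by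
    rw [J, Jsigned, K_toMeas_of_subset hs, norm_toMeas_of_subset hs, norm_toMeas_of_subset hws]
    have hle : ∑ x ∈ u.support, |P.signed u w x| ≤ ∑ x ∈ u.support, |w x| := by
      refine Finset.sum_le_sum fun x _ => ?_
      change |Real.sign (u x) * w x| ≤ _
      rw [abs_mul]
      refine mul_le_of_le_one_left (abs_nonneg _) ?_
      rcases Real.sign_apply_eq (u x) with h | h | h <;> simp [h]
    have := mul_le_mul_of_nonneg_left hle P.α_pos.le
    change P.F (P.Ksigned u w) + _ ≤ _
    linarith
  have h2 : P.Jsigned u (u.mapRange (fun a => |a|) abs_zero) = P.J (P.toMeas u) := by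
    rw [J, Jsigned, K_toMeas, P.norm_toMeas u,
      norm_toMeas_of_subset (S := u.support) Finsupp.support_mapRange]
    congr 2
    · refine Finset.sum_congr rfl fun x _ => ?_
      congr 1
      rw [Finsupp.mapRange_apply]
      rcases lt_trichotomy (u x) 0 with h | h | h
      · rw [Real.sign_of_neg h, abs_of_neg h]; ring
      · simp [h]
      · rw [Real.sign_of_pos h, abs_of_pos h]; ring
    · exact Finset.sum_congr rfl fun x _ => by rw [Finsupp.mapRange_apply, abs_abs]
  linarith

theorem J_dropStep_le (u : P.Sparse) : P.J (P.toMeas (P.dropStep A u)) ≤ P.J (P.toMeas u) := by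
  unfold dropStep
  split_ifs with h
  · exact h
  · exact le_rfl

theorem dropStep_eq_self {u : P.Sparse}
    (h : ∀ x ∈ u.support, Real.sign (P.p (P.toMeas u) x) = Real.sign (u x) ∧
      P.α - A.σ / 2 < |P.p (P.toMeas u) x|) : P.dropStep A u = u := by
  have h1 : P.dropMeas A u = u := by
    rw [dropMeas, Finsupp.filter_eq_self_iff]
    intro x hx
    obtain ⟨h2, h3⟩ := h x (Finsupp.mem_support_iff.2 hx)
    rintro (h4 | h4)
    · exact h4 h2
    · exact absurd h3 (not_lt.2 h4)
  rw [dropStep, h1, if_pos le_rfl]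

/-! ### Local merging of well-separated atoms -/

section Merge

variable {u : P.Sparse}
  (hsep : ∀ x ∈ u.support, ∀ y ∈ u.support, x ≠ y → 2 * A.R ≤ dist x y) (hR : 0 < A.R)
include hsep hR

theorem massBall_eq {x : P.Ω} (hx : x ∈ u.support) : P.massBall u x (2 * A.R) = u x := by
  classical
  rw [massBall, Finset.sum_filter, Finset.sum_eq_single_of_mem x hx]
  · rw [if_pos (Metric.mem_ball_self (by linarith))]
  · intro y hy hne
    rw [if_neg]
    rw [Metric.mem_ball, not_lt]
    exact hsep y hy x hx hne

theorem filter_notMem_ball [DecidableEq P.Ω] {S : Finset P.Ω} (hS : S ⊆ u.support) {x : P.Ω}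
    (hx : x ∈ S) [DecidablePred fun y => y ∉ Metric.ball x (2 * A.R)] :
    {y ∈ S | y ∉ Metric.ball x (2 * A.R)} = S.erase x := by
  ext y
  rw [Finset.mem_filter, Finset.mem_erase, and_comm]
  refine and_congr_left fun hy => ⟨fun h => ?_, fun h => ?_⟩
  · rintro rfl
    exact h (Metric.mem_ball_self (by linarith))
  · rw [Metric.mem_ball, not_lt]
    exact hsep y (hS hy) x (hS hx) h

/-- For atoms at distance at least `2R`, each pass of the loop removes exactly the chosen atom from
the active set and copies its mass. -/
theorem mergeLoop_iff (S : Finset P.Ω) : S ⊆ u.support → ∀ l l' : P.Sparse,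
    P.MergeLoop A u S l l' ↔ l' = l + ∑ x ∈ S, Finsupp.single x (u x) := by
  classical
  induction S using Finset.strongInduction with
  | H S ih =>
    intro hS l l'
    constructor
    · intro h
      cases h with
      | finish => simp
      | pick _ _ _ x hx hmax h =>
        rw [massBall_eq hsep hR (hS hx), filter_notMem_ball hsep hR hS hx,
          ih _ (Finset.erase_ssubset hx) ((Finset.erase_subset _ _).trans hS)] at h
        rw [h, add_assoc, Finset.add_sum_erase S (fun x => Finsupp.single x (u x)) hx]
    · rintro rfl
      rcases S.eq_empty_or_nonempty with rfl | hne
      · simpa using MergeLoop.finish l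
      · obtain ⟨x, hx, hmax⟩ := S.exists_max_image (fun y => |P.p (P.toMeas u) y|) hne
        refine .pick S l _ x hx hmax ?_
        rw [massBall_eq hsep hR (hS hx), filter_notMem_ball hsep hR hS hx,
          ih _ (Finset.erase_ssubset hx) ((Finset.erase_subset _ _).trans hS), add_assoc,
          Finset.add_sum_erase S (fun x => Finsupp.single x (u x)) hx]

theorem localMerge_iff (u' : P.Sparse) : P.LocalMerge A u u' ↔ u' = u := by
  rw [LocalMerge, mergeLoop_iff hsep hR _ (Finset.Subset.refl _), zero_add]
  have : ∑ x ∈ u.support, Finsupp.single x (u x) = u := u.sum_single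
  rw [this]

end Merge

/-! ### Invariants of the algorithm -/

/-- The invariant of the algorithm started at objective value `J₁`: outer iterates and the measures
`u_k^coef` do not exceed `J₁`, and every threshold `ε` satisfies `r_J(u) ≤ 2 M ε`. -/
def Invariant (P : SparseProblem d Y) (A : Params) (J₁ : ℝ) : P.Config → Prop
  | .outer _ u ε _ => P.J (P.toMeas u) ≤ J₁ ∧ P.residual (P.toMeas u) ≤ 2 * A.M * ε
  | .inner _ ucoef _ εout _ _ u ε => P.J (P.toMeas ucoef) ≤ J₁ ∧
      P.residual (P.toMeas ucoef) ≤ 2 * A.M * εout ∧ P.residual (P.toMeas u) ≤ 2 * A.M * ε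
  | .done _ => True

theorem residual_mono {u v : P.Meas} (h : P.J u ≤ P.J v) : P.residual u ≤ P.residual v :=
  sub_le_sub_right h _

/-- The correction of the threshold after a merging step, which may increase the objective. -/
theorem residual_le_of_shift (hM : 0 < A.M) {u v : P.Meas} {ε : ℝ}
    (h : P.residual u ≤ 2 * A.M * ε) :
    P.residual v ≤ 2 * A.M * (ε + (P.J v - P.J u) / (2 * A.M)) := by
  have : 2 * A.M * (ε + (P.J v - P.J u) / (2 * A.M)) = 2 * A.M * ε + (P.J v - P.J u) := by
    field_simp
  rw [this]
  unfold residual at *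
  linarith

theorem J_newton_le (hm : 0 < A.m) {u : P.Sparse} {N : ℕ} {z : ZSpace d N} (hz : P.IsMinRep u z)
    (h : P.Accept₁ A z) : P.J (P.toMeas (P.U (P.newton z))) ≤ P.J (P.toMeas u) := by
  have h1 := J_U_le h.1
  have h2 := h.2.2
  rw [JN_eq_of_isMinRep hz] at h2
  have h3 : 0 ≤ A.m / 8 * ‖P.gradJN z‖ ^ 2 := by positivity
  linarith

namespace NonDegenerate

variable {ubar : P.Meas} {Nbar : ℕ} {xbar : Fin Nbar → Eucl d} {γ θ R' σ' : ℝ}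
variable (hB : P.NonDegenerate ubar xbar γ θ R' σ') (hA : P.Admissible A Nbar R')
include hB

/-- The solution lies in the sublevel set of the initial measure, on which the norm is at most
`M`. -/
theorem norm_le_of_generated {S : ℕ} {u₁ : P.Sparse} {ε₁ Ψ₁ : ℝ} {c : P.Config}
    (h : P.Generated A S u₁ ε₁ Ψ₁ c) : ‖ubar‖ ≤ A.M := h.1 _ (hB.minimizer _)

include hA

theorem PassesGap_threshold (hM : ‖ubar‖ ≤ A.M) {u uG : P.Sparse} {ε ε' : ℝ} {N : ℕ}
    {z : ZSpace d N} (hr : P.residual (P.toMeas u) ≤ 2 * A.M * ε)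
    (h : P.PassesGap A u ε z uG ε') : P.residual (P.toMeas u) ≤ 2 * A.M * ε' := by
  rcases h with ⟨-, -, rfl⟩ | ⟨-, h, -, -⟩
  · exact hr
  · exact (hB.LGCGStep_threshold hA hM hr h).1

theorem invariant_step (hM : ‖ubar‖ ≤ A.M) {J₁ : ℝ} (hJ₁ : ∀ v, P.J v ≤ J₁ → ‖v‖ ≤ A.M) {S : ℕ}
    {c c' : P.Config} (h : P.Step A S c c') (hc : Invariant P A J₁ c) : Invariant P A J₁ c' := by
  cases h with
  | outer_terminate => trivial
  | outer_enter k u ε Ψ uG εout ucoef u₁ hstep hε hcoef hm =>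
    obtain ⟨h1, h2⟩ := hc
    have h3 : P.J (P.toMeas ucoef) ≤ P.J (P.toMeas u) :=
      (J_le_of_coefficientStep hcoef).trans ((J_dropStep_le uG).trans
        (hB.J_le_of_LGCGStep hA hM (hJ₁ _ h1) h2 hstep))
    have h4 := (residual_mono h3).trans (hB.LGCGStep_threshold hA hM h2 hstep).1
    exact ⟨h3.trans h1, h4, residual_le_of_shift hA.M_pos h4⟩
  | inner_terminate => trivial
  | inner_next k ucoef u₁ εout Ψ s u ε N z hz u' ε' h =>
    obtain ⟨h1, h2, h3⟩ := hc
    refine ⟨h1, h2, ?_⟩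
    cases h with
    | merge uG ε'' _ hp ha hs hm =>
      refine residual_le_of_shift hA.M_pos
        (le_trans ?_ (hB.PassesGap_threshold hA hM h3 hp))
      exact residual_mono ((J_dropStep_le _).trans (J_newton_le hA.m_pos hz ha))
    | plain uG _ hp ha hs =>
      exact (residual_mono (J_newton_le hA.m_pos hz ha)).trans
        (hB.PassesGap_threshold hA hM h3 hp)
  | inner_leave k ucoef u₁ εout Ψ s u ε N z hz uG h unext hmem hmin =>
    obtain ⟨h1, h2, h3⟩ := hc
    have h4 : P.J (P.toMeas unext) ≤ P.J (P.toMeas ucoef) := hmin _ (Or.inl (by simp))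
    exact ⟨h4.trans h1, (residual_mono h4).trans h2⟩

theorem invariant_of_generated {S : ℕ} {u₁ : P.Sparse} {ε₁ Ψ₁ : ℝ} {c : P.Config}
    (h : P.Generated A S u₁ ε₁ Ψ₁ c) : Invariant P A (P.J (P.toMeas u₁)) c := by
  have hM := hB.norm_le_of_generated h
  obtain ⟨h1, h2, -, -, h3⟩ := h
  induction h3 with
  | refl => exact ⟨le_rfl, h2⟩
  | tail _ hs ih => exact hB.invariant_step hA hM h1 hs ih

/-- If the inner loop is reached, the norm bound `M` is strict at the solution: otherwise the
initial sublevel set, on which the norm is at most `M`, cannot contain multiples `t ubar` with `t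
> 1`, so that the initial measure is already a minimizer and the first step terminates. -/
theorem norm_lt_of_generated_inner {S : ℕ} {u₁ : P.Sparse} {ε₁ Ψ₁ : ℝ} {k : ℕ}
    {ucoef uk₁ : P.Sparse} {εout Ψ : ℝ} {s : ℕ} {u : P.Sparse} {ε : ℝ}
    (h : P.Generated A S u₁ ε₁ Ψ₁ (Config.inner k ucoef uk₁ εout Ψ s u ε)) : ‖ubar‖ < A.M := by
  have hM := hB.norm_le_of_generated h
  have hMp := hA.M_pos
  obtain ⟨h1, h2, -, -, h3⟩ := h
  refine lt_of_le_of_ne hM fun heq => ?_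
  have hmin : P.J (P.toMeas u₁) ≤ P.J ubar := by
    by_contra hlt
    rw [not_le] at hlt
    have hcont : Continuous fun t : ℝ => P.F ((1 + t) • P.K ubar) + P.α * ((1 + t) * ‖ubar‖) :=
      (P.F_differentiable.continuous.comp (by fun_prop)).add (by fun_prop)
    have hev : ∀ᶠ t in 𝓝[>] (0 : ℝ),
        P.F ((1 + t) • P.K ubar) + P.α * ((1 + t) * ‖ubar‖) < P.J (P.toMeas u₁) := by
      refine nhdsWithin_le_nhds (hcont.tendsto 0 |>.eventually_lt_const ?_)
      simpa [J] using hlt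
    obtain ⟨t, ht, ht0⟩ := (hev.and self_mem_nhdsWithin).exists
    have ht0 : 0 < t := ht0
    have hle : ‖(1 + t) • ubar‖ ≤ (1 + t) * ‖ubar‖ := by
      simpa only [abs_of_pos (show 0 < 1 + t by linarith)] using P.norm_meas_smul_le (1 + t) ubar
    have hge : (1 + t) * ‖ubar‖ ≤ ‖(1 + t) • ubar‖ := by
      have hinv : ubar = (1 + t)⁻¹ • ((1 + t) • ubar) := by
        rw [smul_smul, inv_mul_cancel₀ (by linarith), one_smul]
      have := P.norm_meas_smul_le (1 + t)⁻¹ ((1 + t) • ubar)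
      rw [← hinv, abs_of_pos (by positivity), ← div_eq_inv_mul, le_div_iff₀ (by linarith)] at this
      linarith
    have := h1 ((1 + t) • ubar) (by
      rw [J, K_smul]
      have := mul_le_mul_of_nonneg_left hle P.α_pos.le
      linarith)
    rw [heq] at hge
    nlinarith
  have hu₁ : ∀ w, P.J (P.toMeas u₁) ≤ P.J w := fun w => hmin.trans (hB.minimizer w)
  rcases h3.cases_head with h3 | ⟨c, hstep, h3⟩
  · cases h3
  · cases hstep with
    | outer_terminate =>
      rcases h3.cases_head with h3 | ⟨c, hstep, h3⟩
      · cases h3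
      · cases hstep
    | outer_enter k u ε Ψ uG ε' ucoef u₁ hstep hε hcoef hm =>
      obtain ⟨h4, v, -, h5⟩ := hB.LGCGStep_threshold hA hM h2 hstep
      have h6 := gap_nonpos_of_minimizer hu₁ v
      have h7 := hB.residual_nonneg (P.toMeas u₁)
      have h8 := (hB.residual_nonneg _).trans h4
      apply hε
      have h9 : A.M * ε' = 0 := le_antisymm (h5.trans h6) (by linarith)
      exact (mul_eq_zero.1 h9).resolve_left hMp.ne'

end NonDegenerate

/-! ### The region of quadratic convergence -/

/-- The atoms of `U(z)` are kept by the drop step; `z` is meant to represent a measure. -/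
def Kept (P : SparseProblem d Y) (A : Params) {N : ℕ} (z : ZSpace d N) : Prop :=
  ∀ j, Real.sign (-inner ℝ (P.κ (z.fst j)) (∇ P.F (KU P z))) = Real.sign (z.snd j) ∧
    P.α - A.σ / 2 < |-inner ℝ (P.κ (z.fst j)) (∇ P.F (KU P z))|

theorem dropStep_eq_self_of_kept {u : P.Sparse} {N : ℕ} {z : ZSpace d N} (hz : P.IsMinRep u z)
    (h : Kept P A z) : P.dropStep A u = u := by
  classical
  obtain ⟨hZ, hi, h0, rfl⟩ := isMinRep_iff.1 hz
  refine dropStep_eq_self fun x hx => ?_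
  rw [support_U hZ hi h0] at hx
  obtain ⟨j, -, rfl⟩ := Finset.mem_image.1 hx
  rw [U_apply hZ hi, p_apply, K_U hZ]
  exact h j

/-- A radius `ν` and a constant `c` for which the balls of radius `ν` around the minimizers of
`J_Nbar`, that is, around the minimal representers of the solution `us`, have all the properties
that the convergence analysis needs. -/
structure GoodRadius (P : SparseProblem d Y) (A : Params) (us : P.Sparse) (N : ℕ) (c ν : ℝ) :
    Prop where
  pos : 0 < ν
  lt_R : ν < A.R
  contraction : c * ν ≤ 1
  decrease : 1 / A.m * c ^ 2 * ν ^ 2 ≤ 3 / (16 * A.mbar)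
  region : ∀ zbar : ZSpace d N, P.IsMinRep us zbar → ∀ z ∈ Metric.ball zbar ν,
    NewtonRegion P A zbar c z ∧ Kept P A z ∧ (‖P.toMeas us‖ < A.M → ∑ j, |z.snd j| ≤ A.M)

theorem dist_pos_le {N : ℕ} (z w : ZSpace d N) (j : Fin N) :
    dist (z.fst j) (w.fst j) ≤ dist z w :=
  (PiLp.dist_apply_le _ _ j).trans (WithLp.dist_fst_le z w)

theorem NewtonRegion.mono {N : ℕ} {zbar z : ZSpace d N} {c c' : ℝ} (h : NewtonRegion P A zbar c z)
    (hc : c ≤ c') : NewtonRegion P A zbar c' z :=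
  { h with newton_error := h.newton_error.trans (mul_le_mul_of_nonneg_right hc (sq_nonneg _)) }

namespace NonDegenerate

variable {ubar : P.Meas} {Nbar : ℕ} {xbar : Fin Nbar → Eucl d} {γ θ R' σ' : ℝ}
variable (hB : P.NonDegenerate ubar xbar γ θ R' σ') {us : P.Sparse} (hus : P.toMeas us = ubar)
include hB hus

/-- At the solution `|p| = α` with the sign of the coefficient at every atom, so that the drop
step is inactive nearby. -/
theorem eventually_kept (hκ : P.KernelC21) (hσ : 0 < A.σ) {zbar : ZSpace d Nbar}
    (hz : P.IsMinRep us zbar) : ∀ᶠ z in 𝓝 zbar, Kept P A z := by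
  refine eventually_all.2 fun j => ?_
  have hint := hB.mem_Zint hus hz
  have hcont : ContinuousAt
      (fun z : ZSpace d Nbar => -inner ℝ (P.κ (z.fst j)) (∇ P.F (KU P z))) zbar := by
    have h1 : ContinuousAt (fun z : ZSpace d Nbar => P.κ (z.fst j)) zbar :=
      ContinuousAt.comp (g := P.κ) (f := fun z : ZSpace d Nbar => z.fst j)
        (hκ.c2Lip (hint j).1).c1Lip.lipNear.continuousAt (continuous_pos j).continuousAt
    have h2 : ContinuousAt (fun z : ZSpace d Nbar => ∇ P.F (KU P z)) zbar :=
      P.continuous_gradient_F.continuousAt.comp (c2Lip_KU hκ hint).c1Lip.lipNear.continuousAt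
    exact (h1.inner h2).neg
  have hval : -inner ℝ (P.κ (zbar.fst j)) (∇ P.F (KU P zbar)) =
      P.α * Real.sign (zbar.snd j) := by
    rw [← K_eq_KU hus hz]
    exact hB.p_eq_sign_of_isMinRep hus hz j
  have hcoef := (continuous_coef (d := d) j).tendsto zbar
  have hα := P.α_pos
  rcases lt_or_gt_of_ne (hint j).2 with h | h
  · rw [Real.sign_of_neg h] at hval
    filter_upwards [hcoef.eventually_lt_const h,
      hcont.tendsto.eventually_lt_const (u := min 0 (-(P.α - A.σ / 2)))
        (by rw [hval]; exact lt_min (by linarith) (by linarith))] with z hz1 hz2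
    obtain ⟨hz3, hz4⟩ := lt_min_iff.1 hz2
    rw [Real.sign_of_neg hz1, Real.sign_of_neg hz3, abs_of_neg hz3]
    exact ⟨rfl, by linarith⟩
  · rw [Real.sign_of_pos h] at hval
    filter_upwards [hcoef.eventually_const_lt h,
      hcont.tendsto.eventually_const_lt (u := max 0 (P.α - A.σ / 2))
        (by rw [hval]; exact max_lt (by linarith) (by linarith))] with z hz1 hz2
    obtain ⟨hz3, hz4⟩ := max_lt_iff.1 hz2
    rw [Real.sign_of_pos hz1, Real.sign_of_pos hz3, abs_of_pos hz3]
    exact ⟨rfl, hz4⟩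

/-- As there are finitely many representers of the solution, one radius and one constant serve
all. -/
theorem exists_goodRadius (hc : us.support.card = Nbar) (hκ : P.KernelC21)
    (hF : ContDiff ℝ 2 P.F) (hF' : LocallyLipschitz (fderiv ℝ (gradient P.F)))
    (hA : P.Admissible A Nbar R') : ∃ c ν, 0 < c ∧ GoodRadius P A us Nbar c ν := by
  obtain ⟨z₀, hz₀⟩ := exists_isMinRep hc
  have hrep : ∀ π : Equiv.Perm (Fin Nbar), P.IsMinRep us (permZ π z₀) := isMinRep_permZ hz₀
  have hex := fun π => hB.exists_newtonRegion hus hc hκ hF hF' hA (hrep π)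
  choose ρ hρ c hc0 hreg using hex
  obtain ⟨c', hc'⟩ := Finite.exists_le c
  have hc'0 : 0 < c' := (hc0 (Equiv.refl _)).trans_le (hc' _)
  have hm := hA.m_pos
  have hmb := hA.mbar_pos
  have hnorm : ∀ π, ∀ᶠ z in 𝓝 (permZ π z₀),
      ‖P.toMeas us‖ < A.M → ∑ j, |z.snd j| ≤ A.M := fun π => by
    by_cases hM : ‖P.toMeas us‖ < A.M
    · have hcont : Continuous fun z : ZSpace d Nbar => ∑ j, |z.snd j| :=
        continuous_finsetSum _ fun j _ => (continuous_coef j).abs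
      filter_upwards [(hcont.tendsto (permZ π z₀)).eventually_lt_const
        (by rw [← norm_eq_of_isMinRep (hrep π)]; exact hM)] with z hz _ using hz.le
    · exact .of_forall fun _ h => absurd h hM
  have hball : ∀ π, ∀ᶠ ν in 𝓝[>] (0 : ℝ), ∀ z ∈ Metric.ball (permZ π z₀) ν,
      NewtonRegion P A (permZ π z₀) c' z ∧ Kept P A z ∧
        (‖P.toMeas us‖ < A.M → ∑ j, |z.snd j| ≤ A.M) := fun π => by
    have hev : ∀ᶠ z in 𝓝 (permZ π z₀), NewtonRegion P A (permZ π z₀) c' z ∧ Kept P A z ∧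
        (‖P.toMeas us‖ < A.M → ∑ j, |z.snd j| ≤ A.M) := by
      filter_upwards [Metric.ball_mem_nhds _ (hρ π),
        hB.eventually_kept hus hκ hA.σ_pos (hrep π), hnorm π] with z h1 h2 h3
      exact ⟨(hreg π z h1).mono (hc' π), h2, h3⟩
    obtain ⟨r, hr, hr'⟩ := Metric.eventually_nhds_iff_ball.1 hev
    filter_upwards [Ioo_mem_nhdsGT hr] with ν hν z hz
    exact hr' z (Metric.ball_subset_ball hν.2.le hz)
  have hsmall : ∀ᶠ ν in 𝓝[>] (0 : ℝ), c' * ν < 1 ∧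
      1 / A.m * c' ^ 2 * ν ^ 2 < 3 / (16 * A.mbar) := by
    have h1 : Continuous fun ν : ℝ => c' * ν := by fun_prop
    have h2 : Continuous fun ν : ℝ => 1 / A.m * c' ^ 2 * ν ^ 2 := by fun_prop
    refine nhdsWithin_le_nhds (((h1.tendsto 0).eventually_lt_const ?_).and
      ((h2.tendsto 0).eventually_lt_const ?_))
    · simp
    · rw [zero_pow two_ne_zero, mul_zero]
      positivity
  obtain ⟨ν, ⟨hν1, hν3, hν4⟩, hν2⟩ :=
    (((eventually_all.2 hball).and hsmall).and (Ioo_mem_nhdsGT hA.R_pos)).exists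
  refine ⟨c', ν, hc'0, hν2.1, hν2.2, hν3.le, hν4.le, fun zbar hz => ?_⟩
  obtain ⟨π, rfl⟩ := exists_perm_of_isMinRep hz₀ hz
  exact hν1 π

omit hus in
theorem le_dist_atoms (hA : P.Admissible A Nbar R') {z zbar : ZSpace d Nbar} {ν : ℝ}
    (hz : ∃ π : Equiv.Perm (Fin Nbar), ∀ j, zbar.fst j = xbar (π j)) (hν : ν < A.R)
    (hzb : z ∈ Metric.ball zbar ν) {i j : Fin Nbar} (hij : i ≠ j) :
    2 * A.R ≤ dist (z.fst i) (z.fst j) := by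
  obtain ⟨π, hπ⟩ := hz
  have h1 := hB.R'_le_dist (π.injective.ne hij)
  rw [← hπ, ← hπ] at h1
  have h2 := (dist_pos_le z zbar i).trans_lt (Metric.mem_ball.1 hzb)
  have h3 := (dist_pos_le z zbar j).trans_lt (Metric.mem_ball.1 hzb)
  have h4 := dist_triangle4 (zbar.fst i) (z.fst i) (z.fst j) (zbar.fst j)
  rw [dist_comm (zbar.fst i) (z.fst i)] at h4
  linarith [hA.R_le]

/-- The points of the balls of good radius represent their measures minimally, and these measures
are not changed by merging. -/
theorem isMinRep_and_localMerge (hA : P.Admissible A Nbar R') {c ν : ℝ}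
    (hG : GoodRadius P A us Nbar c ν) {z zbar : ZSpace d Nbar} (hz : P.IsMinRep us zbar)
    (hzb : z ∈ Metric.ball zbar ν) : P.IsMinRep (P.U z) z ∧
      ∀ u', P.LocalMerge A (P.U z) u' ↔ u' = P.U z := by
  classical
  have hint := (hG.region zbar hz z hzb).1.mem_Zint
  have hZ : z ∈ P.Z Nbar := Zint_subset hint
  have hd : ∀ {i j}, i ≠ j → 2 * A.R ≤ dist (z.fst i) (z.fst j) := fun hij =>
    hB.le_dist_atoms hA (hB.exists_perm hus hz) hG.lt_R hzb hij
  have hi : Function.Injective fun j => z.fst j := fun i j hij => by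
    by_contra hne
    have := hd hne
    have hij : z.fst i = z.fst j := hij
    rw [hij, dist_self] at this
    linarith [hA.R_pos]
  refine ⟨isMinRep_iff.2 ⟨hZ, hi, fun j => (hint j).2, rfl⟩, localMerge_iff ?_ hA.R_pos⟩
  intro x hx y hy hxy
  rw [support_U hZ hi fun j => (hint j).2] at hx hy
  obtain ⟨i, -, rfl⟩ := Finset.mem_image.1 hx
  obtain ⟨j, -, rfl⟩ := Finset.mem_image.1 hy
  exact hd fun h => hxy (by rw [h])

end NonDegenerate

/-- The conclusions of one Newton step from a representer `z` of `u` near a minimizer. -/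
structure NewtonStep (P : SparseProblem d Y) (A : Params) (us : P.Sparse) (c ν : ℝ) (u : P.Sparse)
    {N : ℕ} (z : ZSpace d N) : Prop where
  accept₁ : P.Accept₁ A z
  norm_le : ‖P.toMeas u‖ ≤ A.M
  residual_le : P.residual (P.toMeas u) ≤ A.mbar * ‖P.gradJN z‖ ^ 2
  drop : P.dropStep A (P.U (P.newton z)) = P.U (P.newton z)
  merge : ∀ u', P.LocalMerge A (P.U (P.newton z)) u' ↔ u' = P.U (P.newton z)
  isMinRep : P.IsMinRep (P.U (P.newton z)) (P.newton z)
  near : ∃ zbar : ZSpace d N, P.IsMinRep us zbar ∧ P.newton z ∈ Metric.ball zbar ν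
  quadratic : P.residual (P.toMeas (P.U (P.newton z))) ≤
    8 * c ^ 2 * A.mbar ^ 2 / A.m * P.residual (P.toMeas u) ^ 2

namespace NonDegenerate

variable {ubar : P.Meas} {Nbar : ℕ} {xbar : Fin Nbar → Eucl d} {γ θ R' σ' : ℝ}
variable (hB : P.NonDegenerate ubar xbar γ θ R' σ') {us : P.Sparse} (hus : P.toMeas us = ubar)
variable (hA : P.Admissible A Nbar R') {c ν : ℝ} (hG : GoodRadius P A us Nbar c ν) (hc : 0 < c)

include hG hc in
/-- Quadratic convergence with `c ν ≤ 1` makes the Newton step non-expansive on the ball. -/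
theorem newton_mem_ball {z zbar : ZSpace d Nbar} (hz : P.IsMinRep us zbar)
    (hzb : z ∈ Metric.ball zbar ν) : P.newton z ∈ Metric.ball zbar ν := by
  have h1 := (hG.region zbar hz z hzb).1.newton_error
  rw [mem_ball_iff_norm] at hzb ⊢
  have h2 : c * ‖z - zbar‖ ≤ 1 :=
    (mul_le_mul_of_nonneg_left hzb.le hc.le).trans hG.contraction
  have h3 := mul_le_mul_of_nonneg_right h2 (norm_nonneg (z - zbar))
  rw [pow_two, ← mul_assoc] at h1
  linarith

include hB hus hA hG hc

/-- The decrease of `J_N` is at least half of the residual, since the residual of the Newton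
iterate is of the order of the fourth power of the distance, while the residual of `z` grows
quadratically with the distance. -/
theorem newtonStep (hM : ‖ubar‖ < A.M) {u : P.Sparse} {z zbar : ZSpace d Nbar}
    (hzu : P.IsMinRep u z) (hz : P.IsMinRep us zbar) (hzb : z ∈ Metric.ball zbar ν) :
    NewtonStep P A us c ν u z := by
  obtain ⟨hN, -, hnorm⟩ := hG.region zbar hz z hzb
  have hzb' := newton_mem_ball hG hc hz hzb
  obtain ⟨hN', hkept', hnorm'⟩ := hG.region zbar hz _ hzb'
  obtain ⟨hrep', hmerge⟩ := hB.isMinRep_and_localMerge hus hA hG hz hzb'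
  rw [hus] at hnorm hnorm'
  have hm := hA.m_pos
  have hmb := hA.mbar_pos
  have hbar : P.JN zbar = P.J ubar := by rw [JN_eq_of_isMinRep hz, hus]
  have hr : P.residual (P.toMeas u) = P.JN z - P.JN zbar := by
    rw [hB.residual_eq, JN_eq_of_isMinRep hzu, hbar]
  have hr' : P.residual (P.toMeas (P.U (P.newton z))) = P.JN (P.newton z) - P.JN zbar := by
    rw [hB.residual_eq, JN_eq_of_isMinRep hrep', hbar]
  have hd : ‖z - zbar‖ < ν := mem_ball_iff_norm.1 hzb
  set δ := ‖z - zbar‖ with hδ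
  have hδ0 : 0 ≤ δ := norm_nonneg _
  set r := P.JN z - P.JN zbar with hrdef
  have hgrow : 3 / (8 * A.mbar) * δ ^ 2 ≤ r := hN.growth
  have hup : P.JN (P.newton z) - P.JN zbar ≤ 1 / A.m * (c * δ ^ 2) ^ 2 :=
    hN'.upper.trans (by
      have := hN.newton_error
      gcongr)
  have hr0 : 0 ≤ r := le_trans (by positivity) hgrow
  have hδr : δ ^ 2 ≤ 8 * A.mbar / 3 * r := by
    calc δ ^ 2 = 8 * A.mbar / 3 * (3 / (8 * A.mbar) * δ ^ 2) := by field_simp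
      _ ≤ _ := by gcongr
  refine ⟨⟨hrep'.2.1, hnorm' hM, ?_⟩, ?_, hr ▸ hN.le_grad,
    dropStep_eq_self_of_kept hrep' hkept', hmerge, hrep', ⟨zbar, hz, hzb'⟩, ?_⟩
  · have h1 : 1 / A.m * (c * δ ^ 2) ^ 2 ≤ r / 2 := by
      calc 1 / A.m * (c * δ ^ 2) ^ 2 = (1 / A.m * c ^ 2 * δ ^ 2) * δ ^ 2 := by ring
        _ ≤ (1 / A.m * c ^ 2 * ν ^ 2) * δ ^ 2 := by gcongr
        _ ≤ 3 / (16 * A.mbar) * (8 * A.mbar / 3 * r) := by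
            have := hG.decrease
            gcongr
        _ = r / 2 := by field_simp; ring
    have h2 := hN.grad_le
    rw [← hrdef] at h2
    linarith
  · rw [norm_eq_of_isMinRep hzu]
    exact hnorm hM
  · rw [hr', hr]
    calc P.JN (P.newton z) - P.JN zbar ≤ 1 / A.m * (c * δ ^ 2) ^ 2 := hup
      _ ≤ 1 / A.m * (c * (8 * A.mbar / 3 * r)) ^ 2 := by gcongr
      _ = 64 / 9 * (c ^ 2 * A.mbar ^ 2 / A.m * r ^ 2) := by field_simp; ring
      _ ≤ 8 * (c ^ 2 * A.mbar ^ 2 / A.m * r ^ 2) := by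
          gcongr
          norm_num
      _ = _ := by ring

end NonDegenerate

/-! ### The inner loop near the solution -/

namespace NewtonStep

variable {us u : P.Sparse} {c ν ε : ℝ} {S s N : ℕ} {z : ZSpace d N}

theorem eq_of_next (hN : NewtonStep P A us c ν u z)
    {u' : P.Sparse} {ε' : ℝ} (h : P.InnerBody A S s u ε z (Outcome.next u' ε')) :
    u' = P.U (P.newton z) := by
  cases h with
  | merge uG ε'' _ _ _ _ hm =>
    rw [hN.drop] at hm
    exact (hN.merge _).1 hm
  | plain => rfl

theorem exists_next (hN : NewtonStep P A us c ν u z)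
    {uG : P.Sparse} {ε' : ℝ} (h : P.PassesGap A u ε z uG ε') :
    ∃ ε'', P.InnerBody A S s u ε z (Outcome.next (P.U (P.newton z)) ε'') := by
  by_cases hs : s % S = 0
  · refine ⟨_, .merge uG ε' _ h hN.accept₁ hs ?_⟩
    rw [hN.drop]
    exact (hN.merge _).2 rfl
  · exact ⟨_, .plain uG ε' h hN.accept₁ hs⟩

end NewtonStep

namespace NonDegenerate

variable {ubar : P.Meas} {Nbar : ℕ} {xbar : Fin Nbar → Eucl d} {γ θ R' σ' : ℝ}
variable (hB : P.NonDegenerate ubar xbar γ θ R' σ') {us : P.Sparse} (hus : P.toMeas us = ubar)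
include hB hus

theorem infDist_lt_iff (hcard : us.support.card = Nbar) {z : ZSpace d Nbar} {ν : ℝ} :
    Metric.infDist z (P.argminJN Nbar) < ν ↔
      ∃ zbar, P.IsMinRep us zbar ∧ z ∈ Metric.ball zbar ν := by
  obtain ⟨z₀, hz₀⟩ := exists_isMinRep (d := d) hcard
  rw [hB.argminJN_eq hus hcard, Metric.infDist_lt_iff ⟨z₀, hz₀⟩]
  rfl

/-- Closeness of one minimal representer to the set of minimizers is closeness of all of them, as
both are determined up to a permutation of the indices. -/
theorem near_of_isMinRep (hcard : us.support.card = Nbar) {u : P.Sparse} {z zbar : ZSpace d Nbar}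
    {ν : ℝ} (hz : P.IsMinRep u z) (hzbar : P.IsMinRep us zbar) (hzb : z ∈ Metric.ball zbar ν) :
    P.Near Nbar ν u := by
  refine ⟨hz.1, fun z' hz' => ?_⟩
  obtain ⟨π, rfl⟩ := exists_perm_of_isMinRep hz hz'
  refine (hB.infDist_lt_iff hus hcard).2 ⟨permZ π zbar, isMinRep_permZ hzbar π, ?_⟩
  rwa [Metric.mem_ball, dist_permZ]

variable (hA : P.Admissible A Nbar R') {c ν : ℝ} {S s : ℕ} {u : P.Sparse} {ε : ℝ}
  {z : ZSpace d Nbar}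
include hA

omit hus in
theorem accept₂_of_LGCGStep (hM : ‖ubar‖ < A.M) (hN : NewtonStep P A us c ν u z)
    (hr : P.residual (P.toMeas u) ≤ 2 * A.M * ε) {uG : P.Sparse} {ε' : ℝ}
    (h : P.LGCGStep A u ε uG ε') : P.Accept₂ A z ε' := by
  obtain ⟨h1, v, hv, hgap⟩ := hB.LGCGStep_threshold hA hM.le hr h
  have h2 := (hB.residual_nonneg _).trans h1
  have hMp := hA.M_pos
  exact hB.accept₂_of_gap hA hN.norm_le hN.residual_le
    (nonneg_of_mul_nonneg_right h2 (by positivity)) hv hgap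

omit hus in
theorem not_leave (hM : ‖ubar‖ < A.M) (hN : NewtonStep P A us c ν u z)
    (hr : P.residual (P.toMeas u) ≤ 2 * A.M * ε) (uG : P.Sparse) :
    ¬ P.InnerBody A S s u ε z (Outcome.leave uG) := by
  intro h
  cases h with
  | leave₂ _ ε' _ hstep _ hn => exact hn (hB.accept₂_of_LGCGStep hA hM hN hr hstep)
  | leave₁ _ ε' _ hn => exact hn hN.accept₁

omit hus in
/-- Termination returns the threshold zero, which bounds the residual. -/
theorem eq_of_terminate (hM : ‖ubar‖ < A.M) (hr : P.residual (P.toMeas u) ≤ 2 * A.M * ε)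
    (h : P.InnerBody A S s u ε z Outcome.terminate) : P.toMeas u = ubar := by
  cases h with
  | terminate uG _ hstep =>
    have h1 := (hB.LGCGStep_threshold hA hM.le hr hstep).1
    rw [mul_zero] at h1
    exact hB.eq_of_residual_le_zero h1

omit hus in
/-- The inner loop cannot get stuck: a conditional gradient step always has an output, and its
threshold either is zero, which proves optimality, or satisfies the second acceptance condition. -/
theorem next_or_terminate (hM : ‖ubar‖ < A.M) (hN : NewtonStep P A us c ν u z)
    (hr : P.residual (P.toMeas u) ≤ 2 * A.M * ε) :
    (∃ ε', P.InnerBody A S s u ε z (Outcome.next (P.U (P.newton z)) ε')) ∨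
      (P.toMeas u = ubar ∧ P.InnerBody A S s u ε z Outcome.terminate) := by
  by_cases h : P.Accept₂ A z ε
  · exact .inl (hN.exists_next (.inl ⟨h, rfl, rfl⟩))
  obtain ⟨uG, ε', hstep⟩ := exists_LGCGStep (A := A) u ε
  by_cases hε : ε' = 0
  · subst hε
    have ht : P.InnerBody A S s u ε z Outcome.terminate := .terminate uG h hstep
    exact .inr ⟨hB.eq_of_terminate hA hM hr ht, ht⟩
  · exact .inl (hN.exists_next
      (.inr ⟨h, hstep, hε, hB.accept₂_of_LGCGStep hA hM hN hr hstep⟩))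

variable (hcard : us.support.card = Nbar) (hG : GoodRadius P A us Nbar c ν) (hc : 0 < c)
include hcard hG hc

theorem newtonStep_of_infDist_lt (hM : ‖ubar‖ < A.M) (hz : P.IsMinRep u z)
    (hd : Metric.infDist z (P.argminJN Nbar) < ν) : NewtonStep P A us c ν u z := by
  obtain ⟨zbar, h1, h2⟩ := (hB.infDist_lt_iff hus hcard).1 hd
  exact hB.newtonStep hus hA hG hc hM hz h1 h2

/-- A state of the inner loop near the solution has a successor. -/
theorem exists_step_of_near (hM : ‖ubar‖ < A.M) (hu : P.Near Nbar ν u)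
    (hr : P.residual (P.toMeas u) ≤ 2 * A.M * ε) (k : ℕ) (ucoef uk₁ : P.Sparse) (εout Ψ : ℝ) :
    ∃ c', P.Step A S (Config.inner k ucoef uk₁ εout Ψ s u ε) c' := by
  obtain ⟨z, hz⟩ := exists_isMinRep (d := d) hu.1
  have hN := hB.newtonStep_of_infDist_lt hus hA hcard hG hc hM hz (hu.2 z hz)
  rcases hB.next_or_terminate (S := S) (s := s) hA hM hN hr with ⟨ε', h⟩ | ⟨-, h⟩
  · exact ⟨_, .inner_next _ _ _ _ _ _ _ _ _ z hz _ _ h⟩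
  · exact ⟨_, .inner_terminate _ _ _ _ _ _ _ _ _ z hz h⟩

/-- A step from a state of the inner loop near the solution is a step of the inner loop to a state
near the solution with quadratically smaller residual, or terminates with the solution. -/
theorem step_of_near (hM : ‖ubar‖ < A.M) (hu : P.Near Nbar ν u)
    (hr : P.residual (P.toMeas u) ≤ 2 * A.M * ε) {k : ℕ} {ucoef uk₁ : P.Sparse} {εout Ψ : ℝ}
    {c' : P.Config} (h : P.Step A S (Config.inner k ucoef uk₁ εout Ψ s u ε) c') :
    (∃ u' ε', c' = Config.inner k ucoef uk₁ εout Ψ (s + 1) u' ε' ∧ P.Near Nbar ν u' ∧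
      P.residual (P.toMeas u') ≤
        8 * c ^ 2 * A.mbar ^ 2 / A.m * P.residual (P.toMeas u) ^ 2) ∨
      (c' = Config.done u ∧ P.toMeas u = ubar) := by
  have hNewton : ∀ {N : ℕ} {z : ZSpace d N}, P.IsMinRep u z → ∃ hN : N = Nbar,
      NewtonStep P A us c ν u (hN ▸ z) := by
    intro N z hz
    obtain rfl : N = Nbar := hz.1.symm.trans hu.1
    exact ⟨rfl, hB.newtonStep_of_infDist_lt hus hA hcard hG hc hM hz (hu.2 z hz)⟩
  cases h with
  | inner_terminate _ _ _ _ _ _ _ _ N z hz h =>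
    obtain ⟨rfl, hN⟩ := hNewton hz
    exact .inr ⟨rfl, hB.eq_of_terminate hA hM hr h⟩
  | inner_next _ _ _ _ _ _ _ _ N z hz u' ε' h =>
    obtain ⟨rfl, hN⟩ := hNewton hz
    obtain rfl := hN.eq_of_next h
    obtain ⟨zbar, h1, h2⟩ := hN.near
    exact .inl ⟨_, _, rfl, hB.near_of_isMinRep hus hcard hN.isMinRep h1 h2, hN.quadratic⟩
  | inner_leave _ _ _ _ _ _ _ _ N z hz uG h =>
    obtain ⟨rfl, hN⟩ := hNewton hz
    exact absurd h (hB.not_leave hA hM hN hr uG)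

/-- The configurations that can be reached from a state near the solution; the bound on the residual
is carried along by the invariant. -/
theorem reachable_of_near {u₁ : P.Sparse} {ε₁ Ψ₁ : ℝ} {k : ℕ} {ucoef uk₁ : P.Sparse}
    {εout Ψ : ℝ} (hgen : P.Generated A S u₁ ε₁ Ψ₁ (Config.inner k ucoef uk₁ εout Ψ s u ε))
    (hu : P.Near Nbar ν u) {c' : P.Config}
    (h : Relation.ReflTransGen (P.Step A S) (Config.inner k ucoef uk₁ εout Ψ s u ε) c') :
    (∃ n u' ε', c' = Config.inner k ucoef uk₁ εout Ψ (s + n) u' ε' ∧ P.Near Nbar ν u' ∧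
        P.residual (P.toMeas u') ≤ 2 * A.M * ε') ∨
      (∃ u', c' = Config.done u' ∧ P.toMeas u' = ubar) := by
  have hM := hB.norm_lt_of_generated_inner hA hgen
  induction h with
  | refl => exact .inl ⟨0, u, ε, rfl, hu, (hB.invariant_of_generated hA hgen).2.2⟩
  | tail hcs hs ih =>
    rcases ih with ⟨n, u', ε', rfl, hu', hr⟩ | ⟨u', rfl, -⟩
    · rcases hB.step_of_near hus hA hcard hG hc hM hu' hr hs with
        ⟨u'', ε'', rfl, hu'', -⟩ | ⟨rfl, h⟩
      · have hgen' := hB.invariant_of_generated hA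
          ⟨hgen.1, hgen.2.1, hgen.2.2.1, hgen.2.2.2.1, hgen.2.2.2.2.trans (hcs.tail hs)⟩
        exact .inl ⟨n + 1, u'', ε'', rfl, hu'', hgen'.2.2⟩
      · exact .inr ⟨u', rfl, h⟩
    · cases hs

theorem exists_sequence_of_near {u₁ : P.Sparse} {ε₁ Ψ₁ : ℝ} {k : ℕ} {ucoef uk₁ : P.Sparse}
    {εout Ψ : ℝ} (hgen : P.Generated A S u₁ ε₁ Ψ₁ (Config.inner k ucoef uk₁ εout Ψ s u ε))
    (hu : P.Near Nbar ν u) {f : ℕ → P.Config}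
    (hf0 : f 0 = Config.inner k ucoef uk₁ εout Ψ s u ε)
    (hf : ∀ n, P.Step A S (f n) (f (n + 1))) :
    ∃ (w : ℕ → P.Sparse) (e : ℕ → ℝ), w 0 = u ∧
      ∀ n, f n = Config.inner k ucoef uk₁ εout Ψ (s + n) (w n) (e n) ∧
        (w n).support.card = Nbar ∧
        P.residual (P.toMeas (w (n + 1))) ≤
          8 * c ^ 2 * A.mbar ^ 2 / A.m * P.residual (P.toMeas (w n)) ^ 2 := by
  have hM := hB.norm_lt_of_generated_inner hA hgen
  -- A terminal configuration has no successor.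
  have hdone : ∀ n u', f n ≠ Config.done u' := fun n u' h => by
    have := hf n
    rw [h] at this
    cases this
  have hreach : ∀ n, Relation.ReflTransGen (P.Step A S)
      (Config.inner k ucoef uk₁ εout Ψ s u ε) (f n) := fun n => by
    induction n with
    | zero => rw [hf0]
    | succ n ih => exact ih.tail (hf n)
  have key : ∀ n, ∃ u' ε', f n = Config.inner k ucoef uk₁ εout Ψ (s + n) u' ε' ∧
      P.Near Nbar ν u' ∧ P.residual (P.toMeas u') ≤ 2 * A.M * ε' := by
    intro n
    induction n with
    | zero => exact ⟨u, ε, hf0, hu, (hB.invariant_of_generated hA hgen).2.2⟩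
    | succ n ih =>
      obtain ⟨u', ε', h1, h2, h3⟩ := ih
      have hs := hf n
      rw [h1] at hs
      rcases hB.step_of_near hus hA hcard hG hc hM h2 h3 hs with ⟨u'', ε'', h4, h5, -⟩ | ⟨h4, -⟩
      · have h6 := hreach (n + 1)
        rw [h4] at h6
        exact ⟨u'', ε'', h4, h5, (hB.invariant_of_generated hA
          ⟨hgen.1, hgen.2.1, hgen.2.2.1, hgen.2.2.2.1, hgen.2.2.2.2.trans h6⟩).2.2⟩
      · exact absurd h4 (hdone _ _)
  choose w e h1 h2 h3 using key
  refine ⟨w, e, ?_, fun n => ⟨h1 n, (h2 n).1, ?_⟩⟩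
  · have h := (h1 0).symm.trans hf0
    injection h
  · have hs := hf n
    rw [h1 n] at hs
    rcases hB.step_of_near hus hA hcard hG hc hM (h2 n) (h3 n) hs with ⟨u', ε', h4, -, h5⟩ | ⟨h4, -⟩
    · have h6 := (h1 (n + 1)).symm.trans h4
      injection h6 with _ _ _ _ _ _ h7
      rw [h7]
      exact h5
    · exact absurd h4 (hdone _ _)

omit hA in
theorem newtonContracts : P.NewtonContracts Nbar ν c := by
  intro zbar hzbar z hz
  rw [hB.argminJN_eq hus hcard] at hzbar
  obtain ⟨hN, -, -⟩ := hG.region zbar hzbar z hz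
  exact ⟨hN.mem_Zint, newton_mem_ball hG hc hzbar hz, hN.newton_error⟩

end NonDegenerate

end SparseProblem

end NLGCG

theorem mainTheorem6 {d : ℕ} {Y : Type*} [NormedAddCommGroup Y] [InnerProductSpace ℝ Y]
    [CompleteSpace Y] (P : SparseProblem d Y) (ubar : P.Meas) {Nbar : ℕ}
    (xbar : Fin Nbar → Eucl d) (γ θ R' σ' : ℝ)
    (hB : P.NonDegenerate ubar xbar γ θ R' σ') (hκ : P.KernelC21)
    (hF : ContDiff ℝ 2 P.F) (hF' : LocallyLipschitz (fderiv ℝ (gradient P.F)))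
    (A : Params) (hA : P.Admissible A Nbar R') :
    ∃ ν₀ cNew : ℝ, 0 < ν₀ ∧ ν₀ < A.R ∧ 0 < cNew ∧ P.NewtonContracts Nbar ν₀ cNew ∧
      ∀ (S : ℕ) (u₁ : P.Sparse) (ε₁ Ψ₁ : ℝ) (k : ℕ) (ucoef uk₁ : P.Sparse) (εout Ψ : ℝ)
        (s : ℕ) (u : P.Sparse) (ε : ℝ) (z : ZSpace d Nbar),
        P.Generated A S u₁ ε₁ Ψ₁ (Config.inner k ucoef uk₁ εout Ψ s u ε) →
        u.support.card = Nbar → P.IsMinRep u z →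
        Metric.infDist z (P.argminJN Nbar) < ν₀ →
        -- the Newton step is accepted
        (P.Accept₁ A z ∧
          (∀ uG ε', P.LGCGStep A u ε uG ε' → P.Accept₂ A z ε') ∧
          (∀ uG, ¬ P.InnerBody A S s u ε z (Outcome.leave uG))) ∧
        -- it is unchanged by the drop step and by merging
        (P.dropStep A (P.U (P.newton z)) = P.U (P.newton z) ∧
          ∀ u', P.LocalMerge A (P.U (P.newton z)) u' ↔ u' = P.U (P.newton z)) ∧
        -- the next iterate exists unless the algorithm stops at the solution,
        -- and it is the Newton iterate
        ((∃ ε', P.InnerBody A S s u ε z (Outcome.next (P.U (P.newton z)) ε')) ∨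
          (P.toMeas u = ubar ∧ P.InnerBody A S s u ε z Outcome.terminate)) ∧
        (P.InnerBody A S s u ε z Outcome.terminate → P.toMeas u = ubar) ∧
        (∀ u' ε', P.InnerBody A S s u ε z (Outcome.next u' ε') → u' = P.U (P.newton z)) ∧
        -- the next iterate has the same two properties, and the residual decays quadratically
        P.Near Nbar ν₀ (P.U (P.newton z)) ∧
        P.residual (P.toMeas (P.U (P.newton z))) ≤
          8 * cNew ^ 2 * A.mbar ^ 2 / A.m * P.residual (P.toMeas u) ^ 2 ∧
        -- every configuration reached from here lies in the same inner loop and has a successor,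
        -- unless the algorithm has stopped at the solution
        (∀ c, Relation.ReflTransGen (P.Step A S) (Config.inner k ucoef uk₁ εout Ψ s u ε) c →
          (∃ n u' ε', c = Config.inner k ucoef uk₁ εout Ψ (s + n) u' ε' ∧ P.Near Nbar ν₀ u' ∧
            ∃ c', P.Step A S c c') ∨
          (∃ u', c = Config.done u' ∧ P.toMeas u' = ubar)) ∧
        -- every infinite continuation stays in the inner loop forever, at the quadratic rate
        (∀ c : ℕ → P.Config, c 0 = Config.inner k ucoef uk₁ εout Ψ s u ε →
          (∀ n, P.Step A S (c n) (c (n + 1))) →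
          ∃ (w : ℕ → P.Sparse) (e : ℕ → ℝ), w 0 = u ∧
            ∀ n, c n = Config.inner k ucoef uk₁ εout Ψ (s + n) (w n) (e n) ∧
              (w n).support.card = Nbar ∧
              P.residual (P.toMeas (w (n + 1))) ≤
                8 * cNew ^ 2 * A.mbar ^ 2 / A.m * P.residual (P.toMeas (w n)) ^ 2) := by
  obtain ⟨us, z₀, hus, hz₀, -⟩ := hB.exists_representer
  have hcard := hz₀.1
  obtain ⟨c, ν, hc, hG⟩ := hB.exists_goodRadius hus hcard hκ hF hF' hA
  refine ⟨ν, c, hG.pos, hG.lt_R, hc, hB.newtonContracts hus hcard hG hc, ?_⟩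
  intro S u₁ ε₁ Ψ₁ k ucoef uk₁ εout Ψ s u ε z hgen hu hz hd
  have hM := hB.norm_lt_of_generated_inner hA hgen
  have hr : P.residual (P.toMeas u) ≤ 2 * A.M * ε := (hB.invariant_of_generated hA hgen).2.2
  have hN := hB.newtonStep_of_infDist_lt hus hA hcard hG hc hM hz hd
  obtain ⟨zbar, hzbar, hzb⟩ := (hB.infDist_lt_iff hus hcard).1 hd
  obtain ⟨zbar', hzbar', hzb'⟩ := hN.near
  have hnear := hB.near_of_isMinRep hus hcard hz hzbar hzb
  refine ⟨⟨hN.accept₁, fun uG ε' => hB.accept₂_of_LGCGStep hA hM hN hr,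
    hB.not_leave hA hM hN hr⟩, ⟨hN.drop, hN.merge⟩, hB.next_or_terminate hA hM hN hr,
    hB.eq_of_terminate hA hM hr, fun u' ε' => hN.eq_of_next,
    hB.near_of_isMinRep hus hcard hN.isMinRep hzbar' hzb', hN.quadratic, fun c' hc' => ?_,
    fun f => hB.exists_sequence_of_near hus hA hcard hG hc hgen hnear⟩
  rcases hB.reachable_of_near hus hA hcard hG hc hgen hnear hc' with ⟨n, u', ε', rfl, h1, h2⟩ | h
  · exact .inl ⟨n, u', ε', rfl, h1,
      hB.exists_step_of_near hus hA hcard hG hc hM h1 h2 k ucoef uk₁ εout Ψ⟩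
  · exact .inr h
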